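/- **Theorem 3.7.** Let $H_0,H_1$ be complex Hilbert spaces, $m\ge 1$ and $N\ge m+1$ integers, $d\in\mathbb R$, $\tau>0$. Write $\langle\xi\rangle=(1+|\xi|^2)^{1/2}$. For a Banach space $X$ let $C^\tau(\mathbb R^m;X)$ be the space of $[\tau]$ times continuously differentiable functions $f:\mathbb R^m\to X$ with $$\|f\|_{C^\tau}=\sum_{|\beta|\le[\tau]}\sup_x\|D^\beta f(x)\|_X+\sum_{|\beta|=[\tau]}\sup_{x\ne y}\frac{\|D^\beta f(x)-D^\beta f(y)\|_X}{|x-y|^{\tau-[\tau]}}<\infty ,$$ where $[\tau]$ is the largest integer $\le\tau$. Let $p\in C^\tau S^d_{1,0}(\mathbb R^m\times\mathbb R^m,N;\mathcal L(H_0,H_1))$, that is, $p:\mathbb R^m\times\mathbb R^m\to\mathcal L(H_0,H_1)$ is such that for each $x$ the function $\xi\mapsto p(x,\xi)$ is $N$ times continuously differentiable, and for all multi-indices $|\alpha|\le N$ the functions $x\mapsto D_\xi^\alpha p(x,\xi)$ belong to $C^\tau(\mathbb R^m;\mathcal L(H_0,H_1))$ with $$\|D_\xi^\alpha p(\cdot,\xi)\|_{C^\tau}\le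 C_\alpha\langle\xi\rangle^{d-|\alpha|}\quad\text{for all }\xi\in\mathbb R^m .$$ For a Schwartz function $u\in\mathcal S(\mathbb R^m;H_0)$ put $$\operatorname{OP}(p)u(x)=(2\pi)^{-m}\int_{\mathbb R^m}e^{ix\cdot\xi}\,p(x,\xi)\,\hat u(\xi)\,d\xi,\qquad \hat u(\xi)=\int_{\mathbb R^m}e^{-iy\cdot\xi}u(y)\,dy ,$$ and let $H^s(\mathbb R^m;H)$ be the space of tempered distributions $v$ with values in $H$ for which $\mathcal F^{-1}(\langle\xi\rangle^s\mathcal Fv)\in L_2(\mathbb R^m;H)$, with the $L_2$-norm of this function as norm (up to equivalence). Then $\operatorname{OP}(p)$ is continuous $$\operatorname{OP}(p):H^{s+d}(\mathbb R^m;H_0)\to H^s(\mathbb R^m;H_1)\quad\text{for all } |s|<\tau ;$$ precisely, for all real $s$ with $|s|<\tau$ there are bounded linear operators $P_s:H^{s+d}(\mathbb R^m;H_0)\to H^s(\mathbb R^m;H_1)$ that coincide with $\operatorname{OP}(p)$ on $\mathcal S(\mathbb R^m;H_0)$ and that are consistent with each other ($P_su=P_{s'}u$ for $u\in H^{s+d}\cap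 H^{s'+d}$), and the family $(P_s)_{|s|<\tau}$ is unique. -/

import Mathlib

open MeasureTheory TemperedDistribution
open scoped SchwartzMap ENNReal

noncomputable section

namespace NonsmoothPsiDO

/-- The Euclidean space `ℝᵐ`. -/
abbrev Eu (m : ℕ) : Type := EuclideanSpace ℝ (Fin m)

/-! ### Multi-index derivatives and Hölder spaces -/

section Holder

variable {m : ℕ} {X : Type*} [NormedAddCommGroup X] [NormedSpace ℝ X]

/-- The first order partial derivative `∂ᵢ f`. -/
def pderiv (i : Fin m) (f : Eu m → X) : Eu m → X :=
  fun x ↦ fderiv ℝ f x (EuclideanSpace.single i 1)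

/-- The partial derivative `∂^β f = ∂₁^{β₁} ⋯ ∂ₘ^{βₘ} f` for a multi-index `β`. (It differs from
`D^β f`, where `D = -i ∂`, by the factor `i ^ |β|`, which is irrelevant for norms.) -/
def mderiv (β : Fin m → ℕ) (f : Eu m → X) : Eu m → X :=
  (List.finRange m).foldr (fun i g ↦ (pderiv i)^[β i] g) f

/-- The `C^τ`-norm of `f`, with values in `[0, ∞]`:
`∑_{|β| ≤ [τ]} sup_x ‖∂^β f(x)‖
  + ∑_{|β| = [τ]} sup_{x ≠ y} ‖∂^β f(x) - ∂^β f(y)‖ / |x - y| ^ (τ - [τ])`.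
The finite set `Finset.piAntidiag Finset.univ j` consists of the multi-indices of length `j`. -/
def holderENorm (τ : ℝ) (f : Eu m → X) : ℝ≥0∞ :=
  (∑ j ∈ Finset.range (⌊τ⌋₊ + 1), ∑ β ∈ Finset.piAntidiag (Finset.univ : Finset (Fin m)) j,
    ⨆ x : Eu m, ‖mderiv β f x‖ₑ) +
  ∑ β ∈ Finset.piAntidiag (Finset.univ : Finset (Fin m)) ⌊τ⌋₊,
    ⨆ (x : Eu m) (y : Eu m) (_ : x ≠ y),
      ‖mderiv β f x - mderiv β f y‖ₑ / ENNReal.ofReal (‖x - y‖ ^ (τ - (⌊τ⌋₊ : ℝ)))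

/-- The symbol class `C^τ S^d_{1,0}(ℝᵐ × ℝᵐ, N; X)`: the functions `p(x, ξ)` that are `N` times
continuously differentiable in `ξ`, with `∂_ξ^α p(·, ξ) ∈ C^τ(ℝᵐ; X)` and
`‖∂_ξ^α p(·, ξ)‖_{C^τ} = O(⟨ξ⟩^{d - |α|})` on `ℝᵐ` for all `|α| ≤ N`,
where `⟨ξ⟩ = (1 + |ξ|²)^{1/2}`. -/
structure IsSymbol (τ d : ℝ) (N : ℕ) (p : Eu m → Eu m → X) : Prop where
  contDiff_right : ∀ x, ContDiff ℝ N (p x)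
  contDiff_left : ∀ α : Fin m → ℕ, ∑ i, α i ≤ N → ∀ ξ,
    ContDiff ℝ ⌊τ⌋₊ (fun x ↦ mderiv α (p x) ξ)
  bound : ∀ α : Fin m → ℕ, ∑ i, α i ≤ N → ∃ C : ℝ, ∀ ξ : Eu m,
    holderENorm τ (fun x ↦ mderiv α (p x) ξ) ≤
      ENNReal.ofReal (C * (1 + ‖ξ‖ ^ 2) ^ ((d - ((∑ i, α i : ℕ) : ℝ)) / 2))

end Holder

/-! ### Vector-valued Sobolev spaces -/

section Sobolev

variable {m : ℕ} {F : Type*} [NormedAddCommGroup F] [NormedSpace ℂ F] [CompleteSpace F]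

variable (m F) in
/-- The tempered distributions that belong to `H^s(ℝᵐ; F)`, as a linear subspace. -/
def sobolevSubmodule (s : ℝ) : Submodule ℂ 𝓢'(Eu m, F) where
  carrier := {u | MemSobolev s 2 u}
  zero_mem' := memSobolev_fun_zero _ _ s 2
  add_mem' := MemSobolev.add
  smul_mem' c _ hu := hu.smul c

variable (m F) in
/-- The `L₂`-Sobolev space `H^s(ℝᵐ; F)` of tempered distributions. It is not an abbreviation of the
subspace of `𝓢'`, because it carries its own norm topology. -/
def SobolevSpace (s : ℝ) : Type _ := sobolevSubmodule m F s

namespace SobolevSpace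

instance (s : ℝ) : AddCommGroup (SobolevSpace m F s) :=
  inferInstanceAs (AddCommGroup (sobolevSubmodule m F s))

instance (s : ℝ) : Module ℂ (SobolevSpace m F s) :=
  inferInstanceAs (Module ℂ (sobolevSubmodule m F s))

/-- The inclusion `H^s(ℝᵐ; F) ⊆ 𝓢'(ℝᵐ; F)`. -/
def toDistribution {s : ℝ} : SobolevSpace m F s →ₗ[ℂ] 𝓢'(Eu m, F) :=
  (sobolevSubmodule m F s).subtype

theorem toDistribution_injective {s : ℝ} :
    Function.Injective (toDistribution : SobolevSpace m F s → 𝓢'(Eu m, F)) :=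
  (sobolevSubmodule m F s).injective_subtype

theorem memSobolev {s : ℝ} (u : SobolevSpace m F s) : MemSobolev s 2 (toDistribution u) :=
  Subtype.property (p := (· ∈ sobolevSubmodule m F s)) u

/-- A tempered distribution that belongs to `H^s`, as an element of `H^s(ℝᵐ; F)`. -/
def mk {s : ℝ} (u : 𝓢'(Eu m, F)) (hu : MemSobolev s 2 u) : SobolevSpace m F s :=
  (⟨u, hu⟩ : sobolevSubmodule m F s)

@[simp]
theorem toDistribution_mk {s : ℝ} (u : 𝓢'(Eu m, F)) (hu : MemSobolev s 2 u) :
    toDistribution (mk u hu) = u := rfl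

/-- A Schwartz function as an element of `H^s(ℝᵐ; F)`. -/
def ofSchwartz (s : ℝ) (f : 𝓢(Eu m, F)) : SobolevSpace m F s :=
  mk (f.toTemperedDistributionCLM (Eu m) F volume) f.memSobolev

@[simp]
theorem toDistribution_ofSchwartz (s : ℝ) (f : 𝓢(Eu m, F)) :
    toDistribution (ofSchwartz s f) = f.toTemperedDistributionCLM (Eu m) F volume := rfl

theorem Lp_toTemperedDistribution_injective :
    Function.Injective (Lp.toTemperedDistributionCLM F (volume : Measure (Eu m)) 2) :=
  LinearMap.ker_eq_bot.mp Lp.ker_toTemperedDistributionCLM_eq_bot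

/-- The `L₂`-function `⟨D⟩^s u = 𝓕⁻¹(⟨ξ⟩^s 𝓕 u)` of `u ∈ H^s(ℝᵐ; F)`. -/
def toL2Fun {s : ℝ} (u : SobolevSpace m F s) : Lp F 2 (volume : Measure (Eu m)) :=
  Classical.choose u.memSobolev

theorem toL2Fun_spec {s : ℝ} (u : SobolevSpace m F s) :
    besselPotential (Eu m) F s (toDistribution u) =
      Lp.toTemperedDistributionCLM F (volume : Measure (Eu m)) 2 (toL2Fun u) :=
  Classical.choose_spec u.memSobolev

/-- The map `u ↦ ⟨D⟩^s u` from `H^s(ℝᵐ; F)` to `L₂(ℝᵐ; F)`, as a linear map. -/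
def toL2 {s : ℝ} : SobolevSpace m F s →ₗ[ℂ] Lp F 2 (volume : Measure (Eu m)) where
  toFun := toL2Fun
  map_add' u v := Lp_toTemperedDistribution_injective <| by
    rw [map_add, ← toL2Fun_spec, ← toL2Fun_spec, ← toL2Fun_spec, map_add, map_add]
  map_smul' c u := Lp_toTemperedDistribution_injective <| by
    rw [map_smul, ← toL2Fun_spec, ← toL2Fun_spec, map_smul, map_smul, RingHom.id_apply]

theorem toL2_spec {s : ℝ} (u : SobolevSpace m F s) :
    besselPotential (Eu m) F s (toDistribution u) =
      Lp.toTemperedDistributionCLM F (volume : Measure (Eu m)) 2 (toL2 u) :=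
  toL2Fun_spec u

theorem toL2_injective {s : ℝ} :
    Function.Injective (toL2 : SobolevSpace m F s → Lp F 2 (volume : Measure (Eu m))) := by
  intro u v h
  apply toDistribution_injective
  have h' : besselPotential (Eu m) F s (toDistribution u) =
      besselPotential (Eu m) F s (toDistribution v) := by rw [toL2_spec, toL2_spec, h]
  simpa using congrArg (besselPotential (Eu m) F (-s)) h'

/-- The norm of `H^s(ℝᵐ; F)` is `‖u‖_s = ‖𝓕⁻¹(⟨ξ⟩^s 𝓕 u)‖_{L₂(ℝᵐ; F)}`. The Fourier transform in
the Bessel potential is Mathlib's, with kernel `exp(-2πi x·ξ)`; the kernel `exp(-i x·ξ)` gives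
the same space with an equivalent norm. -/
instance (s : ℝ) : NormedAddCommGroup (SobolevSpace m F s) :=
  NormedAddCommGroup.induced _ _ (toL2 : SobolevSpace m F s →ₗ[ℂ] _) toL2_injective

instance (s : ℝ) : NormedSpace ℂ (SobolevSpace m F s) :=
  NormedSpace.induced ℂ _ _ (toL2 : SobolevSpace m F s →ₗ[ℂ] _)

theorem norm_eq {s : ℝ} (u : SobolevSpace m F s) : ‖u‖ = ‖toL2 u‖ := rfl

end SobolevSpace

/-- The tempered distribution `u` is (integration against) the function `g`. -/
def IsRepresentedBy (u : 𝓢'(Eu m, F)) (g : Eu m → F) : Prop :=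
  ∀ φ : 𝓢(Eu m, ℂ), Integrable (fun x ↦ φ x • g x) ∧ u φ = ∫ x, φ x • g x

end Sobolev

/-! ### Pseudodifferential operators -/

section Operators

variable {m : ℕ} {H₀ H₁ : Type*}
  [NormedAddCommGroup H₀] [NormedSpace ℂ H₀] [NormedAddCommGroup H₁] [NormedSpace ℂ H₁]

/-- The Fourier transform `û(ξ) = ∫ e^{-i y·ξ} u(y) dy`. -/
def fourierHat (u : Eu m → H₀) (ξ : Eu m) : H₀ :=
  ∫ y, Complex.exp (-Complex.I * (inner ℝ y ξ : ℝ)) • u y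

/-- The action of the pseudodifferential operator with symbol `p` on a Schwartz function `u`:
`OP(p)u(x) = (2π)^{-m} ∫ e^{i x·ξ} p(x, ξ) û(ξ) dξ = ∫∫ e^{i(x-y)·ξ} p(x, ξ) u(y) dy đξ`. -/
def OP (p : Eu m → Eu m → H₀ →L[ℂ] H₁) (u : 𝓢(Eu m, H₀)) (x : Eu m) : H₁ :=
  ((2 * Real.pi : ℂ) ^ m)⁻¹ •
    ∫ ξ, Complex.exp (Complex.I * (inner ℝ x ξ : ℝ)) • p x ξ (fourierHat u ξ)

end Operators

end NonsmoothPsiDO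

end

noncomputable section

open FourierTransform Filter Topology

namespace NonsmoothPsiDO

/-! ### Iterated partial derivatives and Hölder bounds. -/

section PartialDerivatives

variable {m : ℕ} {X : Type*} [NormedAddCommGroup X] [NormedSpace ℝ X]

/-! The heart of the matter is the form estimate `|∫ ⟨g, OP(p)f⟩| ≤ C ‖g‖_{H^{-s}} ‖f‖_{H^{s+d}}`
for Schwartz functions (`IsSymbol.exists_norm_integral_inner_OP_le`). It is proved by cutting `f`
and `g` into dyadic frequency pieces `f_j`, `g_l` and showing that the pairing of `g_l` with
`OP(p)f_j` is at most `C 2^{jd} 2^{-τ|l-j|}` times the product of the `L₂`-norms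
(`IsSymbol.exists_dyadic_estimate`). Distributing the weights `2^{j(s+d)}` and `2^{-ls}` costs at
most `2^{|s||l-j|}`, so for `|s| < τ` the geometrically decaying kernel `2^{-(τ-|s|)|l-j|}` remains.
Schur's test and the almost orthogonality of the pieces then sum the double series.

The dyadic estimate separates the two variables of the symbol. On the shell `|η| ~ 2^j` the symbol
may be multiplied by a cutoff, rescaled to unit size and Fourier transformed in the frequency, which
gives `OP(p)f_j(x) = ∫ K_j(x,w) f_j(x + 2^{-j}w) dw`. Integration by parts `m+1` times bounds
`K_j(·,w)`, in a Hölder type class in `x`, by `2^{jd}(1+|w|)^{-(m+1)}`, which is integrable in `w`;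
this is the role of `N ≥ m+1`. Translations being isometries, only multiplication by a single
operator valued Hölder function `a` is left (`norm_integral_inner_OP_le`).

For such an `a`, mollification at scale `ε` with a kernel whose Fourier transform is `1` near the
origin and `0` outside the unit ball changes `a` by `O(ε^τ)` (`exists_norm_mollify_sub_le`). The
mollified function has frequencies of size at most `1/ε`, so it pairs to zero with functions whose
frequencies are at least `1/ε` apart (`integral_inner_mollify_eq_zero`). Taking `ε ~ 2^{-max(j,l)}`
gives the decay.

Finally, the Riesz theorem converts the form estimate into `OP(p)f ∈ H^s` with a norm bound
(`exists_memSobolev_of_bounded`). Density of the Schwartz functions in every `H^s` yields the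
extension, its uniqueness and, since `H^s` embeds continuously into the tempered distributions, the
consistency. -/

theorem contDiff_pderiv {n : ℕ} {f : Eu m → X} (hf : ContDiff ℝ (n + 1 : ℕ) f) (i : Fin m) :
    ContDiff ℝ n (pderiv i f) :=
  (hf.fderiv_right (m := (n : WithTop ℕ∞)) (by norm_cast)).clm_apply contDiff_const

theorem contDiff_pderiv_iterate {n : ℕ} (k : ℕ) {f : Eu m → X}
    (hf : ContDiff ℝ (n + k : ℕ) f) (i : Fin m) : ContDiff ℝ n ((pderiv i)^[k] f) := by
  induction k generalizing f with
  | zero => simpa using hf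
  | succ k ih =>
    rw [Function.iterate_succ_apply]
    exact ih (contDiff_pderiv (n := n + k) hf i)

theorem pderiv_comm {f : Eu m → X} (hf : ContDiff ℝ 2 f) (i j : Fin m) :
    pderiv i (pderiv j f) = pderiv j (pderiv i f) := by
  have h1 : ∀ x, DifferentiableAt ℝ (fderiv ℝ f) x := fun x ↦
    ((hf.fderiv_right (m := 1) (by norm_num)).differentiable (by norm_num)) x
  have h2 : ∀ (k l : Fin m) x, pderiv k (pderiv l f) x =
      fderiv ℝ (fderiv ℝ f) x (EuclideanSpace.single k 1) (EuclideanSpace.single l 1) := by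
    intro k l x
    have := (h1 x).hasFDerivAt.clm_apply
      (hasFDerivAt_const (EuclideanSpace.single l (1 : ℝ)) x)
    change fderiv ℝ (fun y ↦ fderiv ℝ f y (EuclideanSpace.single l 1)) x _ = _
    rw [this.fderiv]
    simp
  ext x
  rw [h2, h2]
  exact (hf.contDiffAt (x := x)).isSymmSndFDerivAt (by simp) _ _

theorem pderiv_iterate_comm (k : ℕ) {f : Eu m → X} (hf : ContDiff ℝ (k + 1 : ℕ) f)
    (i j : Fin m) : pderiv j ((pderiv i)^[k] f) = (pderiv i)^[k] (pderiv j f) := by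
  induction k generalizing f with
  | zero => rfl
  | succ k ih =>
    rw [Function.iterate_succ_apply, Function.iterate_succ_apply,
      ih (contDiff_pderiv hf i), pderiv_comm (hf.of_le (by norm_cast; omega))]

/-- The iterated partial derivatives in the directions of a list. -/
def listDeriv (l : List (Fin m)) (β : Fin m → ℕ) (f : Eu m → X) : Eu m → X :=
  l.foldr (fun i g ↦ (pderiv i)^[β i] g) f

theorem listDeriv_cons (i : Fin m) (l : List (Fin m)) (β : Fin m → ℕ) (f : Eu m → X) :
    listDeriv (i :: l) β f = (pderiv i)^[β i] (listDeriv l β f) := rfl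

theorem contDiff_listDeriv {k : ℕ} (l : List (Fin m)) (β : Fin m → ℕ) {f : Eu m → X}
    (hf : ContDiff ℝ (k + (l.map β).sum : ℕ) f) : ContDiff ℝ k (listDeriv l β f) := by
  induction l generalizing k with
  | nil => simpa [listDeriv] using hf
  | cons i l ih =>
    rw [listDeriv_cons]
    refine contDiff_pderiv_iterate _ (ih ?_) i
    simpa [add_assoc] using hf

theorem pderiv_listDeriv (l : List (Fin m)) (β : Fin m → ℕ) {f : Eu m → X}
    (hf : ContDiff ℝ (1 + (l.map β).sum : ℕ) f) (j : Fin m) :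
    pderiv j (listDeriv l β f) = listDeriv l β (pderiv j f) := by
  induction l with
  | nil => rfl
  | cons i l ih =>
    rw [listDeriv_cons, listDeriv_cons, pderiv_iterate_comm, ih (hf.of_le _)]
    · norm_cast; simp only [List.map_cons, List.sum_cons]; omega
    · refine contDiff_listDeriv _ _ (hf.of_le ?_)
      norm_cast; simp only [List.map_cons, List.sum_cons]; omega

theorem listDeriv_congr (l : List (Fin m)) {β γ : Fin m → ℕ} (h : ∀ i ∈ l, β i = γ i)
    (f : Eu m → X) : listDeriv l β f = listDeriv l γ f := by
  induction l with
  | nil => rfl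
  | cons i l ih =>
    rw [listDeriv_cons, listDeriv_cons, h i (by simp), ih fun j hj ↦ h j (by simp [hj])]

theorem listDeriv_pderiv (l : List (Fin m)) (hl : l.Nodup) (β : Fin m → ℕ) {f : Eu m → X}
    (hf : ContDiff ℝ (1 + (l.map β).sum : ℕ) f) (j : Fin m) (hj : j ∈ l) :
    listDeriv l β (pderiv j f) = listDeriv l (β + Pi.single j 1) f := by
  induction l with
  | nil => simp at hj
  | cons i l ih =>
    have hf' : ContDiff ℝ (1 + (l.map β).sum : ℕ) f := by
      refine hf.of_le ?_
      norm_cast; simp only [List.map_cons, List.sum_cons]; omega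
    rw [List.nodup_cons] at hl
    rw [listDeriv_cons, listDeriv_cons]
    rcases eq_or_ne j i with rfl | hji
    · rw [listDeriv_congr l (β := β + Pi.single j 1) (γ := β), ← pderiv_listDeriv l β hf']
      · simp
      · intro k hk
        have : k ≠ j := by rintro rfl; exact hl.1 hk
        simp [this]
    · rw [ih hl.2 hf' (by simpa [hji] using hj)]
      simp [hji.symm]

theorem mderiv_pderiv {β : Fin m → ℕ} {f : Eu m → X} (hf : ContDiff ℝ (∑ i, β i + 1 : ℕ) f)
    (j : Fin m) : mderiv β (pderiv j f) = mderiv (β + Pi.single j 1) f := by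
  refine listDeriv_pderiv _ (List.nodup_finRange m) β ?_ j (List.mem_finRange j)
  rwa [add_comm, ← Fin.sum_univ_def]

theorem mderiv_zero (f : Eu m → X) : mderiv 0 f = f := by
  have : ∀ l : List (Fin m), listDeriv l 0 f = f := by
    intro l
    induction l with
    | nil => rfl
    | cons i l ih => rw [listDeriv_cons, ih]; rfl
  exact this _

theorem mderiv_single (i : Fin m) (k : ℕ) (f : Eu m → X) :
    mderiv (Pi.single i k) f = (pderiv i)^[k] f := by
  have h0 : ∀ l : List (Fin m), i ∉ l → listDeriv l (Pi.single i k) f = f := by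
    intro l hl
    induction l with
    | nil => rfl
    | cons j l ih =>
      have hji : j ≠ i := by rintro rfl; simp at hl
      rw [listDeriv_cons, ih (by simp at hl; exact hl.2)]
      simp [hji]
  have h1 : ∀ l : List (Fin m), l.Nodup → i ∈ l →
      listDeriv l (Pi.single i k) f = (pderiv i)^[k] f := by
    intro l hl hi
    induction l with
    | nil => simp at hi
    | cons j l ih =>
      rw [List.nodup_cons] at hl
      rw [listDeriv_cons]
      rcases eq_or_ne i j with rfl | hji
      · rw [h0 l hl.1]; simp
      · rw [ih hl.2 (by simpa [hji] using hi)]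
        simp [hji.symm]
  exact h1 _ (List.nodup_finRange m) (List.mem_finRange i)

/-- `f` is `n` times continuously differentiable, the derivatives up to order `n` are bounded
by `M`, and those of order `n` are Hölder continuous of exponent `θ` with constant `M`. -/
structure HolderBound (n : ℕ) (θ M : ℝ) (f : Eu m → X) : Prop where
  contDiff : ContDiff ℝ n f
  bound : ∀ β : Fin m → ℕ, ∑ i, β i ≤ n → ∀ x, ‖mderiv β f x‖ ≤ M
  holder : ∀ β : Fin m → ℕ, ∑ i, β i = n → ∀ x y,
    ‖mderiv β f x - mderiv β f y‖ ≤ M * ‖x - y‖ ^ θ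

theorem HolderBound.norm_le {n : ℕ} {θ M : ℝ} {f : Eu m → X} (h : HolderBound n θ M f)
    (x : Eu m) : ‖f x‖ ≤ M := by
  simpa [mderiv_zero] using h.bound 0 (by simp) x

theorem HolderBound.of_pderiv {n : ℕ} {θ M : ℝ} {f : Eu m → X} (h : HolderBound (n + 1) θ M f)
    (i : Fin m) : HolderBound n θ M (pderiv i f) := by
  have hs : ∀ β : Fin m → ℕ, ∑ j, (β + Pi.single i 1 : Fin m → ℕ) j = ∑ j, β j + 1 := fun β ↦ by
    simp [Finset.sum_add_distrib]
  refine ⟨contDiff_pderiv h.contDiff i, fun β hβ x ↦ ?_, fun β hβ x y ↦ ?_⟩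
  · rw [mderiv_pderiv (h.contDiff.of_le (by norm_cast; omega))]
    exact h.bound _ (by rw [hs]; omega) x
  · rw [mderiv_pderiv (h.contDiff.of_le (by norm_cast; omega))]
    exact h.holder _ (by rw [hs]; omega) x y

/-- Every supremum is one of finitely many nonnegative summands of the norm, so the total bounds
each of them. -/
theorem holderBound_of_holderENorm_le {τ M : ℝ} (hM : 0 ≤ M) {f : Eu m → X}
    (hf : ContDiff ℝ ⌊τ⌋₊ f) (h : holderENorm τ f ≤ ENNReal.ofReal M) :
    HolderBound ⌊τ⌋₊ (τ - (⌊τ⌋₊ : ℝ)) M f := by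
  have hmem : ∀ β : Fin m → ℕ, β ∈ Finset.piAntidiag Finset.univ (∑ i, β i) := fun β ↦ by
    simp [Finset.mem_piAntidiag]
  refine ⟨hf, fun β hβ x ↦ ?_, fun β hβ x y ↦ ?_⟩
  · have h1 : ‖mderiv β f x‖ₑ ≤ ENNReal.ofReal M := by
      refine le_trans ?_ (le_trans le_self_add h)
      refine le_trans ?_ (Finset.single_le_sum (f := fun j ↦
        ∑ β ∈ Finset.piAntidiag (Finset.univ : Finset (Fin m)) j, ⨆ x : Eu m, ‖mderiv β f x‖ₑ)
        (fun _ _ ↦ zero_le) (Finset.mem_range.2 (Nat.lt_succ_of_le hβ)))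
      refine le_trans ?_ (Finset.single_le_sum (f := fun β ↦ ⨆ x : Eu m, ‖mderiv β f x‖ₑ)
        (fun _ _ ↦ zero_le) (hmem β))
      exact le_iSup (fun x ↦ ‖mderiv β f x‖ₑ) x
    rwa [← ofReal_norm, ENNReal.ofReal_le_ofReal_iff hM] at h1
  · rcases eq_or_ne x y with rfl | hxy
    · simp only [sub_self, norm_zero]; positivity
    have hpos : 0 < ‖x - y‖ ^ (τ - (⌊τ⌋₊ : ℝ)) :=
      Real.rpow_pos_of_pos (norm_pos_iff.2 (sub_ne_zero.2 hxy)) _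
    have h1 : ‖mderiv β f x - mderiv β f y‖ₑ / ENNReal.ofReal (‖x - y‖ ^ (τ - (⌊τ⌋₊ : ℝ)))
        ≤ ENNReal.ofReal M := by
      refine le_trans ?_ (le_trans le_add_self h)
      refine le_trans ?_ (Finset.single_le_sum (f := fun β ↦
        ⨆ (x : Eu m) (y : Eu m) (_ : x ≠ y), ‖mderiv β f x - mderiv β f y‖ₑ /
          ENNReal.ofReal (‖x - y‖ ^ (τ - (⌊τ⌋₊ : ℝ))))
        (fun _ _ ↦ zero_le) (hβ ▸ hmem β))
      exact le_iSup_of_le x (le_iSup_of_le y (le_iSup_of_le hxy le_rfl))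
    rw [← ofReal_norm, ← ENNReal.ofReal_div_of_pos hpos, ENNReal.ofReal_le_ofReal_iff hM,
      div_le_iff₀ hpos] at h1
    exact h1

end PartialDerivatives

/-! ### Approximation of Hölder functions by mollification. -/

section Mollification

variable {m : ℕ} {X : Type*} [NormedAddCommGroup X] [NormedSpace ℂ X]

theorem integrable_smul_of_bounded (φ : 𝓢(Eu m, ℂ)) {b : Eu m → X} {M : ℝ} (hb : Continuous b)
    (hM : ∀ x, ‖b x‖ ≤ M) : Integrable fun y ↦ φ y • b y := by
  refine (φ.integrable.norm.mul_const M).mono' (φ.continuous.smul hb).aestronglyMeasurable ?_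
  filter_upwards with y
  rw [norm_smul]
  gcongr
  exact hM y

/-- The Schwartz function `y ↦ yᵢ φ(y)`. -/
def coordMul (i : Fin m) (φ : 𝓢(Eu m, ℂ)) : 𝓢(Eu m, ℂ) :=
  SchwartzMap.smulLeftCLM ℂ (fun x : Eu m ↦ inner ℝ x (EuclideanSpace.single i 1)) φ

theorem coordMul_apply (i : Fin m) (φ : 𝓢(Eu m, ℂ)) (y : Eu m) :
    coordMul i φ y = (y i : ℂ) * φ y := by
  rw [coordMul, SchwartzMap.smulLeftCLM_apply_apply (by fun_prop)]
  simp [EuclideanSpace.inner_single_right]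

/-- Multiplication by a coordinate is, up to a factor, differentiation of the Fourier transform, and
a locally constant function has derivative zero. The induction for the mollification error thus
stays within the same class of kernels, with constant `0` after the first step. -/
theorem fourier_coordMul_eventuallyEq (i : Fin m) {φ : 𝓢(Eu m, ℂ)} {c : ℂ}
    (h : (𝓕 φ : 𝓢(Eu m, ℂ)) =ᶠ[𝓝 0] fun _ ↦ c) :
    (𝓕 (coordMul i φ) : 𝓢(Eu m, ℂ)) =ᶠ[𝓝 0] fun _ ↦ (0 : ℂ) := by
  have h1 := SchwartzMap.lineDerivOp_fourier_eq φ (EuclideanSpace.single i (1 : ℝ))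
  rw [FourierTransform.fourier_smul] at h1
  have h2 : ∀ᶠ x in 𝓝 (0 : Eu m), fderiv ℝ (𝓕 φ : 𝓢(Eu m, ℂ)) x = 0 := by
    filter_upwards [h.eventuallyEq_nhds] with x hx
    rw [hx.fderiv_eq]; simp
  filter_upwards [h2] with x hx
  have h3 := congrArg (fun ψ : 𝓢(Eu m, ℂ) ↦ ψ x) h1
  simp only [SchwartzMap.lineDerivOp_apply_eq_fderiv, hx] at h3
  have h4 : (0 : ℂ) = -(2 * Real.pi * Complex.I) * (𝓕 (coordMul i φ) : 𝓢(Eu m, ℂ)) x := by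
    simpa [coordMul] using h3
  rcases mul_eq_zero.1 h4.symm with h5 | h5
  · simp [Real.pi_ne_zero] at h5
  · exact h5

theorem integral_eq_of_fourier_eventuallyEq {φ : 𝓢(Eu m, ℂ)} {c : ℂ}
    (h : (𝓕 φ : 𝓢(Eu m, ℂ)) =ᶠ[𝓝 0] fun _ ↦ c) : ∫ y, φ y = c := by
  have h1 := h.eq_of_nhds
  rw [SchwartzMap.fourier_coe, Real.fourier_eq] at h1
  simpa using h1

theorem fderiv_apply_eq_sum_pderiv (a : Eu m → X) (x y : Eu m) :
    fderiv ℝ a x y = ∑ i, (y i : ℂ) • pderiv i a x := by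
  conv_lhs => rw [← (EuclideanSpace.basisFun (Fin m) ℝ).sum_repr y]
  simp [pderiv]

theorem hasDerivAt_mollify (φ : 𝓢(Eu m, ℂ)) {a : Eu m → X} {M : ℝ} (ha : ContDiff ℝ 1 a)
    (hb : ∀ x, ‖a x‖ ≤ M) (hd : ∀ i x, ‖pderiv i a x‖ ≤ M) (x : Eu m) (t : ℝ) :
    HasDerivAt (fun t : ℝ ↦ ∫ y, φ y • a (x + t • y))
      (∑ i, ∫ y, coordMul i φ y • pderiv i a (x + t • y)) t := by
  have hcont : ∀ t : ℝ, Continuous fun y ↦ a (x + t • y) := fun t ↦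
    ha.continuous.comp (by fun_prop)
  have hpc : ∀ i, Continuous (pderiv i a) := fun i ↦
    (contDiff_pderiv (n := 0) (by simpa using ha) i).continuous
  have hI : ∀ i, Integrable fun y ↦ coordMul i φ y • pderiv i a (x + t • y) := fun i ↦
    integrable_smul_of_bounded _ ((hpc i).comp (by fun_prop)) (fun y ↦ hd i _)
  rw [← integral_finsetSum _ fun i _ ↦ hI i]
  refine (hasDerivAt_integral_of_dominated_loc_of_deriv_le
    (F' := fun t y ↦ ∑ i, coordMul i φ y • pderiv i a (x + t • y))
    (bound := fun y ↦ ∑ i, ‖coordMul i φ y‖ * M) (s := Set.univ) Filter.univ_mem ?_ ?_ ?_ ?_ ?_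
    ?_).2
  · exact Eventually.of_forall fun t ↦
      (φ.continuous.smul (hcont t)).aestronglyMeasurable
  · exact integrable_smul_of_bounded φ (hcont t) fun y ↦ hb _
  · refine Continuous.aestronglyMeasurable (continuous_finsetSum _ fun i _ ↦ ?_)
    exact (coordMul i φ).continuous.smul ((hpc i).comp (by fun_prop))
  · filter_upwards with y t _
    refine (norm_sum_le _ _).trans (Finset.sum_le_sum fun i _ ↦ ?_)
    rw [norm_smul]
    gcongr
    exact hd i _
  · exact integrable_finsetSum _ fun i _ ↦ (coordMul i φ).integrable.norm.mul_const M
  · filter_upwards with y t _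
    have h1 : HasDerivAt (fun t : ℝ ↦ x + t • y) y t := by
      simpa using ((hasDerivAt_id t).smul_const y).const_add x
    have h2 := ((ha.differentiable (by norm_num)) (x + t • y)).hasFDerivAt.comp_hasDerivAt t h1
    convert! h2.const_smul (φ y) using 1
    rw [fderiv_apply_eq_sum_pderiv, Finset.smul_sum]
    refine Finset.sum_congr rfl fun i _ ↦ ?_
    rw [coordMul_apply, smul_smul, mul_comm]

theorem HolderBound.nonneg {n : ℕ} {θ M : ℝ} {f : Eu m → X} (h : HolderBound n θ M f) :
    0 ≤ M := (norm_nonneg _).trans (h.norm_le 0)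

/-- Mollification by a Schwartz function whose Fourier transform is constant near the origin
approximates Hölder continuous functions to the optimal order. -/
theorem exists_norm_mollify_sub_le [CompleteSpace X] (n : ℕ) {θ : ℝ} (hθ : 0 ≤ θ) (hθ1 : θ ≤ 1) :
    ∀ (φ : 𝓢(Eu m, ℂ)) (c : ℂ), ((𝓕 φ : 𝓢(Eu m, ℂ)) =ᶠ[𝓝 0] fun _ ↦ c) →
    ∃ C : ℝ, 0 ≤ C ∧ ∀ (M : ℝ) (a : Eu m → X), HolderBound n θ M a → ∀ (x : Eu m) (ε : ℝ), 0 ≤ ε →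
      ‖(∫ y, φ y • a (x + ε • y)) - c • a x‖ ≤ C * M * ε ^ (n + θ) := by
  induction n with
  | zero =>
    intro φ c h
    have hint : Integrable fun y : Eu m ↦ ‖φ y‖ * (1 + ‖y‖) := by
      have := φ.integrable.norm.add (φ.integrable_pow_mul volume 1)
      refine this.congr (Eventually.of_forall fun y ↦ ?_)
      simp only [Pi.add_apply]; ring
    -- The weight `1 + ‖y‖` dominates `‖y‖ ^ θ` because `0 ≤ θ ≤ 1`.
    refine ⟨∫ y, ‖φ y‖ * (1 + ‖y‖), integral_nonneg fun y ↦ by positivity, ?_⟩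
    intro M a ha x ε hε
    have hM := ha.nonneg
    have hac : Continuous a := ha.contDiff.continuous
    rw [← integral_eq_of_fourier_eventuallyEq h, ← integral_smul_const,
      ← integral_sub (integrable_smul_of_bounded φ (b := fun y ↦ a (x + ε • y)) (hac.comp (by fun_prop))
          fun y ↦ ha.norm_le _)
        (φ.integrable.smul_const _), Nat.cast_zero, zero_add, mul_assoc, ← integral_mul_const]
    refine norm_integral_le_of_norm_le (hint.mul_const _) (Eventually.of_forall fun y ↦ ?_)
    rw [← smul_sub, norm_smul, mul_assoc]
    gcongr
    have h1 := ha.holder 0 (by simp) (x + ε • y) x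
    rw [mderiv_zero, add_sub_cancel_left, norm_smul, Real.norm_of_nonneg hε,
      Real.mul_rpow hε (norm_nonneg _)] at h1
    refine h1.trans ?_
    have h2 : ‖y‖ ^ θ ≤ 1 + ‖y‖ := by
      calc ‖y‖ ^ θ ≤ (1 + ‖y‖) ^ θ := by gcongr; linarith
        _ ≤ (1 + ‖y‖) ^ (1 : ℝ) := Real.rpow_le_rpow_of_exponent_le (by simp) hθ1
        _ = _ := Real.rpow_one _
    calc M * (ε ^ θ * ‖y‖ ^ θ) ≤ M * (ε ^ θ * (1 + ‖y‖)) := by gcongr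
      _ = _ := by ring
  | succ n ih =>
    intro φ c h
    -- The `t`-derivative of `∫ φ(y) a(x + ty) dy` is a sum of mollifications of the `∂ᵢ a` with
    -- kernels `yᵢ φ(y)`. These have one order of smoothness less and constant `0`, so the
    -- derivative is `O(t^{n+θ})`; the mean value inequality on `[0, ε]` supplies the missing power
    -- of `ε`.
    choose C hC0 hC using fun i ↦ ih (coordMul i φ) 0 (fourier_coordMul_eventuallyEq i h)
    refine ⟨∑ i, C i, Finset.sum_nonneg fun i _ ↦ hC0 i, ?_⟩
    intro M a ha x ε hε
    have hM := ha.nonneg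
    have ha1 : ContDiff ℝ 1 a := ha.contDiff.of_le (by norm_cast; omega)
    have hder := hasDerivAt_mollify φ ha1 ha.norm_le (fun i ↦ (ha.of_pderiv i).norm_le) x
    have h0 : ∫ y, φ y • a (x + (0 : ℝ) • y) = c • a x := by
      simp only [zero_smul, add_zero]
      rw [integral_smul_const, integral_eq_of_fourier_eventuallyEq h]
    rw [← h0]
    have := norm_image_sub_le_of_norm_deriv_le_segment' (a := 0) (b := ε)
      (C := (∑ i, C i) * M * ε ^ (n + θ)) (fun t _ ↦ (hder t).hasDerivWithinAt) ?_ ε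
      (Set.right_mem_Icc.2 hε)
    · refine this.trans (le_of_eq ?_)
      rw [sub_zero, mul_assoc, Nat.cast_succ, add_right_comm,
        Real.rpow_add_one' hε (by positivity)]
    · intro t ht
      refine (norm_sum_le _ _).trans ?_
      rw [Finset.sum_mul, Finset.sum_mul]
      refine Finset.sum_le_sum fun i _ ↦ ?_
      have h1 := hC i M _ (ha.of_pderiv i) x t ht.1
      rw [zero_smul, sub_zero] at h1
      refine h1.trans ?_
      have := hC0 i
      have := ht.1
      gcongr
      exact ht.2.le

/-- `a` is continuous, bounded by `M`, and approximated by its mollifications at scale `ε` with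
an error of at most `M ε^τ`. -/
structure ApproxBound (φ : 𝓢(Eu m, ℂ)) (τ M : ℝ) (a : Eu m → X) : Prop where
  continuous : Continuous a
  norm_le : ∀ x, ‖a x‖ ≤ M
  approx : ∀ ε : ℝ, 0 < ε → ε ≤ 1 → ∀ x, ‖a x - ∫ y, φ y • a (x + ε • y)‖ ≤ M * ε ^ τ

theorem exists_approxBound [CompleteSpace X] {τ : ℝ} (hτ : 0 ≤ τ) {φ : 𝓢(Eu m, ℂ)}
    (hφ : (𝓕 φ : 𝓢(Eu m, ℂ)) =ᶠ[𝓝 0] fun _ ↦ 1) :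
    ∃ C : ℝ, 0 ≤ C ∧ ∀ (M : ℝ) (a : Eu m → X), 0 ≤ M → ContDiff ℝ ⌊τ⌋₊ a →
      holderENorm τ a ≤ ENNReal.ofReal M → ApproxBound φ τ (C * M) a := by
  obtain ⟨C, hC0, hC⟩ := exists_norm_mollify_sub_le (X := X) ⌊τ⌋₊
    (sub_nonneg.2 (Nat.floor_le hτ)) (sub_le_iff_le_add'.2 (Nat.lt_floor_add_one τ).le) φ 1 hφ
  -- The added `1` lets the same constant also bound the supremum of `a`.
  refine ⟨C + 1, by positivity, fun M a hM ha h ↦ ?_⟩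
  have hb := holderBound_of_holderENorm_le hM ha h
  refine ⟨ha.continuous, fun x ↦ (hb.norm_le x).trans ?_, fun ε hε _ x ↦ ?_⟩
  · nlinarith
  · have := hC M a hb x ε hε.le
    rw [one_smul, add_sub_cancel] at this
    rw [norm_sub_rev]
    refine this.trans ?_
    gcongr
    linarith

end Mollification

/-! ### Stability of the approximation class. -/

section ApproxBound

variable {m : ℕ} {X : Type*} [NormedAddCommGroup X] [NormedSpace ℂ X]
  {φ : 𝓢(Eu m, ℂ)} {τ : ℝ}

namespace ApproxBound

theorem nonneg {M : ℝ} {a : Eu m → X} (h : ApproxBound φ τ M a) : 0 ≤ M :=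
  (norm_nonneg _).trans (h.norm_le 0)

theorem mono {M M' : ℝ} {a : Eu m → X} (h : ApproxBound φ τ M a) (hM : M ≤ M') :
    ApproxBound φ τ M' a :=
  ⟨h.continuous, fun x ↦ (h.norm_le x).trans hM, fun ε hε hε1 x ↦
    (h.approx ε hε hε1 x).trans (by gcongr)⟩

theorem zero {M : ℝ} (hM : 0 ≤ M) : ApproxBound φ τ M (fun _ : Eu m ↦ (0 : X)) :=
  ⟨continuous_const, fun x ↦ by simpa using hM, fun ε hε hε1 x ↦ by simp; positivity⟩

theorem integrable {M : ℝ} {a : Eu m → X} (h : ApproxBound φ τ M a) (x : Eu m) (ε : ℝ) :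
    Integrable fun y ↦ φ y • a (x + ε • y) :=
  integrable_smul_of_bounded φ (b := fun y ↦ a (x + ε • y)) (h.continuous.comp (by fun_prop))
    fun y ↦ h.norm_le _

theorem add {M M' : ℝ} {a b : Eu m → X} (ha : ApproxBound φ τ M a) (hb : ApproxBound φ τ M' b) :
    ApproxBound φ τ (M + M') (fun x ↦ a x + b x) := by
  refine ⟨ha.continuous.add hb.continuous, fun x ↦
    (norm_add_le _ _).trans (add_le_add (ha.norm_le x) (hb.norm_le x)), fun ε hε hε1 x ↦ ?_⟩
  simp only [smul_add]
  rw [integral_add (ha.integrable x ε) (hb.integrable x ε), add_sub_add_comm, add_mul]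
  exact (norm_add_le _ _).trans (add_le_add (ha.approx ε hε hε1 x) (hb.approx ε hε hε1 x))

theorem const_smul {M : ℝ} {a : Eu m → X} (ha : ApproxBound φ τ M a) (c : ℂ) :
    ApproxBound φ τ (‖c‖ * M) (fun x ↦ c • a x) := by
  refine ⟨ha.continuous.const_smul c, fun x ↦ ?_, fun ε hε hε1 x ↦ ?_⟩
  · rw [norm_smul]; gcongr; exact ha.norm_le x
  · simp only [smul_comm _ c]
    rw [integral_smul, ← smul_sub, norm_smul, mul_assoc]
    gcongr
    exact ha.approx ε hε hε1 x

/-- Mollification in `x` commutes with integration over the parameter by Fubini. This is the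
advantage of describing Hölder regularity by the mollification error: it passes through integrals
without any differentiation under the integral sign. -/
theorem integral {A : Eu m → Eu m → X} {M : Eu m → ℝ} (hM : Integrable M)
    (hA : ∀ ζ, ApproxBound φ τ (M ζ) fun x ↦ A x ζ) (hc : ∀ x, Continuous (A x)) :
    ApproxBound φ τ (∫ ζ, M ζ) fun x ↦ ∫ ζ, A x ζ := by
  refine ⟨?_, fun x ↦ norm_integral_le_of_norm_le hM (Eventually.of_forall fun ζ ↦
    (hA ζ).norm_le x), fun ε hε hε1 x ↦ ?_⟩
  · exact continuous_of_dominated (fun x ↦ (hc x).aestronglyMeasurable)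
      (fun x ↦ Eventually.of_forall fun ζ ↦ (hA ζ).norm_le x) hM
      (Eventually.of_forall fun ζ ↦ (hA ζ).continuous)
  · have hprod : Integrable (Function.uncurry fun y ζ ↦ φ y • A (x + ε • y) ζ)
        ((volume : Measure (Eu m)).prod volume) := by
      refine (φ.integrable.norm.mul_prod hM).mono' ?_ (Eventually.of_forall fun z ↦ ?_)
      · refine StronglyMeasurable.aestronglyMeasurable ?_
        refine stronglyMeasurable_uncurry_of_continuous_of_stronglyMeasurable (fun ζ ↦ ?_)
          fun y ↦ ?_
        · exact φ.continuous.smul ((hA ζ).continuous.comp (by fun_prop))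
        · exact ((hc _).const_smul _).stronglyMeasurable
      · simp only [Function.uncurry, norm_smul]
        gcongr
        exact (hA _).norm_le _
    have h1 : ∫ y, φ y • ∫ ζ, A (x + ε • y) ζ = ∫ ζ, ∫ y, φ y • A (x + ε • y) ζ := by
      simp_rw [← integral_smul]
      exact integral_integral_swap hprod
    have hAi : Integrable (A x) := hM.mono' (hc x).aestronglyMeasurable
      (Eventually.of_forall fun ζ ↦ (hA ζ).norm_le x)
    have h2 : Integrable fun ζ ↦ ∫ y, φ y • A (x + ε • y) ζ := hprod.integral_prod_right
    rw [h1, ← integral_sub hAi h2, ← integral_mul_const]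
    exact norm_integral_le_of_norm_le (hM.mul_const _) (Eventually.of_forall fun ζ ↦
      (hA ζ).approx ε hε hε1 x)

end ApproxBound

theorem pderiv_smul {ψ : Eu m → ℂ} {f : Eu m → X} (hψ : Differentiable ℝ ψ)
    (hf : Differentiable ℝ f) (i : Fin m) :
    pderiv i (fun ζ ↦ ψ ζ • f ζ) = fun ζ ↦ pderiv i ψ ζ • f ζ + ψ ζ • pderiv i f ζ := by
  ext ζ
  have := ((hψ ζ).hasFDerivAt.smul (hf ζ).hasFDerivAt).fderiv
  simp only [pderiv]
  erw [this]
  simp [add_comm]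

theorem pderiv_iterate_add {n : ℕ} {f g : Eu m → X} (hf : ContDiff ℝ n f) (hg : ContDiff ℝ n g)
    (i : Fin m) : (pderiv i)^[n] (fun ζ ↦ f ζ + g ζ) =
      fun ζ ↦ (pderiv i)^[n] f ζ + (pderiv i)^[n] g ζ := by
  induction n generalizing f g with
  | zero => rfl
  | succ n ih =>
    have h : pderiv i (fun ζ ↦ f ζ + g ζ) = fun ζ ↦ pderiv i f ζ + pderiv i g ζ := by
      ext ζ
      simp only [pderiv]
      rw [fderiv_fun_add ((hf.differentiable (by norm_cast)) ζ)
        ((hg.differentiable (by norm_cast)) ζ)]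
      rfl
    simp only [Function.iterate_succ_apply]
    rw [h, ih (contDiff_pderiv hf i) (contDiff_pderiv hg i)]

theorem tsupport_pderiv_subset (i : Fin m) (ψ : Eu m → X) :
    tsupport (pderiv i ψ) ⊆ tsupport ψ := by
  refine (closure_mono fun x hx ↦ ?_).trans (tsupport_fderiv_subset ℝ (f := ψ))
  rw [Function.mem_support] at hx ⊢
  intro h
  exact hx (by simp [pderiv, h])

/-- Leibniz rule in recursive form: one derivative falls either on `ψ` or on `u`, and both terms are
instances of order `n`. The set `S` is kept apart from `tsupport ψ` so that it does not change when
`ψ` is replaced by its derivative. -/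
theorem exists_approxBound_pderiv_iterate_smul (n : ℕ) (i : Fin m) {S : Set (Eu m)} :
    ∀ ψ : Eu m → ℂ, ContDiff ℝ n ψ → HasCompactSupport ψ → tsupport ψ ⊆ S →
    ∃ C : ℝ, 0 ≤ C ∧ ∀ (u : Eu m → Eu m → X) (M : ℝ), 0 ≤ M → (∀ x, ContDiff ℝ n (u x)) →
      (∀ k ≤ n, ∀ ζ ∈ S, ApproxBound φ τ M fun x ↦ (pderiv i)^[k] (u x) ζ) →
      ∀ ζ, ApproxBound φ τ (C * M) fun x ↦ (pderiv i)^[n] (fun ζ ↦ ψ ζ • u x ζ) ζ := by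
  induction n with
  | zero =>
    intro ψ hψ hc hS
    obtain ⟨C, hC⟩ := hψ.continuous.bounded_above_of_compact_support hc
    refine ⟨C, (norm_nonneg _).trans (hC 0), fun u M hM hu h ζ ↦ ?_⟩
    by_cases hζ : ζ ∈ S
    · refine ((h 0 le_rfl ζ hζ).const_smul (ψ ζ)).mono ?_
      gcongr
      exact hC ζ
    · have : ψ ζ = 0 := image_eq_zero_of_notMem_tsupport fun h ↦ hζ (hS h)
      simp only [Function.iterate_zero, id_eq, this, zero_smul]
      exact .zero (mul_nonneg ((norm_nonneg _).trans (hC 0)) hM)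
  | succ n ih =>
    intro ψ hψ hc hS
    obtain ⟨C₁, hC₁0, hC₁⟩ := ih (pderiv i ψ) (contDiff_pderiv hψ i)
      (hc.of_isClosed_subset (isClosed_tsupport _) (tsupport_pderiv_subset i ψ))
      ((tsupport_pderiv_subset i ψ).trans hS)
    obtain ⟨C₂, hC₂0, hC₂⟩ := ih ψ (hψ.of_le (by norm_cast; omega)) hc hS
    refine ⟨C₁ + C₂, by positivity, fun u M hM hu h ζ ↦ ?_⟩
    have hu' : ∀ x, ContDiff ℝ n (u x) := fun x ↦ (hu x).of_le (by norm_cast; omega)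
    have h1 := hC₁ u M hM hu' (fun k hk ↦ h k (by omega)) ζ
    have h2 := hC₂ (fun x ↦ pderiv i (u x)) M hM (fun x ↦ contDiff_pderiv (hu x) i)
      (fun k hk ζ hζ ↦ by simpa using h (k + 1) (by omega) ζ hζ) ζ
    rw [add_mul]
    convert h1.add h2 using 2 with x
    rw [Function.iterate_succ_apply, pderiv_smul (hψ.differentiable (by norm_cast))
      ((hu x).differentiable (by norm_cast)), pderiv_iterate_add]
    · exact (contDiff_pderiv hψ i).smul (hu' x)
    · exact (hψ.of_le (by norm_cast; omega)).smul (contDiff_pderiv (hu x) i)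

end ApproxBound

/-! ### Decay of the kernels by integration by parts. -/

section Kernel

variable {m : ℕ} {X : Type*} [NormedAddCommGroup X] [NormedSpace ℂ X]
  {φ : 𝓢(Eu m, ℂ)} {τ : ℝ}

theorem hasCompactSupport_pderiv {f : Eu m → X} (hf : HasCompactSupport f) (i : Fin m) :
    HasCompactSupport (pderiv i f) :=
  hf.of_isClosed_subset (isClosed_tsupport _) (tsupport_pderiv_subset i f)

theorem tsupport_pderiv_iterate_subset (n : ℕ) (i : Fin m) (f : Eu m → X) :
    tsupport ((pderiv i)^[n] f) ⊆ tsupport f := by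
  induction n generalizing f with
  | zero => rfl
  | succ n ih => exact (ih _).trans (tsupport_pderiv_subset i f)

theorem fourier_pderiv {f : Eu m → X} (hf : ContDiff ℝ 1 f) (hc : HasCompactSupport f)
    (i : Fin m) (w : Eu m) :
    𝓕 (pderiv i f) w = (2 * Real.pi * Complex.I * w i : ℂ) • 𝓕 f w := by
  have hi : Integrable (fderiv ℝ f) :=
    (hf.continuous_fderiv (by norm_num)).integrable_of_hasCompactSupport (hc.fderiv ℝ)
  have h1 := Real.fourier_fderiv (hf.continuous.integrable_of_hasCompactSupport hc)
    (hf.differentiable (by norm_num)) hi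
  have h2 := congrArg (fun F ↦ F w (EuclideanSpace.single i (1 : ℝ))) h1
  simp only [Real.fourier_continuousLinearMap_apply hi,
    VectorFourier.fourierSMulRight_apply] at h2
  change 𝓕 (fun x ↦ fderiv ℝ f x (EuclideanSpace.single i (1 : ℝ))) w = _
  have h3 : innerSL ℝ w (EuclideanSpace.single i (1 : ℝ)) = w i := by
    simp [innerSL_apply_apply, EuclideanSpace.inner_single_right]
  rw [h2, neg_apply, neg_apply, h3]
  simp [smul_smul, ← Complex.coe_smul]

theorem fourier_pderiv_iterate (n : ℕ) {f : Eu m → X} (hf : ContDiff ℝ n f)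
    (hc : HasCompactSupport f) (i : Fin m) (w : Eu m) :
    𝓕 ((pderiv i)^[n] f) w = ((2 * Real.pi * Complex.I * w i : ℂ) ^ n) • 𝓕 f w := by
  induction n generalizing f with
  | zero => simp
  | succ n ih =>
    rw [Function.iterate_succ_apply, ih (contDiff_pderiv hf i) (hasCompactSupport_pderiv hc i),
      fourier_pderiv (hf.of_le (by norm_cast; omega)) hc, smul_smul, pow_succ]

/-- The Fourier integral runs over the compact support of `ψ` with unimodular weights, so the bound
is the pointwise one times the volume of this support. -/
theorem exists_approxBound_fourier_pderiv_iterate (n : ℕ) (i : Fin m) {ψ : Eu m → ℂ}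
    (hψ : ContDiff ℝ n ψ) (hc : HasCompactSupport ψ) :
    ∃ C : ℝ, 0 ≤ C ∧ ∀ (u : Eu m → Eu m → X) (M : ℝ), 0 ≤ M → (∀ x, ContDiff ℝ n (u x)) →
      (∀ k ≤ n, ∀ ζ ∈ tsupport ψ, ApproxBound φ τ M fun x ↦ (pderiv i)^[k] (u x) ζ) →
      ∀ w, ApproxBound φ τ (C * M) fun x ↦ 𝓕 ((pderiv i)^[n] (fun ζ ↦ ψ ζ • u x ζ)) w := by
  obtain ⟨C, hC0, hC⟩ := exists_approxBound_pderiv_iterate_smul (X := X) (φ := φ) (τ := τ) n i ψ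
    hψ hc subset_rfl
  refine ⟨volume.real (tsupport ψ) * C, by positivity, fun u M hM hu h w ↦ ?_⟩
  have hfin : volume (tsupport ψ) ≠ ∞ := hc.isCompact.measure_lt_top.ne
  have hmeas : MeasurableSet (tsupport ψ) := (isClosed_tsupport ψ).measurableSet
  have hint : Integrable ((tsupport ψ).indicator fun _ ↦ C * M) :=
    (integrable_indicator_iff hmeas).2 (integrableOn_const hfin)
  have hval : ∫ ζ, (tsupport ψ).indicator (fun _ ↦ C * M) ζ = volume.real (tsupport ψ) * C * M := by
    rw [integral_indicator hmeas, setIntegral_const, smul_eq_mul, mul_assoc]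
  have hsmooth : ∀ x, ContDiff ℝ n (fun ζ ↦ ψ ζ • u x ζ) := fun x ↦ hψ.smul (hu x)
  rw [← hval]
  simp only [Real.fourier_eq']
  refine ApproxBound.integral hint (fun ζ ↦ ?_) fun x ↦ ?_
  · by_cases hζ : ζ ∈ tsupport ψ
    · rw [Set.indicator_of_mem hζ]
      refine ((hC u M hM hu h ζ).const_smul _).mono (le_of_eq ?_)
      rw [Complex.norm_exp_ofReal_mul_I, one_mul]
    · rw [Set.indicator_of_notMem hζ]
      convert! ApproxBound.zero (φ := φ) (τ := τ) (X := X) le_rfl using 2 with x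
      have h0 : (pderiv i)^[n] (fun ζ ↦ ψ ζ • u x ζ) ζ = 0 := by
        refine image_eq_zero_of_notMem_tsupport fun h' ↦ hζ ?_
        refine closure_mono (fun ξ hξ ↦ ?_) (tsupport_pderiv_iterate_subset n i _ h')
        exact left_ne_zero_of_smul hξ
      rw [h0, smul_zero]
  · refine Continuous.smul (by fun_prop) ?_
    exact (contDiff_pderiv_iterate (n := 0) n (by simpa using hsmooth x) i).continuous

/-- The norm is at most the sum of the `|w i|`, so some coordinate is at least the average. In that
direction pure derivatives suffice to gain decay, and mixed derivatives of the symbol are never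
needed. -/
theorem exists_norm_le_mul_abs_coord (w : Eu m) (hw : 0 < ‖w‖) : ∃ i, ‖w‖ ≤ m * |w i| := by
  by_contra! h
  have h1 : ‖w‖ ≤ ∑ i, |w i| := by
    conv_lhs => rw [← (EuclideanSpace.basisFun (Fin m) ℝ).sum_repr w]
    refine (norm_sum_le _ _).trans (le_of_eq (Finset.sum_congr rfl fun i _ ↦ ?_))
    simp [norm_smul]
  rcases Nat.eq_zero_or_pos m with rfl | hm
  · simp at h1
    simp [h1] at hw
  have h2 : (m : ℝ) * ∑ i, |w i| < ∑ _i : Fin m, ‖w‖ := by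
    rw [Finset.mul_sum]
    exact Finset.sum_lt_sum_of_nonempty ⟨⟨0, hm⟩, Finset.mem_univ _⟩ fun i _ ↦ h i
  simp only [Finset.sum_const, Finset.card_univ, Fintype.card_fin, nsmul_eq_mul] at h2
  have : (0 : ℝ) < m := by exact_mod_cast hm
  nlinarith

/-- The kernel `w ↦ 𝓕(ψ u)(w)` decays of order `n` in the spaces of the parameter `x`. -/
theorem exists_approxBound_kernel (hm : 1 ≤ m) (n : ℕ) {ψ : Eu m → ℂ}
    (hψ : ContDiff ℝ n ψ) (hc : HasCompactSupport ψ) :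
    ∃ C : ℝ, 0 ≤ C ∧ ∀ (u : Eu m → Eu m → X) (M : ℝ), 0 ≤ M → (∀ x, ContDiff ℝ n (u x)) →
      (∀ i, ∀ k ≤ n, ∀ ζ ∈ tsupport ψ, ApproxBound φ τ M fun x ↦ (pderiv i)^[k] (u x) ζ) →
      ∀ w, ApproxBound φ τ (C * M * (1 + ‖w‖) ^ (-(n : ℝ))) fun x ↦
        𝓕 (fun ζ ↦ ψ ζ • u x ζ) w := by
  obtain ⟨C₀, hC₀0, hC₀⟩ := exists_approxBound_fourier_pderiv_iterate (X := X) (φ := φ) (τ := τ) 0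
    ⟨0, hm⟩ (hψ.of_le (by norm_cast; omega)) hc
  choose C hC0 hC using fun i ↦ exists_approxBound_fourier_pderiv_iterate (X := X) (φ := φ)
    (τ := τ) n i hψ hc
  refine ⟨2 ^ n * C₀ + (2 * m) ^ n * ∑ i, C i, ?_, fun u M hM hu h w ↦ ?_⟩
  · have := Finset.sum_nonneg fun i (_ : i ∈ Finset.univ) ↦ hC0 i
    positivity
  have hsum : 0 ≤ ∑ i, C i := Finset.sum_nonneg fun i _ ↦ hC0 i
  rw [Real.rpow_neg (by positivity), Real.rpow_natCast]
  -- Small `w` need no decay: no derivative is used and `(1 + ‖w‖)^n ≤ 2^n`. For `‖w‖ > 1` one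
  -- integrates by parts `n` times in a dominant coordinate `i`, and `1 + ‖w‖ ≤ 2‖w‖ ≤ 2m|w i|`
  -- produces the factor `(2m)^n`.
  rcases le_or_gt ‖w‖ 1 with hw | hw
  · refine (hC₀ u M hM (fun x ↦ (hu x).of_le (by norm_cast; omega))
      (fun k hk ↦ h _ k (by omega)) w).mono ?_
    rw [← div_eq_mul_inv, le_div_iff₀ (by positivity)]
    have h1 : (1 + ‖w‖) ^ n ≤ 2 ^ n := by gcongr; linarith
    calc C₀ * M * (1 + ‖w‖) ^ n ≤ C₀ * M * 2 ^ n := by gcongr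
      _ = (2 ^ n * C₀ + 0) * M := by ring
      _ ≤ _ := by gcongr; positivity
  · obtain ⟨i, hi⟩ := exists_norm_le_mul_abs_coord w (by linarith)
    have hwi : 0 < |w i| := by
      by_contra! h0
      have : |w i| = 0 := le_antisymm h0 (abs_nonneg _)
      rw [this, mul_zero] at hi
      linarith
    set c : ℂ := (2 * Real.pi * Complex.I * w i : ℂ) ^ n with hcdef
    have hcn : ‖c‖ = (2 * Real.pi * |w i|) ^ n := by
      simp [hcdef, abs_of_pos Real.pi_pos]
    have hcpos : 0 < ‖c‖ := by rw [hcn]; positivity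
    have h1 := ((hC i u M hM hu (h i) w).const_smul c⁻¹)
    have h2 : (fun x ↦ c⁻¹ • 𝓕 ((pderiv i)^[n] (fun ζ ↦ ψ ζ • u x ζ)) w) =
        fun x ↦ 𝓕 (fun ζ ↦ ψ ζ • u x ζ) w := by
      ext x
      have h3 : HasCompactSupport fun ζ ↦ ψ ζ • u x ζ := hc.smul_right
      have h4 : ContDiff ℝ n fun ζ ↦ ψ ζ • u x ζ := hψ.smul (hu x)
      rw [fourier_pderiv_iterate n h4 h3, inv_smul_smul₀ (norm_pos_iff.1 hcpos)]
    rw [h2] at h1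
    refine h1.mono ?_
    rw [norm_inv, inv_mul_le_iff₀ hcpos, ← mul_assoc, ← div_eq_mul_inv,
      le_div_iff₀ (by positivity), hcn]
    have h3 : (1 + ‖w‖) ^ n ≤ (2 * m) ^ n * (2 * Real.pi * |w i|) ^ n := by
      rw [← mul_pow]
      gcongr
      have h4 : (1 : ℝ) ≤ 2 * Real.pi := by linarith [Real.pi_gt_three]
      calc 1 + ‖w‖ ≤ 2 * ‖w‖ := by linarith
        _ ≤ 2 * (m * |w i|) := by gcongr
        _ = 2 * m * (1 * |w i|) := by ring
        _ ≤ _ := by gcongr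
    have h5 : C i ≤ ∑ i, C i := Finset.single_le_sum (fun i _ ↦ hC0 i) (Finset.mem_univ i)
    calc C i * M * (1 + ‖w‖) ^ n
        ≤ (∑ i, C i) * M * ((2 * m) ^ n * (2 * Real.pi * |w i|) ^ n) := by gcongr
      _ = (2 * Real.pi * |w i|) ^ n * ((0 + (2 * m) ^ n * ∑ i, C i) * M) := by ring
      _ ≤ _ := by gcongr; positivity

end Kernel

/-! ### Pairings with multiplication operators and separated frequencies. -/

section Pairing

variable {m : ℕ} {H₀ H₁ : Type*}
  [NormedAddCommGroup H₀] [InnerProductSpace ℂ H₀]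
  [NormedAddCommGroup H₁] [InnerProductSpace ℂ H₁]
  {φ : 𝓢(Eu m, ℂ)} {τ : ℝ}

theorem integral_norm_mul_norm_le (g : 𝓢(Eu m, H₁)) (h : 𝓢(Eu m, H₀)) :
    ∫ x, ‖g x‖ * ‖h x‖ ≤ ‖g.toLp 2‖ * ‖h.toLp 2‖ := by
  have := integral_mul_le_Lp_mul_Lq_of_nonneg (μ := (volume : Measure (Eu m)))
    Real.HolderConjugate.two_two (f := fun x ↦ ‖g x‖) (g := fun x ↦ ‖h x‖)
    (Eventually.of_forall fun x ↦ norm_nonneg _) (Eventually.of_forall fun x ↦ norm_nonneg _)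
    (by simpa using (g.memLp 2).norm) (by simpa using (h.memLp 2).norm)
  rw [SchwartzMap.norm_toLp' (by norm_num) (by norm_num),
    SchwartzMap.norm_toLp' (by norm_num) (by norm_num)]
  simpa using this

theorem integrable_norm_mul_norm (g : 𝓢(Eu m, H₁)) (h : 𝓢(Eu m, H₀)) :
    Integrable fun x ↦ ‖g x‖ * ‖h x‖ := by
  exact (g.memLp 2 (volume : Measure (Eu m))).norm.integrable_mul
    (h.memLp 2 (volume : Measure (Eu m))).norm

theorem norm_integral_inner_le {b : Eu m → H₀ →L[ℂ] H₁} {M : ℝ} (hM : ∀ x, ‖b x‖ ≤ M)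
    (g : 𝓢(Eu m, H₁)) (h : 𝓢(Eu m, H₀)) :
    ‖∫ x, inner ℂ (g x) (b x (h x))‖ ≤ M * ‖g.toLp 2‖ * ‖h.toLp 2‖ := by
  have hM0 : 0 ≤ M := (norm_nonneg _).trans (hM 0)
  refine (norm_integral_le_of_norm_le ((integrable_norm_mul_norm g h).const_mul M)
    (Eventually.of_forall fun x ↦ ?_)).trans ?_
  · calc ‖inner ℂ (g x) (b x (h x))‖ ≤ ‖g x‖ * (M * ‖h x‖) := by
          grw [norm_inner_le_norm, (b x).le_opNorm, hM x]
      _ = _ := by ring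
  · rw [integral_const_mul, mul_assoc]
    gcongr
    exact integral_norm_mul_norm_le g h

theorem fourierInv_compSubConst (h : 𝓢(Eu m, H₀)) (ω x : Eu m) :
    (𝓕⁻ (SchwartzMap.compSubConstCLM ℂ ω h) : 𝓢(Eu m, H₀)) x =
      Complex.exp ((2 * Real.pi * inner ℝ x ω : ℝ) * Complex.I) • (𝓕⁻ h : 𝓢(Eu m, H₀)) x := by
  rw [SchwartzMap.fourierInv_coe, SchwartzMap.fourierInv_coe, Real.fourierInv_eq',
    Real.fourierInv_eq', ← integral_smul, ← integral_sub_right_eq_self (fun v ↦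
      Complex.exp ((2 * Real.pi * inner ℝ x ω : ℝ) * Complex.I) •
        Complex.exp ((2 * Real.pi * inner ℝ v x : ℝ) * Complex.I) • h v) ω]
  refine integral_congr_ae (Eventually.of_forall fun v ↦ ?_)
  simp only [SchwartzMap.compSubConstCLM_apply, smul_smul, ← Complex.exp_add]
  congr 2
  rw [inner_sub_left, real_inner_comm ω x]
  push_cast
  ring

theorem norm_toLp_compSubConst (f : 𝓢(Eu m, H₀)) (a : Eu m) :
    ‖(SchwartzMap.compSubConstCLM ℂ a f).toLp 2‖ = ‖f.toLp 2‖ := by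
  rw [SchwartzMap.norm_toLp' (by norm_num) (by norm_num),
    SchwartzMap.norm_toLp' (by norm_num) (by norm_num)]
  congr 1
  simp only [SchwartzMap.compSubConstCLM_apply]
  exact integral_sub_right_eq_self (fun x ↦ ‖f x‖ ^ _) a

/-- A translation multiplies the Fourier transform by a phase and hence does not enlarge its
support. -/
theorem fourier_compSubConst_ne_zero {f : 𝓢(Eu m, H₀)} {a ξ : Eu m}
    (h : (𝓕 (SchwartzMap.compSubConstCLM ℂ a f) : 𝓢(Eu m, H₀)) ξ ≠ 0) :
    (𝓕 f : 𝓢(Eu m, H₀)) ξ ≠ 0 := by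
  intro h0
  apply h
  have h1 := fourierInv_compSubConst f a (-ξ)
  rw [SchwartzMap.fourierInv_coe, Real.fourierInv_eq_fourier_neg, neg_neg,
    ← SchwartzMap.fourier_coe, SchwartzMap.fourierInv_coe, Real.fourierInv_eq_fourier_neg, neg_neg,
    ← SchwartzMap.fourier_coe, h0, smul_zero] at h1
  exact h1

variable [CompleteSpace H₀] [CompleteSpace H₁]

theorem fourier_postcomp (h : 𝓢(Eu m, H₀)) (A : H₀ →L[ℂ] H₁) (ξ : Eu m) :
    (𝓕 (SchwartzMap.postcompCLM A h) : 𝓢(Eu m, H₁)) ξ = A ((𝓕 h : 𝓢(Eu m, H₀)) ξ) := by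
  rw [SchwartzMap.fourier_coe, SchwartzMap.fourier_coe, Real.fourier_eq', Real.fourier_eq',
    ← ContinuousLinearMap.integral_comp_comm]
  · simp
  · rw [← integrable_norm_iff]
    · simpa only [norm_smul, Complex.norm_exp_ofReal_mul_I, one_mul] using
        (h.integrable (μ := (volume : Measure (Eu m)))).norm
    · exact Continuous.aestronglyMeasurable (by fun_prop)

/-- Parseval: the Fourier transform of `e^{2πi x·ω} A h(x)` is `A` applied to the transform of `h`
translated by `ω`, which is zero wherever the transform of `g` is not. It identifies frequencies
missing from the scalar function `x ↦ ⟨g(x), A h(x)⟩`. -/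
theorem integral_exp_mul_inner_eq_zero (g : 𝓢(Eu m, H₁)) (h : 𝓢(Eu m, H₀)) (A : H₀ →L[ℂ] H₁)
    (ω : Eu m) (hs : ∀ ζ, (𝓕 g : 𝓢(Eu m, H₁)) ζ = 0 ∨ (𝓕 h : 𝓢(Eu m, H₀)) (ζ - ω) = 0) :
    ∫ x, Complex.exp ((2 * Real.pi * inner ℝ x ω : ℝ) * Complex.I) * inner ℂ (g x) (A (h x)) =
      0 := by
  set k : 𝓢(Eu m, H₁) := SchwartzMap.compSubConstCLM ℂ ω (𝓕 (SchwartzMap.postcompCLM A h))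
  have h1 := SchwartzMap.integral_inner_fourier_fourier g (𝓕⁻ k)
  have h2 : ∫ ξ, inner ℂ ((𝓕 g : 𝓢(Eu m, H₁)) ξ) ((𝓕 (𝓕⁻ k) : 𝓢(Eu m, H₁)) ξ) = 0 := by
    rw [← integral_zero (Eu m) ℂ]
    congr 1
    ext ξ
    rw [FourierTransform.fourier_fourierInv_eq, SchwartzMap.compSubConstCLM_apply,
      fourier_postcomp]
    rcases hs ξ with h | h <;> simp [h]
  rw [h2] at h1
  rw [h1]
  congr 1
  ext x
  rw [fourierInv_compSubConst, FourierTransform.fourierInv_fourier_eq, inner_smul_right,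
    SchwartzMap.postcompCLM_apply]

/-- The integral is the convolution of `b` with `φ` at scale `ε`. Writing `φ` as a Fourier transform
and moving the transform to the other factor gives an integral over `η` of `χ(η)` times a phase
multiple of the Fourier integral of `b` at frequency `-η/ε`; for each `η` one of these factors
vanishes. -/
theorem integral_mul_comp_eq_zero {b : Eu m → ℂ} (hb : Integrable b) {ε : ℝ} (hε : 0 < ε)
    (hs : ∀ η : Eu m, (𝓕 φ : 𝓢(Eu m, ℂ)) (-(ε • η)) ≠ 0 →
      ∫ x, Complex.exp ((2 * Real.pi * inner ℝ x η : ℝ) * Complex.I) * b x = 0) (z : Eu m) :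
    ∫ y, φ y * b (z - ε • y) = 0 := by
  set χ : 𝓢(Eu m, ℂ) := 𝓕⁻ φ with hχ
  have hφ : φ = 𝓕 χ := (FourierTransform.fourier_fourierInv_eq φ).symm
  have hB : Integrable fun y ↦ b (z - ε • y) := by
    have := (hb.comp_sub_left z).comp_smul hε.ne'
    exact this
  have h1 : ∫ y, (𝓕 χ : 𝓢(Eu m, ℂ)) y * b (z - ε • y) =
      ∫ η, χ η * 𝓕 (fun y ↦ b (z - ε • y)) η := by
    simpa using! VectorFourier.integral_fourierIntegral_smul_eq_flip (L := innerₗ (Eu m))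
      Real.continuous_fourierChar continuous_inner χ.integrable hB
  rw [hφ, h1, ← integral_zero (Eu m) ℂ]
  congr 1
  ext η
  rcases eq_or_ne (χ η) 0 with h0 | h0
  · rw [h0, zero_mul]
  have h2 := hs (ε⁻¹ • η) (by
    rw [smul_inv_smul₀ hε.ne']
    rwa [hχ, SchwartzMap.fourierInv_coe, Real.fourierInv_eq_fourier_neg,
      ← SchwartzMap.fourier_coe] at h0)
  rw [Real.fourier_eq']
  obtain ⟨K, hK⟩ : ∃ K : Eu m → ℂ, K = fun x ↦
      Complex.exp ((-2 * Real.pi * inner ℝ z (ε⁻¹ • η) : ℝ) * Complex.I) *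
        (Complex.exp ((2 * Real.pi * inner ℝ x (ε⁻¹ • η) : ℝ) * Complex.I) * b x) := ⟨_, rfl⟩
  have h3 : ∀ y : Eu m, Complex.exp ((-2 * Real.pi * inner ℝ y η : ℝ) * Complex.I) •
      b (z - ε • y) = K (z - ε • y) := by
    intro y
    simp only [hK, smul_eq_mul, ← mul_assoc, ← Complex.exp_add]
    congr 2
    rw [inner_sub_left, real_inner_smul_right, real_inner_smul_right, real_inner_smul_left,
      inv_mul_cancel_left₀ hε.ne']
    push_cast
    ring
  simp_rw [h3]
  rw [Measure.integral_comp_smul volume (fun v ↦ K (z - v)) ε,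
    integral_sub_left_eq_self (fun v ↦ K v), hK, integral_const_mul, h2]
  simp

/-- The pairing with the mollification of an operator valued function vanishes for functions
with well separated frequencies. -/
theorem integral_inner_mollify_eq_zero (hφ : ∀ η, 1 ≤ ‖η‖ → (𝓕 φ : 𝓢(Eu m, ℂ)) η = 0)
    {M : ℝ} {a : Eu m → H₀ →L[ℂ] H₁} (ha : ApproxBound φ τ M a) (g : 𝓢(Eu m, H₁))
    (h : 𝓢(Eu m, H₀)) {ε : ℝ} (hε : 0 < ε)
    (hs : ∀ ζ ξ, (𝓕 g : 𝓢(Eu m, H₁)) ζ ≠ 0 → (𝓕 h : 𝓢(Eu m, H₀)) ξ ≠ 0 → 1 ≤ ε * ‖ζ - ξ‖) :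
    Integrable (fun x ↦ inner ℂ (g x) ((∫ y, φ y • a (x + ε • y)) (h x))) ∧
      ∫ x, inner ℂ (g x) ((∫ y, φ y • a (x + ε • y)) (h x)) = 0 := by
  have hac := ha.continuous
  let F : Eu m × Eu m → ℂ := fun z ↦ φ z.2 * inner ℂ (g z.1) (a (z.1 + ε • z.2) (h z.1))
  have hFc : Continuous F := by
    have h1 : Continuous fun z : Eu m × Eu m ↦ a (z.1 + ε • z.2) := hac.comp (by fun_prop)
    have h2 : Continuous fun z : Eu m × Eu m ↦ a (z.1 + ε • z.2) (h z.1) :=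
      h1.clm_apply (h.continuous.comp continuous_fst)
    exact (φ.continuous.comp continuous_snd).mul ((g.continuous.comp continuous_fst).inner h2)
  have hM0 := ha.nonneg
  have hFi : Integrable F (volume.prod volume) := by
    refine (((integrable_norm_mul_norm g h).const_mul M).mul_prod φ.integrable.norm).mono'
      hFc.aestronglyMeasurable (Eventually.of_forall fun z ↦ ?_)
    simp only [F, norm_mul]
    calc ‖φ z.2‖ * ‖inner ℂ (g z.1) (a (z.1 + ε • z.2) (h z.1))‖
        ≤ ‖φ z.2‖ * (‖g z.1‖ * (M * ‖h z.1‖)) := by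
          grw [norm_inner_le_norm, (a _).le_opNorm, ha.norm_le]
      _ = _ := by ring
  have h1 : ∀ x, inner ℂ (g x) ((∫ y, φ y • a (x + ε • y)) (h x)) = ∫ y, F (x, y) := by
    intro x
    have hi := ha.integrable x ε
    rw [ContinuousLinearMap.integral_apply hi]
    have h2 := ((innerSL ℂ (g x))).integral_comp_comm (φ := fun y ↦ (φ y • a (x + ε • y)) (h x))
      (hi.apply_continuousLinearMap _)
    simp only [innerSL_apply_apply] at h2
    rw [← h2]
    simp [F, inner_smul_right]
  simp_rw [h1]
  refine ⟨hFi.integral_prod_left, ?_⟩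
  rw [integral_integral_swap (f := fun x y ↦ F (x, y)) hFi]
  -- The substitution `x = z - εy` freezes the coefficient at `a z`. For fixed `z` the `y`-integral
  -- is then a mollification of the scalar function `x ↦ ⟨g(x), a(z) h(x)⟩`, to which the constant
  -- coefficient lemmas apply.
  let G : Eu m × Eu m → ℂ := fun z ↦ F (z.1 - ε • z.2, z.2)
  have hGi : Integrable G (volume.prod volume) := by
    have hGc : Continuous G := hFc.comp (by fun_prop)
    rw [integrable_prod_iff' hGc.aestronglyMeasurable]
    have hF2 := (integrable_prod_iff' hFc.aestronglyMeasurable).1 hFi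
    refine ⟨?_, ?_⟩
    · filter_upwards [hF2.1] with y hy
      exact hy.comp_sub_right (ε • y)
    · refine hF2.2.congr (Eventually.of_forall fun y ↦ ?_)
      exact (integral_sub_right_eq_self (fun x ↦ ‖F (x, y)‖) (ε • y)).symm
  have h3 : ∀ y, ∫ x, F (x, y) = ∫ z, G (z, y) := fun y ↦
    (integral_sub_right_eq_self (fun x ↦ F (x, y)) (ε • y)).symm
  simp_rw [h3]
  rw [← integral_integral_swap (f := fun z y ↦ G (z, y)) hGi, ← integral_zero (Eu m) ℂ]
  congr 1
  ext z
  have h4 : ∀ y, G (z, y) = φ y * inner ℂ (g (z - ε • y)) (a z (h (z - ε • y))) := by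
    intro y
    simp [G, F]
  simp_rw [h4]
  refine integral_mul_comp_eq_zero (b := fun x ↦ inner ℂ (g x) (a z (h x))) ?_ hε
    (fun η hη ↦ ?_) z
  · refine ((integrable_norm_mul_norm g h).const_mul M).mono'
      (g.continuous.inner ((a z).continuous.comp h.continuous)).aestronglyMeasurable
      (Eventually.of_forall fun x ↦ ?_)
    calc ‖inner ℂ (g x) (a z (h x))‖ ≤ ‖g x‖ * (M * ‖h x‖) := by
          grw [norm_inner_le_norm, (a z).le_opNorm, ha.norm_le]
      _ = _ := by ring
  · refine integral_exp_mul_inner_eq_zero g h (a z) η fun ζ ↦ ?_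
    by_contra! hne
    have h5 := hs ζ (ζ - η) hne.1 hne.2
    rw [sub_sub_cancel] at h5
    refine hη (hφ _ ?_)
    rwa [norm_neg, norm_smul, Real.norm_of_nonneg hε.le]

/-- Subtracting the mollification of `a` does not change the pairing, since its contribution is
zero, and the difference is bounded by `M ε^τ`. -/
theorem norm_integral_inner_le_of_separated
    (hφ : ∀ η, 1 ≤ ‖η‖ → (𝓕 φ : 𝓢(Eu m, ℂ)) η = 0)
    {M : ℝ} {a : Eu m → H₀ →L[ℂ] H₁} (ha : ApproxBound φ τ M a) (g : 𝓢(Eu m, H₁))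
    (h : 𝓢(Eu m, H₀)) {ε : ℝ} (hε : 0 < ε) (hε1 : ε ≤ 1)
    (hs : ∀ ζ ξ, (𝓕 g : 𝓢(Eu m, H₁)) ζ ≠ 0 → (𝓕 h : 𝓢(Eu m, H₀)) ξ ≠ 0 → 1 ≤ ε * ‖ζ - ξ‖) :
    ‖∫ x, inner ℂ (g x) (a x (h x))‖ ≤ M * ε ^ τ * ‖g.toLp 2‖ * ‖h.toLp 2‖ := by
  obtain ⟨h1, h2⟩ := integral_inner_mollify_eq_zero hφ ha g h hε hs
  have hi : Integrable fun x ↦ inner ℂ (g x) (a x (h x)) := by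
    refine ((integrable_norm_mul_norm g h).const_mul M).mono'
      (g.continuous.inner (ha.continuous.clm_apply h.continuous)).aestronglyMeasurable
      (Eventually.of_forall fun x ↦ ?_)
    have := ha.nonneg
    calc ‖inner ℂ (g x) (a x (h x))‖ ≤ ‖g x‖ * (M * ‖h x‖) := by
          grw [norm_inner_le_norm, (a x).le_opNorm, ha.norm_le]
      _ = _ := by ring
  have h3 := norm_integral_inner_le (b := fun x ↦ a x - ∫ y, φ y • a (x + ε • y))
    (ha.approx ε hε hε1) g h
  simp only [sub_apply, inner_sub_right] at h3
  rwa [integral_sub hi h1, h2, sub_zero] at h3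

end Pairing

/-! ### Symbol estimates after rescaling. -/

section Symbols

variable {m : ℕ}

/-- The substitution `ξ = 2πη` absorbs the factor `(2π)^{-m}` and passes to the Fourier transform
with kernel `e^{-2πi y·η}`. -/
theorem OP_eq_integral {H₀ H₁ : Type*} [NormedAddCommGroup H₀] [InnerProductSpace ℂ H₀]
    [NormedAddCommGroup H₁] [InnerProductSpace ℂ H₁]
    (p : Eu m → Eu m → H₀ →L[ℂ] H₁) (f : 𝓢(Eu m, H₀)) (x : Eu m) :
    OP p f x = ∫ η, Complex.exp ((2 * Real.pi * inner ℝ x η : ℝ) * Complex.I) •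
      p x ((2 * Real.pi) • η) ((𝓕 f : 𝓢(Eu m, H₀)) η) := by
  have h1 : ∀ η : Eu m, fourierHat f ((2 * Real.pi) • η) = (𝓕 f : 𝓢(Eu m, H₀)) η := by
    intro η
    rw [SchwartzMap.fourier_coe, Real.fourier_eq', fourierHat]
    congr 1
    ext y
    congr 2
    rw [real_inner_smul_right]
    push_cast
    ring
  have h2 := Measure.integral_comp_smul (volume : Measure (Eu m)) (fun ξ : Eu m ↦
    Complex.exp (Complex.I * (inner ℝ x ξ : ℝ)) • p x ξ (fourierHat f ξ)) (2 * Real.pi)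
  rw [finrank_euclideanSpace_fin, abs_of_pos (by positivity)] at h2
  have h3 : OP p f x = ((2 * Real.pi) ^ m)⁻¹ • ∫ ξ : Eu m,
      Complex.exp (Complex.I * (inner ℝ x ξ : ℝ)) • p x ξ (fourierHat f ξ) := by
    rw [OP, ← Complex.coe_smul]
    push_cast
    rfl
  rw [h3, ← h2]
  congr 1
  ext η
  rw [h1]
  congr 2
  rw [real_inner_smul_right]
  push_cast
  ring

theorem rpow_le_rpow_abs_mul {x y K r s : ℝ} (hy : 0 < y) (hK : 1 ≤ K) (h1 : y ≤ K * x)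
    (h2 : x ≤ K * y) (hr : |r| ≤ s) : x ^ r ≤ K ^ s * y ^ r := by
  have hx : 0 < x := by
    by_contra! h
    nlinarith
  have hK0 : 0 < K := by linarith
  have h3 : K ^ |r| ≤ K ^ s := Real.rpow_le_rpow_of_exponent_le hK hr
  rcases le_total 0 r with h | h
  · rw [abs_of_nonneg h] at h3
    calc x ^ r ≤ (K * y) ^ r := by gcongr
      _ = K ^ r * y ^ r := Real.mul_rpow hK0.le hy.le
      _ ≤ _ := by gcongr
  · rw [abs_of_nonpos h] at h3
    calc x ^ r = (K * x) ^ r * K ^ (-r) := by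
          rw [Real.mul_rpow hK0.le hx.le, Real.rpow_neg hK0.le]
          field_simp
      _ ≤ y ^ r * K ^ s := by
          gcongr ?_ * ?_
          exact Real.rpow_le_rpow_of_nonpos hy h1 h
      _ = _ := mul_comm _ _

variable {X : Type*} [NormedAddCommGroup X] [NormedSpace ℂ X]
  {φ : 𝓢(Eu m, ℂ)} {τ d : ℝ} {N : ℕ} {p : Eu m → Eu m → X}

theorem pderiv_iterate_comp_smul (c : ℝ) (i : Fin m) (k : ℕ) {f : Eu m → X}
    (hf : ContDiff ℝ k f) : (pderiv i)^[k] (fun ζ ↦ f (c • ζ)) =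
      fun ζ ↦ ((c : ℂ) ^ k) • (pderiv i)^[k] f (c • ζ) := by
  induction k generalizing f with
  | zero => simp
  | succ k ih =>
    have h1 : pderiv i (fun ζ ↦ f (c • ζ)) = fun ζ ↦ (fun ζ ↦ (c : ℂ) • pderiv i f ζ) (c • ζ) := by
      ext ζ
      simp only [pderiv]
      rw [fderiv_comp_smul]
      simp
    have h2 : ∀ (j : ℕ) (g : Eu m → X), ContDiff ℝ j g →
        (pderiv i)^[j] (fun ζ ↦ (c : ℂ) • g ζ) = fun ζ ↦ (c : ℂ) • (pderiv i)^[j] g ζ := by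
      intro j
      induction j with
      | zero => intro g _; rfl
      | succ j ihj =>
        intro g hg
        have h3 : pderiv i (fun ζ ↦ (c : ℂ) • g ζ) = fun ζ ↦ (c : ℂ) • pderiv i g ζ := by
          ext ζ
          simp only [pderiv]
          rw [fderiv_fun_const_smul (hg.differentiable (by norm_cast) ζ)]
          simp
        rw [Function.iterate_succ_apply, Function.iterate_succ_apply, h3,
          ihj _ (contDiff_pderiv hg i)]
    have h4 := contDiff_pderiv hf i
    have h5 : ContDiff ℝ k fun ζ ↦ (c : ℂ) • pderiv i f ζ := contDiff_const.smul h4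
    rw [Function.iterate_succ_apply, h1, ih h5, h2 k _ h4]
    ext ζ
    rw [smul_smul, Function.iterate_succ_apply, pow_succ]

variable [CompleteSpace X]

theorem IsSymbol.exists_approxBound (hp : IsSymbol τ d N p) (hτ : 0 ≤ τ)
    (hφ : (𝓕 φ : 𝓢(Eu m, ℂ)) =ᶠ[𝓝 0] fun _ ↦ 1) :
    ∃ C : ℝ, 0 ≤ C ∧ ∀ i, ∀ k ≤ N, ∀ ξ : Eu m,
      ApproxBound φ τ (C * (1 + ‖ξ‖ ^ 2) ^ ((d - k) / 2)) fun x ↦ (pderiv i)^[k] (p x) ξ := by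
  obtain ⟨C₀, hC₀0, hC₀⟩ := NonsmoothPsiDO.exists_approxBound (X := X) hτ hφ
  have h1 : ∀ i : Fin m, ∀ k : ℕ, ∃ C : ℝ, k ≤ N → ∀ ξ : Eu m,
      holderENorm τ (fun x ↦ (pderiv i)^[k] (p x) ξ) ≤
        ENNReal.ofReal (C * (1 + ‖ξ‖ ^ 2) ^ ((d - k) / 2)) := by
    intro i k
    by_cases hk : k ≤ N
    · obtain ⟨C, hC⟩ := hp.bound (Pi.single i k) (by simpa using hk)
      refine ⟨C, fun _ ξ ↦ ?_⟩
      simpa [mderiv_single] using hC ξ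
    · exact ⟨0, fun h ↦ absurd h hk⟩
  choose C hC using h1
  -- One constant for all directions and orders; absolute values are taken because the constants of
  -- the symbol class carry no sign.
  refine ⟨C₀ * ∑ i, ∑ k ∈ Finset.range (N + 1), |C i k|, by positivity, fun i k hk ξ ↦ ?_⟩
  have h2 : C i k ≤ ∑ i, ∑ k ∈ Finset.range (N + 1), |C i k| := by
    refine (le_abs_self _).trans (le_trans ?_ (Finset.single_le_sum
      (f := fun i ↦ ∑ k ∈ Finset.range (N + 1), |C i k|) (fun i _ ↦ by positivity)
      (Finset.mem_univ i)))
    exact Finset.single_le_sum (f := fun k ↦ |C i k|) (fun i _ ↦ by positivity)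
      (Finset.mem_range.2 (by omega))
  rw [mul_assoc]
  refine hC₀ _ _ (by positivity) ?_ ((hC i k hk ξ).trans ?_)
  · simpa [mderiv_single] using hp.contDiff_left (Pi.single i k) (by simpa using hk) ξ
  · gcongr

/-- The rescaled symbol `ζ ↦ p(x, 2πR ζ)` on the unit scale. -/
theorem IsSymbol.exists_approxBound_rescale (hp : IsSymbol τ d N p) (hτ : 0 ≤ τ)
    (hφ : (𝓕 φ : 𝓢(Eu m, ℂ)) =ᶠ[𝓝 0] fun _ ↦ 1) :
    ∃ C : ℝ, 0 ≤ C ∧ ∀ R : ℝ, 1 ≤ R → ∀ i, ∀ k ≤ N, ∀ ζ : Eu m, ‖ζ‖ ≤ 4 →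
      (1 / 4 ≤ ‖ζ‖ ∨ R = 1) →
      ApproxBound φ τ (C * R ^ d) fun x ↦
        (pderiv i)^[k] (fun ζ ↦ p x ((2 * Real.pi * R) • ζ)) ζ := by
  obtain ⟨C, hC0, hC⟩ := hp.exists_approxBound hτ hφ
  -- With `c = 2πR`, the quantity `1 + ‖cζ‖²` is comparable to `c²` up to the factor `40`. This uses
  -- `‖ζ‖ ≥ 1/4`, or else `R = 1`, where `c² = (2π)² < 40`. The exponent bounds `|d - k| / 2` for
  -- all `k ≤ N`.
  refine ⟨C * 40 ^ ((|d| + N) / 2) * (2 * Real.pi) ^ d, by positivity, ?_⟩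
  intro R hR i k hk ζ hζ hζR
  set c : ℝ := 2 * Real.pi * R with hc
  have hpi : 2 * Real.pi ≤ c := by
    rw [hc]; nlinarith [Real.pi_pos]
  have hc1 : 1 ≤ c := by linarith [Real.pi_gt_three]
  have h1 : (fun x ↦ (pderiv i)^[k] (fun ζ ↦ p x (c • ζ)) ζ) =
      fun x ↦ ((c : ℂ) ^ k) • (pderiv i)^[k] (p x) (c • ζ) := by
    ext x
    rw [pderiv_iterate_comp_smul c i k ((hp.contDiff_right x).of_le (by exact_mod_cast hk))]
  rw [h1]
  refine ((hC i k hk (c • ζ)).const_smul _).mono ?_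
  have h2 : ‖c • ζ‖ ^ 2 = c ^ 2 * ‖ζ‖ ^ 2 := by
    rw [norm_smul, Real.norm_of_nonneg (by linarith), mul_pow]
  have h3 : ‖ζ‖ ^ 2 ≤ 16 := by nlinarith [norm_nonneg ζ]
  have h4 : (1 + ‖c • ζ‖ ^ 2) ^ ((d - k) / 2) ≤
      40 ^ ((|d| + N) / 2) * (c ^ 2) ^ ((d - k) / 2) := by
    refine rpow_le_rpow_abs_mul (by positivity) (by norm_num) ?_ ?_ ?_
    · rw [h2]
      rcases hζR with h | h
      · have : (1 / 4 : ℝ) ^ 2 ≤ ‖ζ‖ ^ 2 := by gcongr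
        nlinarith
      · have : c ^ 2 ≤ 40 := by
          rw [hc, h, mul_one]
          nlinarith [Real.pi_lt_d2, Real.pi_pos]
        nlinarith [sq_nonneg (c * ‖ζ‖)]
    · rw [h2]; nlinarith
    · rw [abs_div, abs_of_pos (by norm_num : (0 : ℝ) < 2)]
      gcongr
      refine (abs_sub _ _).trans ?_
      rw [Nat.abs_cast]
      gcongr
  -- The factor `c^k` from the chain rule cancels the gain of the symbol under `k` differentiations,
  -- so that all orders are bounded by the same multiple of `R^d`.
  have h5 : c ^ k * (c ^ 2) ^ ((d - k) / 2) = (2 * Real.pi) ^ d * R ^ d := by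
    rw [← Real.rpow_natCast c k, ← Real.rpow_natCast c 2, ← Real.rpow_mul (by positivity),
      ← Real.rpow_add (by positivity), hc, ← Real.mul_rpow (by positivity) (by positivity)]
    congr 1
    push_cast
    ring
  calc ‖(c : ℂ) ^ k‖ * (C * (1 + ‖c • ζ‖ ^ 2) ^ ((d - k) / 2))
      ≤ c ^ k * (C * (40 ^ ((|d| + N) / 2) * (c ^ 2) ^ ((d - k) / 2))) := by
        rw [norm_pow, Complex.norm_real, Real.norm_of_nonneg (by linarith)]
        gcongr
    _ = C * 40 ^ ((|d| + N) / 2) * (c ^ k * (c ^ 2) ^ ((d - k) / 2)) := by ring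
    _ = _ := by rw [h5]; ring

end Symbols

/-! ### Kernel representation of the operator on a frequency shell. -/

section Dyadic

variable {m : ℕ} {H₀ H₁ : Type*}
  [NormedAddCommGroup H₀] [InnerProductSpace ℂ H₀] [CompleteSpace H₀]
  [NormedAddCommGroup H₁] [InnerProductSpace ℂ H₁] [CompleteSpace H₁]
  {φ : 𝓢(Eu m, ℂ)} {τ d : ℝ} {N : ℕ} {p : Eu m → Eu m → H₀ →L[ℂ] H₁}

/-- Insert Fourier inversion for `f`, exchange the integrals, and recognise the `w`-integral as
Fourier inversion for `h` at `rη`. Integrability of the kernel is what allows both. -/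
theorem integral_kernel_apply_eq {h : Eu m → H₀ →L[ℂ] H₁} (hh : Continuous h)
    (hi : Integrable h) (hk : Integrable (𝓕 h)) (f : 𝓢(Eu m, H₀)) (r : ℝ) (x : Eu m) :
    ∫ w, 𝓕 h w (f (x + r • w)) = ∫ η, Complex.exp ((2 * Real.pi * inner ℝ x η : ℝ) * Complex.I) •
      h (r • η) ((𝓕 f : 𝓢(Eu m, H₀)) η) := by
  have hKc : Continuous (𝓕 h) :=
    VectorFourier.fourierIntegral_continuous Real.continuous_fourierChar
      (L := innerₗ (Eu m)) continuous_inner hi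
  have hf : ∀ y, f y = ∫ η, Complex.exp ((2 * Real.pi * inner ℝ η y : ℝ) * Complex.I) •
      (𝓕 f : 𝓢(Eu m, H₀)) η := by
    intro y
    rw [← Real.fourierInv_eq', ← SchwartzMap.fourierInv_coe,
      FourierTransform.fourierInv_fourier_eq]
  let F : Eu m → Eu m → H₁ := fun w η ↦
    Complex.exp ((2 * Real.pi * inner ℝ η (x + r • w) : ℝ) * Complex.I) •
      𝓕 h w ((𝓕 f : 𝓢(Eu m, H₀)) η)
  have hFi : Integrable (Function.uncurry F) (volume.prod volume) := by
    refine (hk.norm.mul_prod (𝓕 f : 𝓢(Eu m, H₀)).integrable.norm).mono' ?_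
      (Eventually.of_forall fun z ↦ ?_)
    · refine Continuous.aestronglyMeasurable ?_
      have h1 : Continuous fun z : Eu m × Eu m ↦ 𝓕 h z.1 ((𝓕 f : 𝓢(Eu m, H₀)) z.2) :=
        (hKc.comp continuous_fst).clm_apply ((𝓕 f : 𝓢(Eu m, H₀)).continuous.comp continuous_snd)
      exact Continuous.smul (by fun_prop) h1
    · simp only [F, Function.uncurry, norm_smul, Complex.norm_exp_ofReal_mul_I, one_mul]
      exact (𝓕 h z.1).le_opNorm _
  have h1 : ∀ w, 𝓕 h w (f (x + r • w)) = ∫ η, F w η := by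
    intro w
    rw [hf, ← ContinuousLinearMap.integral_comp_comm]
    · simp [F]
    · rw [← integrable_norm_iff]
      · simpa only [norm_smul, Complex.norm_exp_ofReal_mul_I, one_mul] using
          ((𝓕 f : 𝓢(Eu m, H₀)).integrable (μ := (volume : Measure (Eu m)))).norm
      · exact Continuous.aestronglyMeasurable (by fun_prop)
  simp_rw [h1]
  rw [integral_integral_swap hFi]
  congr 1
  ext η
  have h2 : h (r • η) = ∫ w, Complex.exp ((2 * Real.pi * inner ℝ w (r • η) : ℝ) * Complex.I) •
      𝓕 h w := by
    rw [← Real.fourierInv_eq', hi.fourierInv_fourier_eq hk hh.continuousAt]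
  have h3 : Integrable fun w ↦ Complex.exp ((2 * Real.pi * inner ℝ w (r • η) : ℝ) * Complex.I) •
      𝓕 h w := by
    rw [← integrable_norm_iff]
    · simpa only [norm_smul, Complex.norm_exp_ofReal_mul_I, one_mul] using hk.norm
    · exact Continuous.aestronglyMeasurable (by fun_prop)
  rw [h2, ContinuousLinearMap.integral_apply h3, ← integral_smul]
  congr 1
  ext w
  simp only [F, smul_apply, smul_smul, ← Complex.exp_add]
  congr 2
  rw [inner_add_right, real_inner_smul_right, real_inner_smul_right, real_inner_comm η x,
    real_inner_comm η w]
  push_cast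
  ring

/-- Reduction of the pairing with a frequency localized piece to the pairings with the
multiplication operators given by the kernel. -/
theorem norm_integral_inner_OP_le {ψ : Eu m → ℂ} (hψ : Continuous ψ) (hc : HasCompactSupport ψ)
    (hp : ∀ x, Continuous (p x)) {R B β : ℝ} (hR : 0 < R)
    (hK : ∀ w, ApproxBound φ τ (B * (1 + ‖w‖) ^ (-((m + 1 : ℕ) : ℝ))) fun x ↦
      𝓕 (fun ζ ↦ ψ ζ • p x ((2 * Real.pi * R) • ζ)) w)
    (g : 𝓢(Eu m, H₁)) (f : 𝓢(Eu m, H₀))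
    (hf : ∀ η, (𝓕 f : 𝓢(Eu m, H₀)) η ≠ 0 → ψ (R⁻¹ • η) = 1)
    (hβ : ∀ (M : ℝ) (a : Eu m → H₀ →L[ℂ] H₁) (v : Eu m), ApproxBound φ τ M a →
      ‖∫ x, inner ℂ (g x) (a x (SchwartzMap.compSubConstCLM ℂ v f x))‖ ≤
        M * β * ‖g.toLp 2‖ * ‖f.toLp 2‖) :
    ‖∫ x, inner ℂ (g x) (OP p f x)‖ ≤
      (∫ w : Eu m, (1 + ‖w‖) ^ (-((m + 1 : ℕ) : ℝ))) * B * β * ‖g.toLp 2‖ * ‖f.toLp 2‖ := by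
  set K : Eu m → Eu m → H₀ →L[ℂ] H₁ := fun x w ↦
    𝓕 (fun ζ ↦ ψ ζ • p x ((2 * Real.pi * R) • ζ)) w with hKdef
  -- Decay of order `m + 1` is integrable in dimension `m`; this fixes the number of derivatives
  -- required of the symbol.
  have hW : Integrable fun w : Eu m ↦ (1 + ‖w‖) ^ (-((m + 1 : ℕ) : ℝ)) :=
    integrable_one_add_norm (by rw [finrank_euclideanSpace_fin]; push_cast; linarith)
  have hhc : ∀ x, Continuous fun ζ ↦ ψ ζ • p x ((2 * Real.pi * R) • ζ) := fun x ↦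
    hψ.smul ((hp x).comp (by fun_prop))
  have hhi : ∀ x, Integrable fun ζ ↦ ψ ζ • p x ((2 * Real.pi * R) • ζ) := fun x ↦
    (hhc x).integrable_of_hasCompactSupport hc.smul_right
  have hKc : ∀ x, Continuous (K x) := fun x ↦
    VectorFourier.fourierIntegral_continuous Real.continuous_fourierChar
      (L := innerₗ (Eu m)) continuous_inner (hhi x)
  have hKi : ∀ x, Integrable (K x) := fun x ↦
    (hW.const_mul B).mono' (hKc x).aestronglyMeasurable
      (Eventually.of_forall fun w ↦ (hK w).norm_le x)
  -- The cutoff may be inserted because it equals `1` at `R⁻¹η` wherever the transform of `f` is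
  -- nonzero.
  have hrep : ∀ x, OP p f x = ∫ w, K x w (f (x + R⁻¹ • w)) := by
    intro x
    rw [integral_kernel_apply_eq (hhc x) (hhi x) (hKi x) f R⁻¹ x, OP_eq_integral]
    congr 1
    ext η
    by_cases h0 : (𝓕 f : 𝓢(Eu m, H₀)) η = 0
    · simp [h0]
    · rw [hf η h0, one_smul, smul_smul, mul_assoc (2 * Real.pi), mul_inv_cancel₀ hR.ne', mul_one]
  obtain ⟨Cf, hCf⟩ : ∃ Cf, ∀ x, ‖f x‖ ≤ Cf := ⟨_, SchwartzMap.norm_le_seminorm ℂ f⟩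
  have hCf0 : 0 ≤ Cf := (norm_nonneg _).trans (hCf 0)
  let F : Eu m → Eu m → ℂ := fun x w ↦ inner ℂ (g x) (K x w (f (x + R⁻¹ • w)))
  have hFi : Integrable (Function.uncurry F) (volume.prod volume) := by
    refine ((g.integrable.norm.const_mul Cf).mul_prod (hW.const_mul B)).mono' ?_
      (Eventually.of_forall fun z ↦ ?_)
    · refine StronglyMeasurable.aestronglyMeasurable ?_
      refine stronglyMeasurable_uncurry_of_continuous_of_stronglyMeasurable (fun w ↦ ?_) fun x ↦ ?_
      · exact g.continuous.inner ((hK w).continuous.clm_apply (f.continuous.comp (by fun_prop)))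
      · refine Continuous.stronglyMeasurable ?_
        exact continuous_const.inner ((hKc x).clm_apply (f.continuous.comp (by fun_prop)))
    · have h0 := (hK z.2).nonneg
      calc ‖F z.1 z.2‖ ≤ ‖g z.1‖ * ((B * (1 + ‖z.2‖) ^ (-((m + 1 : ℕ) : ℝ))) * Cf) := by
            simp only [F]
            grw [norm_inner_le_norm, (K _ _).le_opNorm, (hK z.2).norm_le z.1, hCf]
        _ = _ := by ring
  have h1 : ∀ x, inner ℂ (g x) (OP p f x) = ∫ w, F x w := by
    intro x
    rw [hrep]
    have hi : Integrable fun w ↦ K x w (f (x + R⁻¹ • w)) := by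
      refine ((hKi x).norm.mul_const Cf).mono' ?_ (Eventually.of_forall fun w ↦ ?_)
      · exact ((hKc x).clm_apply (f.continuous.comp (by fun_prop))).aestronglyMeasurable
      · grw [(K x w).le_opNorm, hCf]
    have h2 := (innerSL ℂ (g x)).integral_comp_comm hi
    simpa only [innerSL_apply_apply] using h2.symm
  simp_rw [h1]
  rw [integral_integral_swap hFi]
  -- For fixed `w` the integrand is the pairing of `g` with the multiplication operator `K(·, w)`
  -- applied to a translate of `f`.
  have h3 : ∀ w, ‖∫ x, F x w‖ ≤ (1 + ‖w‖) ^ (-((m + 1 : ℕ) : ℝ)) *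
      (B * β * ‖g.toLp 2‖ * ‖f.toLp 2‖) := by
    intro w
    have h4 := hβ _ _ (-(R⁻¹ • w)) (hK w)
    simp only [SchwartzMap.compSubConstCLM_apply, sub_neg_eq_add] at h4
    exact h4.trans (le_of_eq (by ring))
  refine (norm_integral_le_of_norm_le (hW.mul_const _) (Eventually.of_forall h3)).trans ?_
  rw [integral_mul_const]
  exact le_of_eq (by ring)

end Dyadic

/-! ### Dyadic partition of unity. -/

section Cutoff

variable {m : ℕ}

/-- A smooth radial cutoff function, equal to `1` on the unit ball and to `0` outside of the ball
of radius `√2`. -/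
def cutoff (ξ : Eu m) : ℝ := Real.smoothTransition (2 - ‖ξ‖ ^ 2)

theorem contDiff_cutoff {n : ℕ∞} : ContDiff ℝ n (cutoff (m := m)) :=
  Real.smoothTransition.contDiff.comp (contDiff_const.sub (contDiff_norm_sq ℝ))

theorem cutoff_eq_one {ξ : Eu m} (h : ‖ξ‖ ≤ 1) : cutoff ξ = 1 :=
  Real.smoothTransition.one_of_one_le (by nlinarith [norm_nonneg ξ])

theorem cutoff_eq_zero {ξ : Eu m} (h : 2 ≤ ‖ξ‖ ^ 2) : cutoff ξ = 0 :=
  Real.smoothTransition.zero_of_nonpos (by linarith)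

theorem cutoff_eq_zero_of_two_le {ξ : Eu m} (h : 2 ≤ ‖ξ‖) : cutoff ξ = 0 :=
  cutoff_eq_zero (by nlinarith)

theorem cutoff_nonneg (ξ : Eu m) : 0 ≤ cutoff ξ := Real.smoothTransition.nonneg _

theorem cutoff_le_one (ξ : Eu m) : cutoff ξ ≤ 1 := Real.smoothTransition.le_one _

theorem cutoff_le_of_norm_le {ξ η : Eu m} (h : ‖ξ‖ ≤ ‖η‖) : cutoff η ≤ cutoff ξ :=
  Real.smoothTransition.monotone (by gcongr)

/-- The functions of a dyadic partition of unity. -/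
def dyadicCutoff : ℕ → Eu m → ℝ
  | 0, ξ => cutoff ξ
  | j + 1, ξ => cutoff (((2 : ℝ) ^ (j + 1))⁻¹ • ξ) - cutoff (((2 : ℝ) ^ j)⁻¹ • ξ)

/-- The dyadic shells. -/
def shell (m j : ℕ) : Set (Eu m) := {ξ | ‖ξ‖ ≤ 2 ^ (j + 1) ∧ (j = 0 ∨ 2 ^ j ≤ 2 * ‖ξ‖)}

theorem norm_inv_two_pow_smul (j : ℕ) (ξ : Eu m) :
    ‖((2 : ℝ) ^ j)⁻¹ • ξ‖ = ‖ξ‖ / 2 ^ j := by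
  rw [norm_smul, Real.norm_of_nonneg (by positivity), inv_mul_eq_div]

theorem mem_shell_of_dyadicCutoff_ne_zero {j : ℕ} {ξ : Eu m} (h : dyadicCutoff j ξ ≠ 0) :
    ξ ∈ shell m j := by
  cases j with
  | zero =>
    refine ⟨?_, Or.inl rfl⟩
    by_contra! h1
    exact h (cutoff_eq_zero_of_two_le (by simpa using h1.le))
  | succ j =>
    have hj : (0 : ℝ) < 2 ^ j := by positivity
    refine ⟨?_, Or.inr ?_⟩
    · by_contra! h1
      apply h
      rw [dyadicCutoff, cutoff_eq_zero_of_two_le, cutoff_eq_zero_of_two_le, sub_zero]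
      · rw [norm_inv_two_pow_smul, le_div_iff₀ hj]
        rw [pow_succ, pow_succ] at h1
        nlinarith
      · rw [norm_inv_two_pow_smul, le_div_iff₀ (by positivity)]
        rw [pow_succ] at h1
        linarith
    · by_contra! h1
      rw [pow_succ] at h1
      apply h
      rw [dyadicCutoff, cutoff_eq_one, cutoff_eq_one, sub_self]
      · rw [norm_inv_two_pow_smul, div_le_iff₀ hj]
        linarith
      · rw [norm_inv_two_pow_smul, div_le_iff₀ (by positivity), pow_succ]
        linarith

theorem dyadicCutoff_nonneg (j : ℕ) (ξ : Eu m) : 0 ≤ dyadicCutoff j ξ := by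
  cases j with
  | zero => exact cutoff_nonneg _
  | succ j =>
    refine sub_nonneg.2 (cutoff_le_of_norm_le ?_)
    rw [norm_inv_two_pow_smul, norm_inv_two_pow_smul]
    gcongr
    · norm_num
    · omega

theorem sum_dyadicCutoff (n : ℕ) (ξ : Eu m) :
    ∑ j ∈ Finset.range (n + 1), dyadicCutoff j ξ = cutoff (((2 : ℝ) ^ n)⁻¹ • ξ) := by
  induction n with
  | zero => simp [dyadicCutoff]
  | succ n ih => rw [Finset.sum_range_succ, ih, dyadicCutoff]; ring

theorem hasCompactSupport_of_norm_le {Y : Type*} [Zero Y] {f : Eu m → Y} {r : ℝ}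
    (h : ∀ ξ, f ξ ≠ 0 → ‖ξ‖ ≤ r) : HasCompactSupport f :=
  HasCompactSupport.of_support_subset_isCompact (isCompact_closedBall 0 r) fun ξ hξ ↦ by
    simpa using h ξ hξ

/-- There is a Schwartz function whose Fourier transform is a cutoff function. -/
theorem exists_fourier_eq_cutoff (m : ℕ) : ∃ φ : 𝓢(Eu m, ℂ),
    ((𝓕 φ : 𝓢(Eu m, ℂ)) =ᶠ[𝓝 0] fun _ ↦ 1) ∧ ∀ η, 1 ≤ ‖η‖ → (𝓕 φ : 𝓢(Eu m, ℂ)) η = 0 := by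
  have hn : ∀ η : Eu m, ‖(2 : ℝ) • η‖ = 2 * ‖η‖ := fun η ↦ by rw [norm_smul]; norm_num
  have h1 : HasCompactSupport fun η : Eu m ↦ (cutoff ((2 : ℝ) • η) : ℂ) := by
    refine hasCompactSupport_of_norm_le (r := 1) fun η hη ↦ ?_
    by_contra! h
    refine hη ?_
    rw [cutoff_eq_zero_of_two_le, Complex.ofReal_zero]
    rw [hn]; linarith
  have h2 : ContDiff ℝ (⊤ : ℕ∞) fun η : Eu m ↦ (cutoff ((2 : ℝ) • η) : ℂ) :=
    Complex.ofRealCLM.contDiff.comp (contDiff_cutoff.comp (contDiff_id.const_smul _))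
  refine ⟨𝓕⁻ (h1.toSchwartzMap h2), ?_, ?_⟩
  · rw [FourierTransform.fourier_fourierInv_eq]
    filter_upwards [Metric.ball_mem_nhds (0 : Eu m) (by norm_num : (0 : ℝ) < 1 / 2)] with η hη
    change (cutoff ((2 : ℝ) • η) : ℂ) = 1
    rw [cutoff_eq_one, Complex.ofReal_one]
    rw [hn]
    simp at hη
    linarith
  · intro η hη
    rw [FourierTransform.fourier_fourierInv_eq]
    change (cutoff ((2 : ℝ) • η) : ℂ) = 0
    rw [cutoff_eq_zero_of_two_le, Complex.ofReal_zero]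
    rw [hn]; linarith

end Cutoff

/-! ### Almost diagonal estimate for dyadic pieces. -/

section DyadicEstimate

variable {m : ℕ} {H₀ H₁ : Type*}
  [NormedAddCommGroup H₀] [InnerProductSpace ℂ H₀]
  [NormedAddCommGroup H₁] [InnerProductSpace ℂ H₁] [CompleteSpace H₁]
  {φ : 𝓢(Eu m, ℂ)} {τ d : ℝ} {N : ℕ} {p : Eu m → Eu m → H₀ →L[ℂ] H₁}

/-- The rescaled symbols obey bounds uniform in `R`, apart from the factor `R^d`, on the region `1/4
≤ ‖ζ‖ ≤ 4`. The alternative `R = 1` serves the lowest frequencies, where the cutoff does not vanish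
near the origin. -/
theorem IsSymbol.exists_kernel_of_cutoff (hp : IsSymbol τ d N p) (hτ : 0 ≤ τ) (hm : 1 ≤ m)
    (hN : m + 1 ≤ N) (hφ : (𝓕 φ : 𝓢(Eu m, ℂ)) =ᶠ[𝓝 0] fun _ ↦ 1)
    {ψ : Eu m → ℂ} (hψ : ContDiff ℝ (m + 1 : ℕ) ψ) (hψ4 : ∀ ζ, ψ ζ ≠ 0 → ‖ζ‖ ≤ 4) :
    ∃ B : ℝ, 0 ≤ B ∧ ∀ R : ℝ, 1 ≤ R → ((∀ ζ, ψ ζ ≠ 0 → 1 / 4 ≤ ‖ζ‖) ∨ R = 1) →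
      ∀ w, ApproxBound φ τ (B * R ^ d * (1 + ‖w‖) ^ (-((m + 1 : ℕ) : ℝ))) fun x ↦
        𝓕 (fun ζ ↦ ψ ζ • p x ((2 * Real.pi * R) • ζ)) w := by
  obtain ⟨C₁, hC₁0, hC₁⟩ := hp.exists_approxBound_rescale hτ hφ
  obtain ⟨C₂, hC₂0, hC₂⟩ := exists_approxBound_kernel (X := H₀ →L[ℂ] H₁) (φ := φ) (τ := τ) hm
    (m + 1) hψ (hasCompactSupport_of_norm_le hψ4)
  refine ⟨C₂ * C₁, by positivity, fun R hR hR' w ↦ ?_⟩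
  rw [mul_assoc C₂]
  refine hC₂ _ _ (by positivity) (fun x ↦ ?_) (fun i k hk ζ hζ ↦ ?_) w
  · exact ((hp.contDiff_right x).of_le (by exact_mod_cast hN)).comp (contDiff_id.const_smul _)
  · refine hC₁ R hR i k (hk.trans hN) ζ ?_ (hR'.imp_left fun h ↦ ?_)
    · exact closure_minimal (t := {ζ | ‖ζ‖ ≤ 4}) hψ4
        (isClosed_le continuous_norm continuous_const) hζ
    · exact closure_minimal (t := {ζ | 1 / 4 ≤ ‖ζ‖}) h
        (isClosed_le continuous_const continuous_norm) hζ

theorem IsSymbol.exists_kernel (hp : IsSymbol τ d N p) (hτ : 0 ≤ τ) (hm : 1 ≤ m)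
    (hN : m + 1 ≤ N) (hφ : (𝓕 φ : 𝓢(Eu m, ℂ)) =ᶠ[𝓝 0] fun _ ↦ 1) :
    ∃ B : ℝ, 0 ≤ B ∧ ∀ j : ℕ, ∃ ψ : Eu m → ℂ, Continuous ψ ∧ HasCompactSupport ψ ∧
      (∀ η ∈ shell m j, ψ (((2 : ℝ) ^ j)⁻¹ • η) = 1) ∧
      ∀ w, ApproxBound φ τ (B * ((2 : ℝ) ^ j) ^ d * (1 + ‖w‖) ^ (-((m + 1 : ℕ) : ℝ))) fun x ↦
        𝓕 (fun ζ ↦ ψ ζ • p x ((2 * Real.pi * (2 : ℝ) ^ j) • ζ)) w := by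
  have hn2 : ∀ η : Eu m, ‖(2⁻¹ : ℝ) • η‖ = ‖η‖ / 2 := fun η ↦ by
    rw [norm_smul, Real.norm_of_nonneg (by norm_num)]; ring
  have hn4 : ∀ η : Eu m, ‖(4 : ℝ) • η‖ = 4 * ‖η‖ := fun η ↦ by rw [norm_smul]; norm_num
  -- Two cutoffs serve all shells: `ψ₀` is `1` on the ball of radius `2`, for `j = 0`; `ψ₁` is `1`
  -- for `1/2 ≤ ‖ζ‖ ≤ 2`, for `j ≥ 1`. Both vanish for `‖ζ‖ > 4`, and `ψ₁` also for `‖ζ‖ < 1/4`.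
  let ψ₀ : Eu m → ℂ := fun ζ ↦ (cutoff ((2⁻¹ : ℝ) • ζ) : ℂ)
  let ψ₁ : Eu m → ℂ := fun ζ ↦ ((cutoff ((2⁻¹ : ℝ) • ζ) - cutoff ((4 : ℝ) • ζ) : ℝ) : ℂ)
  have h₀s : ContDiff ℝ (m + 1 : ℕ) ψ₀ := Complex.ofRealCLM.contDiff.comp
    (contDiff_cutoff.comp (contDiff_id.const_smul _))
  have h₁s : ContDiff ℝ (m + 1 : ℕ) ψ₁ := Complex.ofRealCLM.contDiff.comp
    ((contDiff_cutoff.comp (contDiff_id.const_smul _)).sub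
      (contDiff_cutoff.comp (contDiff_id.const_smul _)))
  have h₀4 : ∀ ζ, ψ₀ ζ ≠ 0 → ‖ζ‖ ≤ 4 := by
    intro ζ hζ
    by_contra! h
    refine hζ ?_
    simp only [ψ₀]
    rw [cutoff_eq_zero_of_two_le, Complex.ofReal_zero]
    rw [hn2]; linarith
  have h₁4 : ∀ ζ, ψ₁ ζ ≠ 0 → ‖ζ‖ ≤ 4 := by
    intro ζ hζ
    by_contra! h
    refine hζ ?_
    simp only [ψ₁]
    rw [cutoff_eq_zero_of_two_le, cutoff_eq_zero_of_two_le, sub_zero, Complex.ofReal_zero]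
    · rw [hn4]; linarith
    · rw [hn2]; linarith
  have h₁4' : ∀ ζ, ψ₁ ζ ≠ 0 → 1 / 4 ≤ ‖ζ‖ := by
    intro ζ hζ
    by_contra! h
    refine hζ ?_
    simp only [ψ₁]
    rw [cutoff_eq_one, cutoff_eq_one, sub_self, Complex.ofReal_zero]
    · rw [hn4]; linarith
    · rw [hn2]; linarith
  obtain ⟨B₀, hB₀0, hB₀⟩ := hp.exists_kernel_of_cutoff hτ hm hN hφ h₀s h₀4
  obtain ⟨B₁, hB₁0, hB₁⟩ := hp.exists_kernel_of_cutoff hτ hm hN hφ h₁s h₁4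
  refine ⟨B₀ + B₁, by positivity, fun j ↦ ?_⟩
  rcases Nat.eq_zero_or_pos j with rfl | hj
  · refine ⟨ψ₀, h₀s.continuous, hasCompactSupport_of_norm_le h₀4, fun η hη ↦ ?_, fun w ↦ ?_⟩
    · simp only [ψ₀]
      rw [cutoff_eq_one, Complex.ofReal_one]
      have := hη.1
      rw [hn2, norm_inv_two_pow_smul]
      norm_num at this ⊢
      linarith
    · refine (hB₀ (2 ^ 0) (by norm_num) (Or.inr (by norm_num)) w).mono ?_
      gcongr
      linarith
  · refine ⟨ψ₁, h₁s.continuous, hasCompactSupport_of_norm_le h₁4, fun η hη ↦ ?_, fun w ↦ ?_⟩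
    · have h1 := hη.1
      have h2 := hη.2.resolve_left hj.ne'
      have hpos : (0 : ℝ) < 2 ^ j := by positivity
      have h3 : ‖η‖ / 2 ^ j ≤ 2 := by
        rw [div_le_iff₀ hpos]; rw [pow_succ] at h1; linarith
      have h4 : 1 / 2 ≤ ‖η‖ / 2 ^ j := by
        rw [le_div_iff₀ hpos]; linarith
      simp only [ψ₁]
      rw [cutoff_eq_one, cutoff_eq_zero_of_two_le, sub_zero, Complex.ofReal_one]
      · rw [hn4, norm_inv_two_pow_smul]; linarith
      · rw [hn2, norm_inv_two_pow_smul]; linarith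
    · refine (hB₁ (2 ^ j) (one_le_pow₀ (by norm_num)) (Or.inl h₁4') w).mono ?_
      gcongr
      linarith

/-- Here `‖ζ‖ ≥ 2^{l-1}` while `‖ξ‖ ≤ 2^{j+1} ≤ 2^{l-2}`, so the distance is at least `2^{l-2}`. A
gap of three is needed for shells of this width. -/
theorem separated_of_mem_shell {j l : ℕ} (hjl : j + 3 ≤ l) {ζ ξ : Eu m} (hζ : ζ ∈ shell m l)
    (hξ : ξ ∈ shell m j) : 1 ≤ 4 * ((2 : ℝ) ^ l)⁻¹ * ‖ζ - ξ‖ := by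
  have h1 := hζ.2.resolve_left (by omega)
  have h2 := hξ.1
  have h3 : (2 : ℝ) ^ (j + 1) * 4 ≤ 2 ^ l := by
    calc (2 : ℝ) ^ (j + 1) * 4 = 2 ^ (j + 3) := by ring
      _ ≤ _ := pow_le_pow_right₀ (by norm_num) hjl
  have h4 := norm_sub_norm_le ζ ξ
  have hpos : (0 : ℝ) < 2 ^ l := by positivity
  rw [mul_right_comm, ← div_eq_mul_inv, le_div_iff₀ hpos]
  linarith

/-- The first bound is plain boundedness of the multiplication operators in the kernel
representation; the second adds the gain from separated frequencies. The first makes no assumption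
on the frequencies of `g`, which is needed later in a limit argument. -/
theorem IsSymbol.exists_dyadic_estimate [CompleteSpace H₀] (hp : IsSymbol τ d N p) (hτ : 0 ≤ τ)
    (hm : 1 ≤ m)
    (hN : m + 1 ≤ N) : ∃ C : ℝ, 0 ≤ C ∧ ∀ (j : ℕ) (g : 𝓢(Eu m, H₁)) (f : 𝓢(Eu m, H₀)),
      (∀ ξ, (𝓕 f : 𝓢(Eu m, H₀)) ξ ≠ 0 → ξ ∈ shell m j) →
      ‖∫ x, inner ℂ (g x) (OP p f x)‖ ≤ C * ((2 : ℝ) ^ j) ^ d * ‖g.toLp 2‖ * ‖f.toLp 2‖ ∧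
      ∀ l : ℕ, (∀ ξ, (𝓕 g : 𝓢(Eu m, H₁)) ξ ≠ 0 → ξ ∈ shell m l) →
        ‖∫ x, inner ℂ (g x) (OP p f x)‖ ≤
          C * ((2 : ℝ) ^ j) ^ d * 2 ^ (-(τ * |(l : ℝ) - j|)) * ‖g.toLp 2‖ * ‖f.toLp 2‖ := by
  obtain ⟨φ, hφ1, hφ0⟩ := exists_fourier_eq_cutoff m
  obtain ⟨B, hB0, hB⟩ := hp.exists_kernel hτ hm hN hφ1
  obtain ⟨W, hW⟩ : ∃ W : ℝ, W = ∫ w : Eu m, (1 + ‖w‖) ^ (-((m + 1 : ℕ) : ℝ)) := ⟨_, rfl⟩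
  have hW0 : 0 ≤ W := by rw [hW]; exact integral_nonneg fun w ↦ by positivity
  have h4τ : (1 : ℝ) ≤ 4 ^ τ := Real.one_le_rpow (by norm_num) hτ
  refine ⟨W * B * 4 ^ τ, by positivity, fun j g f hf ↦ ?_⟩
  obtain ⟨ψ, hψc, hψs, hψ1, hψK⟩ := hB j
  have hpc : ∀ x, Continuous (p x) := fun x ↦ (hp.contDiff_right x).continuous
  have key : ∀ β : ℝ, (∀ (M : ℝ) (a : Eu m → H₀ →L[ℂ] H₁) (v : Eu m), ApproxBound φ τ M a →
      ‖∫ x, inner ℂ (g x) (a x (SchwartzMap.compSubConstCLM ℂ v f x))‖ ≤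
        M * β * ‖g.toLp 2‖ * ‖f.toLp 2‖) →
      ‖∫ x, inner ℂ (g x) (OP p f x)‖ ≤
        W * (B * ((2 : ℝ) ^ j) ^ d) * β * ‖g.toLp 2‖ * ‖f.toLp 2‖ := fun β hβ ↦ by
    rw [hW]
    exact norm_integral_inner_OP_le hψc hψs hpc (by positivity) hψK g f
      (fun η hη ↦ hψ1 η (hf η hη)) hβ
  have hgen := key 1 fun M a v ha ↦ by
    have h2 := norm_integral_inner_le ha.norm_le g (SchwartzMap.compSubConstCLM ℂ v f)
    rwa [norm_toLp_compSubConst f v, ← mul_one M] at h2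
  -- The mollification scale is `ε = 4 · 2^{-L}`, with `L` to be the larger of the two indices; `3 ≤
  -- L` ensures `ε ≤ 1`.
  have hsep : ∀ L : ℕ, 3 ≤ L → (∀ ζ ξ, (𝓕 g : 𝓢(Eu m, H₁)) ζ ≠ 0 →
      (𝓕 f : 𝓢(Eu m, H₀)) ξ ≠ 0 → 1 ≤ 4 * ((2 : ℝ) ^ L)⁻¹ * ‖ζ - ξ‖) → _ := fun L hL3 hL ↦
    key ((4 * ((2 : ℝ) ^ L)⁻¹) ^ τ) fun M a v ha ↦ by
      have hε1 : 4 * ((2 : ℝ) ^ L)⁻¹ ≤ 1 := by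
        rw [← div_eq_mul_inv, div_le_one (by positivity)]
        calc (4 : ℝ) ≤ 2 ^ 3 := by norm_num
          _ ≤ _ := pow_le_pow_right₀ (by norm_num) hL3
      have h2 := norm_integral_inner_le_of_separated hφ0 ha g (SchwartzMap.compSubConstCLM ℂ v f)
        (by positivity) hε1 fun ζ ξ hζ hξ ↦ hL ζ ξ hζ (fourier_compSubConst_ne_zero hξ)
      rwa [norm_toLp_compSubConst f v] at h2
  clear key
  have hG0 : 0 ≤ ‖g.toLp 2‖ := norm_nonneg _
  have hF0 : 0 ≤ ‖f.toLp 2‖ := norm_nonneg _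
  generalize ‖g.toLp 2‖ = G at *
  generalize ‖f.toLp 2‖ = F at *
  generalize ‖∫ x, inner ℂ (g x) (OP p f x)‖ = I at *
  refine ⟨hgen.trans ?_, fun l hg ↦ ?_⟩
  · calc W * (B * ((2 : ℝ) ^ j) ^ d) * 1 * G * F
        = W * B * 1 * ((2 : ℝ) ^ j) ^ d * G * F := by ring
      _ ≤ W * B * 4 ^ τ * ((2 : ℝ) ^ j) ^ d * G * F := by gcongr
  by_cases hclose : |(l : ℝ) - j| ≤ 2
  · refine hgen.trans ?_
    -- Neighbouring shells have `|l - j| ≤ 2`, so the factor `4^τ = 2^{2τ}` in the constant makes up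
    -- for the missing decay.
    have h1 : (1 : ℝ) ≤ 4 ^ τ * 2 ^ (-(τ * |(l : ℝ) - j|)) := by
      have : (4 : ℝ) ^ τ = 2 ^ (2 * τ) := by
        rw [Real.rpow_mul (by norm_num)]; norm_num
      rw [this, ← Real.rpow_add (by norm_num)]
      refine Real.one_le_rpow (by norm_num) ?_
      nlinarith
    calc W * (B * ((2 : ℝ) ^ j) ^ d) * 1 * G * F
        ≤ W * (B * ((2 : ℝ) ^ j) ^ d) * (4 ^ τ * 2 ^ (-(τ * |(l : ℝ) - j|))) * G * F := by gcongr
      _ = W * B * 4 ^ τ * ((2 : ℝ) ^ j) ^ d * 2 ^ (-(τ * |(l : ℝ) - j|)) * G * F := by ring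
  · have hL : ∃ L : ℕ, 3 ≤ L ∧ |(l : ℝ) - j| ≤ L ∧ ∀ ζ ξ, (𝓕 g : 𝓢(Eu m, H₁)) ζ ≠ 0 →
        (𝓕 f : 𝓢(Eu m, H₀)) ξ ≠ 0 → 1 ≤ 4 * ((2 : ℝ) ^ L)⁻¹ * ‖ζ - ξ‖ := by
      have hj0 : (0 : ℝ) ≤ j := Nat.cast_nonneg _
      have hl0 : (0 : ℝ) ≤ l := Nat.cast_nonneg _
      rcases le_total j l with h | h
      · have h' : (j : ℝ) ≤ l := by exact_mod_cast h
        rw [abs_of_nonneg (by linarith)] at hclose ⊢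
        have h3 : j + 3 ≤ l := by
          have : (j : ℝ) + 2 < l := by linarith
          have : j + 2 < l := by exact_mod_cast this
          omega
        exact ⟨l, by omega, by linarith, fun ζ ξ hζ hξ ↦
          separated_of_mem_shell h3 (hg ζ hζ) (hf ξ hξ)⟩
      · have h' : (l : ℝ) ≤ j := by exact_mod_cast h
        rw [abs_of_nonpos (by linarith)] at hclose ⊢
        have h3 : l + 3 ≤ j := by
          have : (l : ℝ) + 2 < j := by linarith
          have : l + 2 < j := by exact_mod_cast this
          omega
        exact ⟨j, by omega, by linarith, fun ζ ξ hζ hξ ↦ by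
          rw [norm_sub_rev]; exact separated_of_mem_shell h3 (hf ξ hξ) (hg ζ hζ)⟩
    obtain ⟨L, hL3, hLabs, hLsep⟩ := hL
    have hετ : (4 * ((2 : ℝ) ^ L)⁻¹) ^ τ ≤ 4 ^ τ * 2 ^ (-(τ * |(l : ℝ) - j|)) := by
      rw [Real.mul_rpow (by norm_num) (by positivity), ← Real.rpow_natCast, ← Real.rpow_neg
        (by norm_num), ← Real.rpow_mul (by norm_num)]
      gcongr
      · norm_num
      · nlinarith
    refine (hsep L hL3 hLsep).trans ?_
    calc W * (B * ((2 : ℝ) ^ j) ^ d) * (4 * ((2 : ℝ) ^ L)⁻¹) ^ τ * G * F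
        ≤ W * (B * ((2 : ℝ) ^ j) ^ d) * (4 ^ τ * 2 ^ (-(τ * |(l : ℝ) - j|))) * G * F := by gcongr
      _ = W * B * 4 ^ τ * ((2 : ℝ) ^ j) ^ d * 2 ^ (-(τ * |(l : ℝ) - j|)) * G * F := by ring

end DyadicEstimate

/-! ### Fourier multipliers on Schwartz functions and square function bounds. -/

section Multiplier

variable {m : ℕ} {H : Type*} [NormedAddCommGroup H] [InnerProductSpace ℂ H]

theorem norm_toLp_sq (f : 𝓢(Eu m, H)) : ‖f.toLp 2‖ ^ 2 = ∫ x, ‖f x‖ ^ 2 := by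
  have h0 : 0 ≤ ∫ x, ‖f x‖ ^ 2 := integral_nonneg fun x ↦ by positivity
  rw [SchwartzMap.norm_toLp' (by norm_num) (by norm_num), ← Real.rpow_natCast, ← Real.rpow_mul]
  · simp
  · simpa using h0

theorem integrable_norm_sq (f : 𝓢(Eu m, H)) : Integrable fun x ↦ ‖f x‖ ^ 2 := by
  refine (integrable_norm_mul_norm f f).congr (Eventually.of_forall fun x ↦ ?_)
  simp only [sq]

theorem hasTemperateGrowth_cutoff_smul (c : ℝ) (hc : 0 < c) :
    (fun ξ : Eu m ↦ cutoff (c • ξ)).HasTemperateGrowth := by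
  have h1 : HasCompactSupport fun ξ : Eu m ↦ cutoff (c • ξ) := by
    refine hasCompactSupport_of_norm_le (r := 2 / c) fun ξ hξ ↦ ?_
    by_contra! h
    refine hξ (cutoff_eq_zero_of_two_le ?_)
    rw [norm_smul, Real.norm_of_nonneg hc.le]
    rw [div_lt_iff₀ hc] at h
    linarith
  exact (h1.toSchwartzMap (contDiff_cutoff.comp (contDiff_id.const_smul _))).hasTemperateGrowth

theorem hasTemperateGrowth_dyadicCutoff (j : ℕ) :
    (dyadicCutoff (m := m) j).HasTemperateGrowth := by
  cases j with
  | zero =>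
    have := hasTemperateGrowth_cutoff_smul (m := m) 1 one_pos
    simp only [one_smul] at this
    exact this
  | succ j =>
    exact (hasTemperateGrowth_cutoff_smul _ (by positivity)).sub
      (hasTemperateGrowth_cutoff_smul _ (by positivity))

/-- The smooth frequency localization to a dyadic shell. -/
def dyadicPiece (j : ℕ) (f : 𝓢(Eu m, H)) : 𝓢(Eu m, H) :=
  SchwartzMap.fourierMultiplierCLM H (dyadicCutoff j) f

/-- The smooth frequency localization to a ball. -/
def lowPass (n : ℕ) (f : 𝓢(Eu m, H)) : 𝓢(Eu m, H) :=
  SchwartzMap.fourierMultiplierCLM H (fun ξ ↦ cutoff (((2 : ℝ) ^ n)⁻¹ • ξ)) f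

/-- The Bessel potential `⟨D⟩^t` on Schwartz functions. -/
def bessel (t : ℝ) (f : 𝓢(Eu m, H)) : 𝓢(Eu m, H) :=
  SchwartzMap.fourierMultiplierCLM H (fun ξ ↦ (1 + ‖ξ‖ ^ 2) ^ (t / 2)) f

theorem lowPass_eq_sum (n : ℕ) (f : 𝓢(Eu m, H)) :
    lowPass n f = ∑ j ∈ Finset.range (n + 1), dyadicPiece j f := by
  have h : (fun ξ : Eu m ↦ cutoff (((2 : ℝ) ^ n)⁻¹ • ξ)) =
      fun ξ ↦ ∑ j ∈ Finset.range (n + 1), dyadicCutoff j ξ := by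
    ext ξ; rw [sum_dyadicCutoff]
  rw [lowPass, h, SchwartzMap.fourierMultiplierCLM_sum H fun j _ ↦ hasTemperateGrowth_dyadicCutoff j]
  simp [dyadicPiece]

variable [CompleteSpace H]

theorem fourier_fourierMultiplier_apply {σ : Eu m → ℝ} (hσ : σ.HasTemperateGrowth)
    (f : 𝓢(Eu m, H)) (ξ : Eu m) :
    (𝓕 (SchwartzMap.fourierMultiplierCLM H σ f) : 𝓢(Eu m, H)) ξ =
      σ ξ • (𝓕 f : 𝓢(Eu m, H)) ξ := by
  rw [SchwartzMap.fourierMultiplierCLM_apply, FourierTransform.fourier_fourierInv_eq,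
    SchwartzMap.smulLeftCLM_apply_apply hσ]

theorem norm_toLp_sq_eq_fourier (f : 𝓢(Eu m, H)) :
    ‖f.toLp 2‖ ^ 2 = ∫ ξ, ‖(𝓕 f : 𝓢(Eu m, H)) ξ‖ ^ 2 := by
  rw [← SchwartzMap.norm_fourier_toL2_eq, norm_toLp_sq]

theorem norm_toLp_fourierMultiplier_sq {σ : Eu m → ℝ} (hσ : σ.HasTemperateGrowth)
    (f : 𝓢(Eu m, H)) : ‖(SchwartzMap.fourierMultiplierCLM H σ f).toLp 2‖ ^ 2 =
      ∫ ξ, σ ξ ^ 2 * ‖(𝓕 f : 𝓢(Eu m, H)) ξ‖ ^ 2 := by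
  rw [norm_toLp_sq_eq_fourier]
  congr 1
  ext ξ
  rw [fourier_fourierMultiplier_apply hσ, norm_smul, mul_pow, Real.norm_eq_abs, sq_abs]

theorem integrable_fourierMultiplier_sq {σ : Eu m → ℝ} (hσ : σ.HasTemperateGrowth)
    (f : 𝓢(Eu m, H)) : Integrable fun ξ ↦ σ ξ ^ 2 * ‖(𝓕 f : 𝓢(Eu m, H)) ξ‖ ^ 2 := by
  refine (integrable_norm_sq (𝓕 (SchwartzMap.fourierMultiplierCLM H σ f) : 𝓢(Eu m, H))).congr
    (Eventually.of_forall fun ξ ↦ ?_)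
  simp only
  rw [fourier_fourierMultiplier_apply hσ, norm_smul, mul_pow, Real.norm_eq_abs, sq_abs]

theorem mem_shell_of_fourier_dyadicPiece_ne_zero {j : ℕ} {f : 𝓢(Eu m, H)} {ξ : Eu m}
    (h : (𝓕 (dyadicPiece j f) : 𝓢(Eu m, H)) ξ ≠ 0) : ξ ∈ shell m j := by
  rw [dyadicPiece, fourier_fourierMultiplier_apply (hasTemperateGrowth_dyadicCutoff j)] at h
  exact mem_shell_of_dyadicCutoff_ne_zero (left_ne_zero_of_smul h)

theorem dyadicCutoff_le_one (j : ℕ) (ξ : Eu m) : dyadicCutoff j ξ ≤ 1 := by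
  refine (Finset.single_le_sum (f := fun j ↦ dyadicCutoff j ξ)
    (fun i _ ↦ dyadicCutoff_nonneg i ξ) (Finset.self_mem_range_succ j)).trans ?_
  rw [sum_dyadicCutoff]
  exact cutoff_le_one _

/-- On the shell, `4^j` and `1 + ‖ξ‖²` agree up to the factor `5`. -/
theorem two_pow_rpow_le_of_mem_shell {j : ℕ} {ξ : Eu m} (h : ξ ∈ shell m j) (t : ℝ) :
    (((2 : ℝ) ^ j) ^ t) ^ 2 ≤ 5 ^ |t| * (1 + ‖ξ‖ ^ 2) ^ t := by
  have hpos : (1 : ℝ) ≤ 2 ^ j := one_le_pow₀ (by norm_num)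
  have h1 : (((2 : ℝ) ^ j) ^ t) ^ 2 = (((2 : ℝ) ^ j) ^ 2) ^ t := by
    rw [← Real.rpow_natCast, ← Real.rpow_natCast _ 2, ← Real.rpow_mul (by positivity),
      ← Real.rpow_mul (by positivity), mul_comm]
  rw [h1]
  refine rpow_le_rpow_abs_mul (by positivity) (by norm_num) ?_ ?_ le_rfl
  · have := h.1
    rw [pow_succ] at this
    nlinarith [norm_nonneg ξ]
  · rcases h.2 with rfl | h2
    · simp; nlinarith [sq_nonneg ‖ξ‖]
    · nlinarith

/-- By Plancherel this is a pointwise inequality for the multipliers: `2^{2jt}` is comparable to `(1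
+ ‖ξ‖²)^t` on the support of the `j`-th cutoff, the square of a cutoff is at most the cutoff, and
the cutoffs sum to at most `1`. -/
theorem sum_dyadicPiece_sq_le (t : ℝ) (n : ℕ) (f : 𝓢(Eu m, H)) :
    ∑ j ∈ Finset.range n, (((2 : ℝ) ^ j) ^ t * ‖(dyadicPiece j f).toLp 2‖) ^ 2 ≤
      5 ^ |t| * ‖(bessel t f).toLp 2‖ ^ 2 := by
  have hb : (fun ξ : Eu m ↦ (1 + ‖ξ‖ ^ 2) ^ (t / 2)).HasTemperateGrowth := by fun_prop
  have h1 : ∀ j, (((2 : ℝ) ^ j) ^ t * ‖(dyadicPiece j f).toLp 2‖) ^ 2 =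
      ∫ ξ, (((2 : ℝ) ^ j) ^ t) ^ 2 * (dyadicCutoff j ξ ^ 2 * ‖(𝓕 f : 𝓢(Eu m, H)) ξ‖ ^ 2) := by
    intro j
    rw [mul_pow, dyadicPiece, norm_toLp_fourierMultiplier_sq (hasTemperateGrowth_dyadicCutoff j),
      integral_const_mul]
  have hi : ∀ j, Integrable fun ξ ↦ (((2 : ℝ) ^ j) ^ t) ^ 2 *
      (dyadicCutoff j ξ ^ 2 * ‖(𝓕 f : 𝓢(Eu m, H)) ξ‖ ^ 2) := fun j ↦
    (integrable_fourierMultiplier_sq (hasTemperateGrowth_dyadicCutoff j) f).const_mul _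
  simp_rw [h1]
  rw [← integral_finsetSum _ fun j _ ↦ hi j, bessel, norm_toLp_fourierMultiplier_sq hb,
    ← integral_const_mul]
  refine integral_mono (integrable_finsetSum _ fun j _ ↦ hi j)
    ((integrable_fourierMultiplier_sq hb f).const_mul _) fun ξ ↦ ?_
  have h2 : ((1 + ‖ξ‖ ^ 2) ^ (t / 2)) ^ 2 = (1 + ‖ξ‖ ^ 2) ^ t := by
    rw [← Real.rpow_natCast, ← Real.rpow_mul (by positivity)]
    congr 1
    push_cast
    ring
  simp only [h2]
  have h3 : ∀ j, (((2 : ℝ) ^ j) ^ t) ^ 2 * (dyadicCutoff j ξ ^ 2 * ‖(𝓕 f : 𝓢(Eu m, H)) ξ‖ ^ 2) ≤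
      dyadicCutoff j ξ * (5 ^ |t| * ((1 + ‖ξ‖ ^ 2) ^ t * ‖(𝓕 f : 𝓢(Eu m, H)) ξ‖ ^ 2)) := by
    intro j
    by_cases h0 : dyadicCutoff j ξ = 0
    · simp [h0]
    have h4 := two_pow_rpow_le_of_mem_shell (mem_shell_of_dyadicCutoff_ne_zero h0) t
    have h5 := dyadicCutoff_nonneg j ξ
    have h6 : dyadicCutoff j ξ ^ 2 ≤ dyadicCutoff j ξ := by
      nlinarith [dyadicCutoff_le_one j ξ]
    calc (((2 : ℝ) ^ j) ^ t) ^ 2 * (dyadicCutoff j ξ ^ 2 * ‖(𝓕 f : 𝓢(Eu m, H)) ξ‖ ^ 2)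
        ≤ (5 ^ |t| * (1 + ‖ξ‖ ^ 2) ^ t) * (dyadicCutoff j ξ * ‖(𝓕 f : 𝓢(Eu m, H)) ξ‖ ^ 2) := by
          gcongr
      _ = _ := by ring
  refine (Finset.sum_le_sum fun j _ ↦ h3 j).trans ?_
  rw [← Finset.sum_mul]
  have h7 : ∑ j ∈ Finset.range n, dyadicCutoff j ξ ≤ 1 := by
    refine (Finset.sum_le_sum_of_subset_of_nonneg (Finset.range_subset_range.2 n.le_succ)
      fun i _ _ ↦ dyadicCutoff_nonneg i ξ).trans ?_
    rw [sum_dyadicCutoff]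
    exact cutoff_le_one _
  refine (mul_le_mul_of_nonneg_right h7 (by positivity)).trans (le_of_eq (one_mul _))

theorem tendsto_integral_one_sub_cutoff {w : Eu m → ℝ} (hw : Integrable w) :
    Tendsto (fun n : ℕ ↦ ∫ ξ, (1 - cutoff (((2 : ℝ) ^ n)⁻¹ • ξ)) * w ξ) atTop (𝓝 0) := by
  rw [← integral_zero (Eu m) ℝ]
  refine tendsto_integral_of_dominated_convergence (fun ξ ↦ ‖w ξ‖) (fun n ↦ ?_) hw.norm
    (fun n ↦ Eventually.of_forall fun ξ ↦ ?_) (Eventually.of_forall fun ξ ↦ ?_)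
  · refine AEStronglyMeasurable.mul ?_ hw.1
    exact (continuous_const.sub ((contDiff_cutoff (n := 0)).continuous.comp
      (by fun_prop))).aestronglyMeasurable
  · rw [norm_mul, Real.norm_of_nonneg (sub_nonneg.2 (cutoff_le_one _))]
    have := cutoff_nonneg (((2 : ℝ) ^ n)⁻¹ • ξ)
    nlinarith [norm_nonneg (w ξ)]
  · obtain ⟨k, hk⟩ := pow_unbounded_of_one_lt ‖ξ‖ (by norm_num : (1 : ℝ) < 2)
    refine tendsto_const_nhds.congr' ?_
    filter_upwards [eventually_ge_atTop k] with n hn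
    rw [cutoff_eq_one, sub_self, zero_mul]
    rw [norm_inv_two_pow_smul, div_le_one (by positivity)]
    exact hk.le.trans (pow_le_pow_right₀ (by norm_num) hn)

theorem fourier_sub_lowPass (n : ℕ) (f : 𝓢(Eu m, H)) (ξ : Eu m) :
    (𝓕 (f - lowPass n f) : 𝓢(Eu m, H)) ξ =
      (1 - cutoff (((2 : ℝ) ^ n)⁻¹ • ξ)) • (𝓕 f : 𝓢(Eu m, H)) ξ := by
  have h : (𝓕 (f - lowPass n f) : 𝓢(Eu m, H)) = 𝓕 f - 𝓕 (lowPass n f) :=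
    (FourierTransform.fourierCLM ℂ 𝓢(Eu m, H)).map_sub _ _
  rw [h, sub_apply, lowPass, fourier_fourierMultiplier_apply
    (hasTemperateGrowth_cutoff_smul _ (by positivity)), sub_smul, one_smul]

theorem tendsto_norm_toLp_sub_lowPass (f : 𝓢(Eu m, H)) :
    Tendsto (fun n ↦ ‖(f - lowPass n f).toLp 2‖) atTop (𝓝 0) := by
  have h1 := tendsto_integral_one_sub_cutoff (integrable_norm_sq (𝓕 f : 𝓢(Eu m, H)))
  have h2 : ∀ n, ‖(f - lowPass n f).toLp 2‖ ^ 2 ≤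
      ∫ ξ, (1 - cutoff (((2 : ℝ) ^ n)⁻¹ • ξ)) * ‖(𝓕 f : 𝓢(Eu m, H)) ξ‖ ^ 2 := by
    intro n
    rw [norm_toLp_sq_eq_fourier]
    refine integral_mono_of_nonneg (Eventually.of_forall fun ξ ↦ by positivity) ?_
      (Eventually.of_forall fun ξ ↦ ?_)
    · refine (integrable_norm_sq (𝓕 f : 𝓢(Eu m, H))).mono' ?_ (Eventually.of_forall fun ξ ↦ ?_)
      · exact ((continuous_const.sub ((contDiff_cutoff (n := 0)).continuous.comp
          (by fun_prop))).mul (by fun_prop)).aestronglyMeasurable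
      · rw [norm_mul, Real.norm_of_nonneg (sub_nonneg.2 (cutoff_le_one _)), norm_pow, norm_norm]
        have := cutoff_nonneg (((2 : ℝ) ^ n)⁻¹ • ξ)
        nlinarith [sq_nonneg ‖(𝓕 f : 𝓢(Eu m, H)) ξ‖]
    · have h3 := cutoff_nonneg (((2 : ℝ) ^ n)⁻¹ • ξ)
      have h4 := cutoff_le_one (((2 : ℝ) ^ n)⁻¹ • ξ)
      simp only [fourier_sub_lowPass, norm_smul, mul_pow,
        Real.norm_of_nonneg (sub_nonneg.2 h4)]
      gcongr
      nlinarith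
  have h3 := squeeze_zero (fun n ↦ by positivity) h2 h1
  have h4 := h3.sqrt
  simpa [Real.sqrt_sq] using h4

end Multiplier

/-! ### Schur's test. -/

section Schur

/-- Schur's test for the kernel `2^{-σ|l-j|}`. -/
theorem exists_sum_geometric_le {σ : ℝ} (hσ : 0 < σ) : ∃ C : ℝ, 0 ≤ C ∧
    ∀ (n k : ℕ) (a b : ℕ → ℝ), ∑ j ∈ Finset.range n, ∑ l ∈ Finset.range k,
      (2 : ℝ) ^ (-(σ * |(l : ℝ) - j|)) * a j * b l ≤
        C * √(∑ j ∈ Finset.range n, a j ^ 2) * √(∑ l ∈ Finset.range k, b l ^ 2) := by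
  let κ : ℤ → ℝ := fun i ↦ 2 ^ (-(σ * |(i : ℝ)|))
  have hκ0 : ∀ i, 0 ≤ κ i := fun i ↦ by positivity
  have hκs : Summable κ := by
    have h1 : Summable fun i : ℕ ↦ ((2 : ℝ) ^ (-σ)) ^ i :=
      summable_geometric_of_lt_one (by positivity)
        (Real.rpow_lt_one_of_one_lt_of_neg (by norm_num) (by linarith))
    refine Summable.of_nat_of_neg (h1.congr fun i ↦ ?_) (h1.congr fun i ↦ ?_)
    · simp only [κ]
      rw [← Real.rpow_natCast, ← Real.rpow_mul (by norm_num)]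
      simp
    · simp only [κ]
      rw [← Real.rpow_natCast, ← Real.rpow_mul (by norm_num)]
      simp
  have hrow : ∀ (c : ℤ) (n : ℕ), ∑ l ∈ Finset.range n, κ (l - c) ≤ ∑' i, κ i := by
    intro c n
    let e : ℕ ↪ ℤ := ⟨fun l ↦ l - c, fun x y h ↦ by simpa using h⟩
    have : ∑ l ∈ Finset.range n, κ (l - c) = ∑ i ∈ (Finset.range n).map e, κ i := by
      rw [Finset.sum_map]; rfl
    rw [this]
    exact hκs.sum_le_tsum _ fun i _ ↦ hκ0 i
  have hκsymm : ∀ i, κ (-i) = κ i := fun i ↦ by simp [κ]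
  set C := ∑' i, κ i
  have hC0 : 0 ≤ C := tsum_nonneg hκ0
  refine ⟨C, hC0, fun n k a b ↦ ?_⟩
  have h1 : ∀ j l : ℕ, (2 : ℝ) ^ (-(σ * |(l : ℝ) - j|)) = κ (l - j) := fun j l ↦ by simp [κ]
  simp_rw [h1]
  rw [← Finset.sum_product' (f := fun (j l : ℕ) ↦ κ ((l : ℤ) - (j : ℤ)) * a j * b l)]
  -- Split the kernel as `√κ · √κ` and apply Cauchy–Schwarz over all pairs; each resulting double
  -- sum is controlled by the row or column sums of `κ`, both at most `C`.
  have h2 := Finset.sum_mul_sq_le_sq_mul_sq (Finset.range n ×ˢ Finset.range k)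
    (fun z : ℕ × ℕ ↦ √(κ ((z.2 : ℤ) - (z.1 : ℤ))) * a z.1) (fun z : ℕ × ℕ ↦ √(κ ((z.2 : ℤ) - (z.1 : ℤ))) * b z.2)
  have h3 : ∀ z : ℕ × ℕ, √(κ ((z.2 : ℤ) - (z.1 : ℤ))) * a z.1 * (√(κ ((z.2 : ℤ) - (z.1 : ℤ))) * b z.2) =
      κ ((z.2 : ℤ) - (z.1 : ℤ)) * a z.1 * b z.2 := fun z ↦ by
    rw [mul_mul_mul_comm, Real.mul_self_sqrt (hκ0 _), mul_assoc]
  have h4 : ∀ (z : ℕ × ℕ) (x : ℝ), (√(κ ((z.2 : ℤ) - (z.1 : ℤ))) * x) ^ 2 = κ ((z.2 : ℤ) - (z.1 : ℤ)) * x ^ 2 :=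
    fun z x ↦ by rw [mul_pow, Real.sq_sqrt (hκ0 _)]
  simp_rw [h3, h4] at h2
  have h5 : ∑ z ∈ Finset.range n ×ˢ Finset.range k, κ ((z.2 : ℤ) - (z.1 : ℤ)) * a z.1 ^ 2 ≤
      C * ∑ j ∈ Finset.range n, a j ^ 2 := by
    rw [Finset.sum_product' (f := fun (j l : ℕ) ↦ κ ((l : ℤ) - (j : ℤ)) * a j ^ 2), Finset.mul_sum]
    refine Finset.sum_le_sum fun j _ ↦ ?_
    rw [← Finset.sum_mul]
    gcongr
    exact hrow j k
  have h6 : ∑ z ∈ Finset.range n ×ˢ Finset.range k, κ ((z.2 : ℤ) - (z.1 : ℤ)) * b z.2 ^ 2 ≤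
      C * ∑ l ∈ Finset.range k, b l ^ 2 := by
    rw [Finset.sum_product_right' (f := fun (j l : ℕ) ↦ κ ((l : ℤ) - (j : ℤ)) * b l ^ 2),
      Finset.mul_sum]
    refine Finset.sum_le_sum fun l _ ↦ ?_
    rw [← Finset.sum_mul]
    gcongr
    refine le_trans (le_of_eq (Finset.sum_congr rfl fun j _ ↦ ?_)) (hrow l n)
    rw [← hκsymm, neg_sub]
  have hA : 0 ≤ ∑ j ∈ Finset.range n, a j ^ 2 := Finset.sum_nonneg fun _ _ ↦ sq_nonneg _
  have hB : 0 ≤ ∑ l ∈ Finset.range k, b l ^ 2 := Finset.sum_nonneg fun _ _ ↦ sq_nonneg _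
  refine abs_le_of_sq_le_sq' ?_ (by positivity) |>.2
  refine h2.trans ?_
  rw [mul_pow, mul_pow, Real.sq_sqrt hA, Real.sq_sqrt hB]
  calc _ ≤ (C * ∑ j ∈ Finset.range n, a j ^ 2) * (C * ∑ l ∈ Finset.range k, b l ^ 2) := by
        gcongr
    _ = _ := by ring

end Schur


/-! ### The form estimate for `OP(p)`. -/

section OperatorBound

variable {m N : ℕ} {τ d : ℝ} {H₀ H₁ : Type*} [NormedAddCommGroup H₀] [InnerProductSpace ℂ H₀]
  [NormedAddCommGroup H₁] [InnerProductSpace ℂ H₁]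
  {p : Eu m → Eu m → H₀ →L[ℂ] H₁}

theorem IsSymbol.continuous_right (hp : IsSymbol τ d N p) (x : Eu m) : Continuous (p x) :=
  (hp.contDiff_right x).continuous

theorem continuous_OP_integrand (hp : ∀ x, Continuous (p x)) (f : 𝓢(Eu m, H₀)) (x : Eu m) :
    Continuous fun η ↦ Complex.exp ((2 * Real.pi * inner ℝ x η : ℝ) * Complex.I) •
      p x ((2 * Real.pi) • η) ((𝓕 f : 𝓢(Eu m, H₀)) η) := by
  have h1 : Continuous fun η : Eu m ↦ p x ((2 * Real.pi) • η) := (hp x).comp (by fun_prop)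
  have h2 : Continuous (𝓕 f : 𝓢(Eu m, H₀)) := SchwartzMap.continuous _
  exact Continuous.smul (by fun_prop) (h1.clm_apply h2)

theorem norm_OP_integrand_le {C : ℝ}
    (hC : ∀ x η, ‖p x ((2 * Real.pi) • η)‖ ≤ C * (1 + ‖η‖ ^ 2) ^ (d / 2)) (f : 𝓢(Eu m, H₀))
    (x η : Eu m) : ‖Complex.exp ((2 * Real.pi * inner ℝ x η : ℝ) * Complex.I) •
      p x ((2 * Real.pi) • η) ((𝓕 f : 𝓢(Eu m, H₀)) η)‖ ≤
        C * ((1 + ‖η‖ ^ 2) ^ (d / 2) * ‖(𝓕 f : 𝓢(Eu m, H₀)) η‖) := by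
  rw [norm_smul, Complex.norm_exp_ofReal_mul_I, one_mul, ← mul_assoc]
  exact (p x _).le_of_opNorm_le (hC x η) _

theorem OP_smul (c : ℂ) (f : 𝓢(Eu m, H₀)) (x : Eu m) : OP p (c • f) x = c • OP p f x := by
  rw [OP_eq_integral, OP_eq_integral, ← integral_smul]
  have h : (𝓕 (c • f) : 𝓢(Eu m, H₀)) = c • 𝓕 f :=
    (FourierTransform.fourierCLM ℂ 𝓢(Eu m, H₀)).map_smul _ _
  simp only [h, smul_apply, map_smul]
  congr 1
  ext η
  rw [smul_comm]

variable [CompleteSpace H₁]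

theorem IsSymbol.continuous_left (hp : IsSymbol τ d N p) (hτ : 0 ≤ τ) (hm : 1 ≤ m) (ξ : Eu m) :
    Continuous fun x ↦ p x ξ := by
  obtain ⟨φ, hφ1, -⟩ := exists_fourier_eq_cutoff m
  obtain ⟨C, -, hC⟩ := hp.exists_approxBound hτ hφ1
  exact (hC ⟨0, hm⟩ 0 (Nat.zero_le _) ξ).continuous

theorem IsSymbol.exists_norm_le (hp : IsSymbol τ d N p) (hτ : 0 ≤ τ) (hm : 1 ≤ m) :
    ∃ C : ℝ, 0 ≤ C ∧ ∀ x η, ‖p x ((2 * Real.pi) • η)‖ ≤ C * (1 + ‖η‖ ^ 2) ^ (d / 2) := by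
  obtain ⟨φ, hφ1, -⟩ := exists_fourier_eq_cutoff m
  obtain ⟨C, hC0, hC⟩ := hp.exists_approxBound hτ hφ1
  refine ⟨C * 40 ^ |d / 2|, by positivity, fun x η ↦ ?_⟩
  refine ((hC ⟨0, hm⟩ 0 (Nat.zero_le _) ((2 * Real.pi) • η)).norm_le x).trans ?_
  have h1 : (1 + ‖(2 * Real.pi) • η‖ ^ 2) ^ (d / 2) ≤ 40 ^ |d / 2| * (1 + ‖η‖ ^ 2) ^ (d / 2) := by
    have hpi := Real.pi_gt_three
    have hpi' := Real.pi_lt_d2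
    have hs := sq_nonneg ‖η‖
    have hpp : 1 ≤ (2 * Real.pi) ^ 2 := by nlinarith
    have hpp' : (2 * Real.pi) ^ 2 ≤ 40 := by nlinarith
    refine rpow_le_rpow_abs_mul (by positivity) (by norm_num) ?_ ?_ le_rfl
    · rw [norm_smul, mul_pow, Real.norm_of_nonneg (by positivity)]
      nlinarith
    · rw [norm_smul, mul_pow, Real.norm_of_nonneg (by positivity)]
      nlinarith
  simp only [Nat.cast_zero, sub_zero]
  calc C * (1 + ‖(2 * Real.pi) • η‖ ^ 2) ^ (d / 2)
      ≤ C * (40 ^ |d / 2| * (1 + ‖η‖ ^ 2) ^ (d / 2)) := by gcongr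
    _ = _ := by ring

variable [CompleteSpace H₀]

theorem integrable_weight_mul_fourier (d : ℝ) (f : 𝓢(Eu m, H₀)) :
    Integrable fun η ↦ (1 + ‖η‖ ^ 2) ^ (d / 2) * ‖(𝓕 f : 𝓢(Eu m, H₀)) η‖ := by
  have hb : (fun ξ : Eu m ↦ (1 + ‖ξ‖ ^ 2) ^ (d / 2)).HasTemperateGrowth := by fun_prop
  refine ((𝓕 (bessel d f) : 𝓢(Eu m, H₀)).integrable
    (μ := (volume : Measure (Eu m)))).norm.congr (Eventually.of_forall fun η ↦ ?_)
  simp only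
  rw [bessel, fourier_fourierMultiplier_apply hb, norm_smul, Real.norm_of_nonneg (by positivity)]

theorem IsSymbol.integrable_OP (hp : IsSymbol τ d N p) (hτ : 0 ≤ τ) (hm : 1 ≤ m)
    (f : 𝓢(Eu m, H₀)) (x : Eu m) :
    Integrable fun η ↦ Complex.exp ((2 * Real.pi * inner ℝ x η : ℝ) * Complex.I) •
      p x ((2 * Real.pi) • η) ((𝓕 f : 𝓢(Eu m, H₀)) η) := by
  obtain ⟨C, hC0, hC⟩ := hp.exists_norm_le hτ hm
  exact ((integrable_weight_mul_fourier d f).const_mul C).mono'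
    (continuous_OP_integrand hp.continuous_right f x).aestronglyMeasurable
    (Eventually.of_forall (norm_OP_integrand_le hC f x))

theorem IsSymbol.exists_norm_OP_le (hp : IsSymbol τ d N p) (hτ : 0 ≤ τ) (hm : 1 ≤ m) :
    ∃ C : ℝ, 0 ≤ C ∧ ∀ (f : 𝓢(Eu m, H₀)) (x : Eu m), ‖OP p f x‖ ≤
      C * ∫ η, (1 + ‖η‖ ^ 2) ^ (d / 2) * ‖(𝓕 f : 𝓢(Eu m, H₀)) η‖ := by
  obtain ⟨C, hC0, hC⟩ := hp.exists_norm_le hτ hm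
  refine ⟨C, hC0, fun f x ↦ ?_⟩
  rw [OP_eq_integral, ← integral_const_mul]
  exact norm_integral_le_of_norm_le ((integrable_weight_mul_fourier d f).const_mul C)
    (Eventually.of_forall (norm_OP_integrand_le hC f x))

theorem IsSymbol.continuous_OP (hp : IsSymbol τ d N p) (hτ : 0 ≤ τ) (hm : 1 ≤ m)
    (f : 𝓢(Eu m, H₀)) : Continuous (OP p f) := by
  obtain ⟨C, hC0, hC⟩ := hp.exists_norm_le hτ hm
  have h : OP p f = fun x ↦ ∫ η, Complex.exp ((2 * Real.pi * inner ℝ x η : ℝ) * Complex.I) •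
      p x ((2 * Real.pi) • η) ((𝓕 f : 𝓢(Eu m, H₀)) η) := funext fun x ↦ OP_eq_integral p f x
  rw [h]
  refine continuous_of_dominated
    (fun x ↦ (continuous_OP_integrand hp.continuous_right f x).aestronglyMeasurable)
    (fun x ↦ Eventually.of_forall (norm_OP_integrand_le hC f x))
    ((integrable_weight_mul_fourier d f).const_mul C) (Eventually.of_forall fun η ↦ ?_)
  have h1 := hp.continuous_left hτ hm ((2 * Real.pi) • η)
  exact Continuous.smul (by fun_prop) (h1.clm_apply continuous_const)

theorem IsSymbol.OP_add (hp : IsSymbol τ d N p) (hτ : 0 ≤ τ) (hm : 1 ≤ m)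
    (f g : 𝓢(Eu m, H₀)) (x : Eu m) : OP p (f + g) x = OP p f x + OP p g x := by
  rw [OP_eq_integral, OP_eq_integral, OP_eq_integral,
    ← integral_add (hp.integrable_OP hτ hm f x) (hp.integrable_OP hτ hm g x)]
  have h : (𝓕 (f + g) : 𝓢(Eu m, H₀)) = 𝓕 f + 𝓕 g :=
    (FourierTransform.fourierCLM ℂ 𝓢(Eu m, H₀)).map_add _ _
  simp only [h, add_apply, map_add, smul_add]

theorem IsSymbol.OP_sum (hp : IsSymbol τ d N p) (hτ : 0 ≤ τ) (hm : 1 ≤ m) {ι : Type*}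
    (s : Finset ι) (f : ι → 𝓢(Eu m, H₀)) (x : Eu m) :
    OP p (∑ i ∈ s, f i) x = ∑ i ∈ s, OP p (f i) x := by
  let L : 𝓢(Eu m, H₀) →+ H₁ := AddMonoidHom.mk' (fun f ↦ OP p f x)
    fun f g ↦ hp.OP_add hτ hm f g x
  exact map_sum L f s

theorem IsSymbol.integrable_inner_OP (hp : IsSymbol τ d N p) (hτ : 0 ≤ τ) (hm : 1 ≤ m)
    (g : 𝓢(Eu m, H₁)) (f : 𝓢(Eu m, H₀)) : Integrable fun x ↦ inner ℂ (g x) (OP p f x) := by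
  obtain ⟨C, hC0, hC⟩ := hp.exists_norm_OP_le hτ hm
  refine ((g.integrable (μ := (volume : Measure (Eu m)))).norm.mul_const
    (C * ∫ η, (1 + ‖η‖ ^ 2) ^ (d / 2) * ‖(𝓕 f : 𝓢(Eu m, H₀)) η‖)).mono' ?_
    (Eventually.of_forall fun x ↦ ?_)
  · have := hp.continuous_OP hτ hm f
    exact (g.continuous.inner this).aestronglyMeasurable
  · refine (norm_inner_le_norm _ _).trans ?_
    gcongr
    exact hC f x

theorem IsSymbol.integral_inner_OP_sum (hp : IsSymbol τ d N p) (hτ : 0 ≤ τ) (hm : 1 ≤ m)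
    {ι κ : Type*} (s : Finset ι) (t : Finset κ) (g : κ → 𝓢(Eu m, H₁)) (f : ι → 𝓢(Eu m, H₀)) :
    ∫ x, inner ℂ ((∑ l ∈ t, g l) x) (OP p (∑ j ∈ s, f j) x) =
      ∑ j ∈ s, ∑ l ∈ t, ∫ x, inner ℂ (g l x) (OP p (f j) x) := by
  simp_rw [← integral_finsetSum _ fun l _ ↦ hp.integrable_inner_OP hτ hm (g l) _]
  rw [← integral_finsetSum _ fun j _ ↦
    integrable_finsetSum _ fun l _ ↦ hp.integrable_inner_OP hτ hm (g l) (f j)]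
  simp only [hp.OP_sum hτ hm, sum_apply, sum_inner, inner_sum]

/-- `OP(p)` is bounded from the weighted `L₁`-norm of the Fourier transform to the supremum norm; in
the weighted norm the low pass filters converge by dominated convergence. -/
theorem IsSymbol.tendsto_integral_inner_OP_lowPass (hp : IsSymbol τ d N p) (hτ : 0 ≤ τ)
    (hm : 1 ≤ m) (g : 𝓢(Eu m, H₁)) (f : 𝓢(Eu m, H₀)) :
    Tendsto (fun n ↦ ∫ x, inner ℂ (g x) (OP p (lowPass n f) x)) atTop
      (𝓝 (∫ x, inner ℂ (g x) (OP p f x))) := by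
  obtain ⟨C, hC0, hC⟩ := hp.exists_norm_OP_le (H₀ := H₀) hτ hm
  have h1 := tendsto_integral_one_sub_cutoff (integrable_weight_mul_fourier d f)
  have h2 : ∀ n, ‖(∫ x, inner ℂ (g x) (OP p (lowPass n f) x)) - ∫ x, inner ℂ (g x) (OP p f x)‖ ≤
      (∫ x, ‖g x‖) * (C * ∫ ξ, (1 - cutoff (((2 : ℝ) ^ n)⁻¹ • ξ)) *
        ((1 + ‖ξ‖ ^ 2) ^ (d / 2) * ‖(𝓕 f : 𝓢(Eu m, H₀)) ξ‖)) := by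
    intro n
    have h3 : ∀ x, inner ℂ (g x) (OP p f x) - inner ℂ (g x) (OP p (lowPass n f) x) =
        inner ℂ (g x) (OP p (f - lowPass n f) x) := by
      intro x
      have := hp.OP_add hτ hm (f - lowPass n f) (lowPass n f) x
      rw [sub_add_cancel] at this
      rw [this, inner_add_right, add_sub_cancel_right]
    rw [norm_sub_rev, ← integral_sub (hp.integrable_inner_OP hτ hm g f)
      (hp.integrable_inner_OP hτ hm g _), ← integral_mul_const]
    refine norm_integral_le_of_norm_le
      ((g.integrable (μ := (volume : Measure (Eu m)))).norm.mul_const _)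
      (Eventually.of_forall fun x ↦ ?_)
    rw [h3]
    refine (norm_inner_le_norm _ _).trans ?_
    gcongr
    refine (hC _ x).trans (le_of_eq ?_)
    congr 2
    ext ξ
    rw [fourier_sub_lowPass, norm_smul, Real.norm_of_nonneg (sub_nonneg.2 (cutoff_le_one _))]
    ring
  refine tendsto_iff_norm_sub_tendsto_zero.2 (squeeze_zero (fun _ ↦ norm_nonneg _) h2 ?_)
  simpa using (h1.const_mul C).const_mul (∫ x, ‖g x‖)

/-- The low pass filters of `g` are known to converge in `L₂`, whereas `OP(p)f` is a priori only
bounded. Hence the assumption that pairing with `OP(p)f` is continuous in the `L₂`-norm. -/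
theorem IsSymbol.tendsto_integral_inner_lowPass_OP (hp : IsSymbol τ d N p) (hτ : 0 ≤ τ)
    (hm : 1 ≤ m) {f : 𝓢(Eu m, H₀)} {C : ℝ}
    (hC : ∀ g : 𝓢(Eu m, H₁), ‖∫ x, inner ℂ (g x) (OP p f x)‖ ≤ C * ‖g.toLp 2‖)
    (g : 𝓢(Eu m, H₁)) :
    Tendsto (fun n ↦ ∫ x, inner ℂ (lowPass n g x) (OP p f x)) atTop
      (𝓝 (∫ x, inner ℂ (g x) (OP p f x))) := by
  have h2 : ∀ n, ‖(∫ x, inner ℂ (lowPass n g x) (OP p f x)) - ∫ x, inner ℂ (g x) (OP p f x)‖ ≤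
      C * ‖(g - lowPass n g).toLp 2‖ := by
    intro n
    refine le_trans (le_of_eq ?_) (hC (g - lowPass n g))
    rw [norm_sub_rev, ← integral_sub (hp.integrable_inner_OP hτ hm g f)
      (hp.integrable_inner_OP hτ hm _ f)]
    simp only [sub_apply, inner_sub_left]
  refine tendsto_iff_norm_sub_tendsto_zero.2 (squeeze_zero (fun _ ↦ norm_nonneg _) h2 ?_)
  simpa using (tendsto_norm_toLp_sub_lowPass g).const_mul C

/-- The main estimate: `OP p` is bounded from `H^{s+d}` to `H^s` in the sense of forms. -/
theorem IsSymbol.exists_norm_integral_inner_OP_le (hp : IsSymbol τ d N p) (hm : 1 ≤ m)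
    (hN : m + 1 ≤ N) {s : ℝ} (hs : |s| < τ) :
    ∃ C : ℝ, 0 ≤ C ∧ ∀ (g : 𝓢(Eu m, H₁)) (f : 𝓢(Eu m, H₀)),
      ‖∫ x, inner ℂ (g x) (OP p f x)‖ ≤
        C * ‖(bessel (-s) g).toLp 2‖ * ‖(bessel (s + d) f).toLp 2‖ := by
  have hτ : 0 ≤ τ := (abs_nonneg s).trans hs.le
  obtain ⟨C, hC0, hC⟩ := hp.exists_dyadic_estimate hτ hm hN
  obtain ⟨K, hK0, hK⟩ := exists_sum_geometric_le (sub_pos.2 hs)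
  refine ⟨C * K * √(5 ^ |s + d|) * √(5 ^ |-s|), by positivity, fun g f ↦ ?_⟩
  have key : ∀ n k, ‖∫ x, inner ℂ (lowPass n g x) (OP p (lowPass k f) x)‖ ≤
      C * K * √(5 ^ |s + d|) * √(5 ^ |-s|) * ‖(bessel (-s) g).toLp 2‖ *
        ‖(bessel (s + d) f).toLp 2‖ := by
    intro n k
    rw [lowPass_eq_sum, lowPass_eq_sum, hp.integral_inner_OP_sum hτ hm]
    have h1 : ∀ j l : ℕ, ‖∫ x, inner ℂ (dyadicPiece l g x) (OP p (dyadicPiece j f) x)‖ ≤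
        C * ((2 : ℝ) ^ (-((τ - |s|) * |(l : ℝ) - j|)) *
          (((2 : ℝ) ^ j) ^ (s + d) * ‖(dyadicPiece j f).toLp 2‖) *
          (((2 : ℝ) ^ l) ^ (-s) * ‖(dyadicPiece l g).toLp 2‖)) := by
      intro j l
      refine ((hC j (dyadicPiece l g) (dyadicPiece j f)
        (fun ξ ↦ mem_shell_of_fourier_dyadicPiece_ne_zero)).2 l
        (fun ξ ↦ mem_shell_of_fourier_dyadicPiece_ne_zero)).trans ?_
      have hG := norm_nonneg ((dyadicPiece l g).toLp 2)
      have hF := norm_nonneg ((dyadicPiece j f).toLp 2)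
      generalize ‖(dyadicPiece l g).toLp 2‖ = G at *
      generalize ‖(dyadicPiece j f).toLp 2‖ = F at *
      -- Write `2^{jd} = 2^{j(s+d)} 2^{-ls} 2^{s(l-j)}`; the last factor is at most `2^{|s||l-j|}`
      -- and uses up part of the decay of rate `τ`.
      have h2 : ((2 : ℝ) ^ j) ^ d * 2 ^ (-(τ * |(l : ℝ) - j|)) ≤
          (2 : ℝ) ^ (-((τ - |s|) * |(l : ℝ) - j|)) * ((2 : ℝ) ^ j) ^ (s + d) *
            ((2 : ℝ) ^ l) ^ (-s) := by
        simp only [← Real.rpow_natCast, ← Real.rpow_mul (zero_le_two (α := ℝ)),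
          ← Real.rpow_add (zero_lt_two' ℝ)]
        refine Real.rpow_le_rpow_of_exponent_le (by norm_num) ?_
        have h3 : s * ((l : ℝ) - j) ≤ |s| * |(l : ℝ) - j| := by
          rw [← abs_mul]; exact le_abs_self _
        nlinarith
      calc C * ((2 : ℝ) ^ j) ^ d * 2 ^ (-(τ * |(l : ℝ) - j|)) * G * F
          = C * (((2 : ℝ) ^ j) ^ d * 2 ^ (-(τ * |(l : ℝ) - j|))) * G * F := by ring
        _ ≤ C * ((2 : ℝ) ^ (-((τ - |s|) * |(l : ℝ) - j|)) * ((2 : ℝ) ^ j) ^ (s + d) *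
            ((2 : ℝ) ^ l) ^ (-s)) * G * F := by gcongr
        _ = _ := by ring
    refine (norm_sum_le _ _).trans ((Finset.sum_le_sum fun j _ ↦ (norm_sum_le _ _).trans
      (Finset.sum_le_sum fun l _ ↦ h1 j l)).trans ?_)
    simp_rw [← Finset.mul_sum]
    have h4 := hK (k + 1) (n + 1)
      (fun j ↦ ((2 : ℝ) ^ j) ^ (s + d) * ‖(dyadicPiece j f).toLp 2‖)
      (fun l ↦ ((2 : ℝ) ^ l) ^ (-s) * ‖(dyadicPiece l g).toLp 2‖)
    have h5 := Real.sqrt_le_sqrt (sum_dyadicPiece_sq_le (s + d) (k + 1) f)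
    have h6 := Real.sqrt_le_sqrt (sum_dyadicPiece_sq_le (-s) (n + 1) g)
    rw [Real.sqrt_mul (by positivity), Real.sqrt_sq (norm_nonneg _)] at h5 h6
    refine (mul_le_mul_of_nonneg_left h4 hC0).trans ?_
    grw [h5, h6]
    exact le_of_eq (by ring)
  -- The low pass filter is removed from `g` first: with `f` cut off to finitely many shells, the
  -- first dyadic bound provides the required continuity. Its constant may grow with `k`, as it is
  -- used only for convergence.
  have h7 : ∀ k, ‖∫ x, inner ℂ (g x) (OP p (lowPass k f) x)‖ ≤
      C * K * √(5 ^ |s + d|) * √(5 ^ |-s|) * ‖(bessel (-s) g).toLp 2‖ *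
        ‖(bessel (s + d) f).toLp 2‖ := by
    intro k
    refine le_of_tendsto (hp.tendsto_integral_inner_lowPass_OP hτ hm
      (C := ∑ j ∈ Finset.range (k + 1), C * ((2 : ℝ) ^ j) ^ d * ‖(dyadicPiece j f).toLp 2‖)
      (fun g ↦ ?_) g).norm (Eventually.of_forall fun n ↦ key n k)
    have h8 := hp.integral_inner_OP_sum hτ hm (Finset.range (k + 1)) {()} (fun _ ↦ g)
      (fun j ↦ dyadicPiece j f)
    simp only [Finset.sum_singleton] at h8
    rw [lowPass_eq_sum, h8, Finset.sum_mul]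
    refine (norm_sum_le _ _).trans (Finset.sum_le_sum fun j _ ↦ ?_)
    refine ((hC j g (dyadicPiece j f)
      (fun ξ ↦ mem_shell_of_fourier_dyadicPiece_ne_zero)).1).trans (le_of_eq ?_)
    generalize ‖g.toLp 2‖ = G
    generalize ‖(dyadicPiece j f).toLp 2‖ = F
    ring
  exact le_of_tendsto (hp.tendsto_integral_inner_OP_lowPass hτ hm g f).norm
    (Eventually.of_forall h7)

end OperatorBound


/-! ### Completeness, density and embeddings of Sobolev spaces. -/

section SobolevSpace

variable {m : ℕ} {F : Type*} [NormedAddCommGroup F] [InnerProductSpace ℂ F] [CompleteSpace F]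

theorem bessel_bessel (s t : ℝ) (f : 𝓢(Eu m, F)) : bessel s (bessel t f) = bessel (t + s) f := by
  rw [bessel, bessel, SchwartzMap.fourierMultiplierCLM_fourierMultiplierCLM_apply (by fun_prop)
    (by fun_prop), bessel]
  congr 2
  ext ξ
  rw [Pi.mul_apply, ← Real.rpow_add (by positivity)]
  congr 1
  ring

theorem bessel_zero (f : 𝓢(Eu m, F)) : bessel 0 f = f := by
  simp [bessel]

theorem norm_toLp_bessel_le {s t : ℝ} (h : s ≤ t) (f : 𝓢(Eu m, F)) :
    ‖(bessel s f).toLp 2‖ ≤ ‖(bessel t f).toLp 2‖ := by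
  have hb : ∀ s : ℝ, (fun ξ : Eu m ↦ (1 + ‖ξ‖ ^ 2) ^ (s / 2)).HasTemperateGrowth :=
    fun s ↦ by fun_prop
  refine le_of_sq_le_sq ?_ (norm_nonneg _)
  rw [bessel, bessel, norm_toLp_fourierMultiplier_sq (hb s), norm_toLp_fourierMultiplier_sq (hb t)]
  refine integral_mono (integrable_fourierMultiplier_sq (hb s) f)
    (integrable_fourierMultiplier_sq (hb t) f) fun ξ ↦ ?_
  have h1 : 1 ≤ 1 + ‖ξ‖ ^ 2 := by nlinarith [sq_nonneg ‖ξ‖]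
  simp only
  gcongr

namespace SobolevSpace

theorem toL2_surjective (s : ℝ) :
    Function.Surjective (toL2 : SobolevSpace m F s → Lp F 2 (volume : Measure (Eu m))) := by
  intro v
  have h : besselPotential (Eu m) F s (besselPotential (Eu m) F (-s)
      (Lp.toTemperedDistributionCLM F (volume : Measure (Eu m)) 2 v)) =
      Lp.toTemperedDistributionCLM F (volume : Measure (Eu m)) 2 v := by simp
  have h' : MemSobolev s 2 (besselPotential (Eu m) F (-s)
      (Lp.toTemperedDistributionCLM F (volume : Measure (Eu m)) 2 v)) := ⟨v, h⟩
  exact ⟨mk _ h', Lp_toTemperedDistribution_injective ((toL2_spec (mk _ h')).symm.trans h)⟩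

variable (m F) in
/-- The isometric isomorphism `⟨D⟩^s` from `H^s` to `L₂`. -/
def toL2Isometry (s : ℝ) : SobolevSpace m F s ≃ₗᵢ[ℂ] Lp F 2 (volume : Measure (Eu m)) :=
  LinearIsometryEquiv.ofSurjective ⟨toL2, fun _ ↦ rfl⟩ (toL2_surjective s)

instance (s : ℝ) : CompleteSpace (SobolevSpace m F s) :=
  (completeSpace_congr (e := (toL2Isometry m F s).toEquiv)
    (toL2Isometry m F s).isometry.isUniformEmbedding).2 inferInstance

/-- The inclusion factors through `L₂` as `⟨D⟩^{-s}` after the isometry `⟨D⟩^s`. It makes tempered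
distributions a common space in which operators between different Sobolev spaces can be compared. -/
theorem continuous_toDistribution (s : ℝ) :
    Continuous (toDistribution : SobolevSpace m F s → 𝓢'(Eu m, F)) := by
  have h : (toDistribution : SobolevSpace m F s → 𝓢'(Eu m, F)) = fun u ↦
      besselPotential (Eu m) F (-s) (Lp.toTemperedDistributionCLM F (volume : Measure (Eu m)) 2
        (toL2Isometry m F s u)) := by
    ext1 u
    have : toL2Isometry m F s u = toL2 u := rfl
    rw [this, ← toL2_spec]
    simp
  rw [h]
  exact (ContinuousLinearMap.continuous _).comp
    ((ContinuousLinearMap.continuous _).comp (toL2Isometry m F s).continuous)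

theorem toL2_ofSchwartz (s : ℝ) (f : 𝓢(Eu m, F)) :
    toL2 (ofSchwartz s f) = (bessel s f).toLp 2 := by
  apply Lp_toTemperedDistribution_injective
  rw [← toL2_spec, toDistribution_ofSchwartz, Lp.toTemperedDistributionCLM_apply,
    Lp.toTemperedDistribution_toLp_eq, besselPotential,
    fourierMultiplierCLM_toTemperedDistributionCLM_eq (by fun_prop)]
  congr 1
  exact SchwartzMap.fourierMultiplierCLM_ofReal ℂ
    (Function.hasTemperateGrowth_one_add_norm_sq_rpow (Eu m) (s / 2)) f

theorem norm_ofSchwartz (s : ℝ) (f : 𝓢(Eu m, F)) :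
    ‖ofSchwartz s f‖ = ‖(bessel s f).toLp 2‖ := by
  rw [norm_eq, toL2_ofSchwartz]

variable (m F) in
/-- The inclusion of the Schwartz functions into `H^s`, as a linear map. -/
def ofSchwartzₗ (s : ℝ) : 𝓢(Eu m, F) →ₗ[ℂ] SobolevSpace m F s where
  toFun := ofSchwartz s
  map_add' f g := toDistribution_injective (by simp)
  map_smul' c f := toDistribution_injective (by simp)

@[simp]
theorem ofSchwartzₗ_apply (s : ℝ) (f : 𝓢(Eu m, F)) : ofSchwartzₗ m F s f = ofSchwartz s f := rfl

/-- `⟨D⟩^s` maps the Schwartz space onto itself, so density is inherited from that of the Schwartz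
functions in `L₂` through the isometry. -/
theorem denseRange_ofSchwartz (s : ℝ) : DenseRange (ofSchwartzₗ m F s) := by
  have h1 : DenseRange fun f : 𝓢(Eu m, F) ↦ (bessel s f).toLp 2 (volume : Measure (Eu m)) := by
    have h2 : Function.Surjective (bessel (m := m) (H := F) s) := fun f ↦
      ⟨bessel (-s) f, by rw [bessel_bessel, neg_add_cancel, bessel_zero]⟩
    exact (SchwartzMap.denseRange_toLpCLM (F := F) (p := 2) (μ := (volume : Measure (Eu m)))
      (by norm_num)).comp h2.denseRange (ContinuousLinearMap.continuous _)
  have h3 : (ofSchwartzₗ m F s : 𝓢(Eu m, F) → SobolevSpace m F s) =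
      (toL2Isometry m F s).symm ∘ fun f ↦ (bessel s f).toLp 2 := by
    ext1 f
    rw [Function.comp_apply, LinearIsometryEquiv.eq_symm_apply]
    exact toL2_ofSchwartz s f
  rw [h3]
  exact (toL2Isometry m F s).symm.surjective.denseRange.comp h1
    (toL2Isometry m F s).symm.continuous

/-- `H^t ⊆ H^s` for `s ≤ t`, with continuous inclusion. -/
theorem exists_inclusion {s t : ℝ} (h : s ≤ t) :
    ∃ J : SobolevSpace m F t →L[ℂ] SobolevSpace m F s,
      ∀ u, toDistribution (J u) = toDistribution u := by
  have h1 : ∃ C : ℝ, ∀ f, ‖ofSchwartzₗ m F s f‖ ≤ C * ‖ofSchwartzₗ m F t f‖ := by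
    refine ⟨1, fun f ↦ ?_⟩
    rw [one_mul, ofSchwartzₗ_apply, ofSchwartzₗ_apply, norm_ofSchwartz, norm_ofSchwartz]
    exact norm_toLp_bessel_le h f
  refine ⟨(ofSchwartzₗ m F s).extendOfNorm (ofSchwartzₗ m F t), fun u ↦ ?_⟩
  refine congrFun ((denseRange_ofSchwartz t).equalizer
    ((continuous_toDistribution s).comp (ContinuousLinearMap.continuous _))
    (continuous_toDistribution t) ?_) u
  ext1 f
  simp only [Function.comp_apply]
  rw [LinearMap.extendOfNorm_eq (denseRange_ofSchwartz t) h1,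
    ofSchwartzₗ_apply, ofSchwartzₗ_apply, toDistribution_ofSchwartz, toDistribution_ofSchwartz]

end SobolevSpace

end SobolevSpace

/-! ### Membership in `H^s` by duality. -/

section Riesz

variable {m : ℕ} {F : Type*} [NormedAddCommGroup F] [InnerProductSpace ℂ F]

/-- The real-linear map `z ↦ z̄ h`. -/
def conjSMul (h : F) : ℂ →L[ℝ] F :=
  ((ContinuousLinearMap.toSpanSingleton ℂ h).restrictScalars ℝ).comp
    Complex.conjCLE.toContinuousLinearMap

@[simp]
theorem conjSMul_apply (h : F) (z : ℂ) : conjSMul h z = (starRingEnd ℂ) z • h := rfl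

variable {w : Eu m → F} {M : ℝ}

theorem integrable_inner_of_bounded (hw : Continuous w) (hM : ∀ x, ‖w x‖ ≤ M) (g : 𝓢(Eu m, F)) :
    Integrable fun x ↦ inner ℂ (w x) (g x) := by
  refine ((g.integrable (μ := (volume : Measure (Eu m)))).norm.const_mul M).mono'
    (hw.inner g.continuous).aestronglyMeasurable (Eventually.of_forall fun x ↦ ?_)
  refine (norm_inner_le_norm _ _).trans ?_
  gcongr
  exact hM x

variable [CompleteSpace F]

/-- Complex conjugation interchanges the Fourier transform and its inverse. Functions `z̄ h`
translate between the sesquilinear `L₂`-pairing and the action of a vector valued distribution on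
scalar test functions. -/
theorem fourier_postcomp_conjSMul (h : F) (f : 𝓢(Eu m, ℂ)) :
    (𝓕 (SchwartzMap.postcompCLM (conjSMul h) f) : 𝓢(Eu m, F)) =
      SchwartzMap.postcompCLM (conjSMul h) (𝓕⁻ f : 𝓢(Eu m, ℂ)) := by
  ext ξ
  rw [SchwartzMap.postcompCLM_apply, SchwartzMap.fourier_coe, SchwartzMap.fourierInv_coe,
    Real.fourier_eq', Real.fourierInv_eq', ← ContinuousLinearMap.integral_comp_comm]
  · congr 1
    ext x
    rw [SchwartzMap.postcompCLM_apply, conjSMul_apply, conjSMul_apply, smul_eq_mul, map_mul,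
      mul_smul, ← Complex.exp_conj, map_mul, Complex.conj_ofReal, Complex.conj_I]
    congr 2
    push_cast
    ring
  · rw [← integrable_norm_iff]
    · simpa only [norm_smul, Complex.norm_exp_ofReal_mul_I, one_mul] using
        (f.integrable (μ := (volume : Measure (Eu m)))).norm
    · exact Continuous.aestronglyMeasurable (by fun_prop)

theorem bessel_postcomp_conjSMul (s : ℝ) (h : F) (f : 𝓢(Eu m, ℂ)) :
    bessel s (SchwartzMap.postcompCLM (conjSMul h) f) = SchwartzMap.postcompCLM (conjSMul h)
      (𝓕 (SchwartzMap.smulLeftCLM ℂ (fun ξ : Eu m ↦ (((1 + ‖ξ‖ ^ 2) ^ (s / 2) : ℝ) : ℂ))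
        (𝓕⁻ f : 𝓢(Eu m, ℂ))) : 𝓢(Eu m, ℂ)) := by
  rw [bessel, SchwartzMap.fourierMultiplierCLM_apply, fourier_postcomp_conjSMul]
  set χ := SchwartzMap.smulLeftCLM ℂ (fun ξ : Eu m ↦ (((1 + ‖ξ‖ ^ 2) ^ (s / 2) : ℝ) : ℂ))
    (𝓕⁻ f : 𝓢(Eu m, ℂ)) with hχ
  have h1 := fourier_postcomp_conjSMul h (𝓕 χ : 𝓢(Eu m, ℂ))
  rw [FourierTransform.fourierInv_fourier_eq] at h1
  have h2 : SchwartzMap.smulLeftCLM F (fun ξ : Eu m ↦ (1 + ‖ξ‖ ^ 2) ^ (s / 2))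
      (SchwartzMap.postcompCLM (conjSMul h) (𝓕⁻ f : 𝓢(Eu m, ℂ))) =
      SchwartzMap.postcompCLM (conjSMul h) χ := by
    ext ξ
    rw [SchwartzMap.smulLeftCLM_apply_apply (by fun_prop), SchwartzMap.postcompCLM_apply,
      SchwartzMap.postcompCLM_apply, hχ, SchwartzMap.smulLeftCLM_apply_apply (by fun_prop),
      smul_eq_mul, ← Complex.real_smul, map_smul]
  rw [h2, ← h1, FourierTransform.fourierInv_fourier_eq]

/-- A bounded continuous function that is bounded as a functional on the Schwartz functions with
the norm of `H^{-s}` belongs to `H^s`. -/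
theorem exists_memSobolev_of_bounded (hw : Continuous w) (hM : ∀ x, ‖w x‖ ≤ M) {s K : ℝ}
    (hK0 : 0 ≤ K)
    (hK : ∀ g : 𝓢(Eu m, F), ‖∫ x, inner ℂ (g x) (w x)‖ ≤ K * ‖(bessel (-s) g).toLp 2‖)
    {u : 𝓢'(Eu m, F)} (hu : IsRepresentedBy u w) :
    ∃ h : MemSobolev s 2 u, ‖SobolevSpace.mk u h‖ ≤ K := by
  -- Placing `w` in the antilinear slot makes the functional complex linear. Inserting `⟨D⟩^s` turns
  -- the bound by the `H^{-s}`-norm into one by the `L₂`-norm, so that it extends to `L₂` and has a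
  -- Riesz representative, which will be `⟨D⟩^s u`.
  let ℓ : 𝓢(Eu m, F) →ₗ[ℂ] ℂ :=
    { toFun := fun g ↦ ∫ x, inner ℂ (w x) (bessel s g x)
      map_add' := fun f g ↦ by
        rw [← integral_add (integrable_inner_of_bounded hw hM _)
          (integrable_inner_of_bounded hw hM _)]
        simp only [bessel, map_add, add_apply, inner_add_right]
      map_smul' := fun c f ↦ by
        have : bessel s (c • f) = c • bessel s f := by
          rw [bessel, bessel, ← SchwartzMap.fourierMultiplierCLM_ofReal ℂ (by fun_prop), map_smul,
            SchwartzMap.fourierMultiplierCLM_ofReal ℂ (by fun_prop)]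
        simp only [this, smul_apply, inner_smul_right, RingHom.id_apply]
        rw [integral_const_mul, smul_eq_mul] }
  let e : 𝓢(Eu m, F) →ₗ[ℂ] Lp F 2 (volume : Measure (Eu m)) :=
    (SchwartzMap.toLpCLM ℂ F 2 (volume : Measure (Eu m))).toLinearMap
  have he : DenseRange e := SchwartzMap.denseRange_toLpCLM (F := F) (p := 2)
    (μ := (volume : Measure (Eu m))) (by norm_num)
  have hℓ : ∀ g, ‖ℓ g‖ ≤ K * ‖e g‖ := fun g ↦ by
    have h1 : ℓ g = (starRingEnd ℂ) (∫ x, inner ℂ (bessel s g x) (w x)) := by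
      rw [← integral_conj]
      simp only [inner_conj_symm]
      rfl
    have h2 := hK (bessel s g)
    rw [bessel_bessel, add_neg_cancel, bessel_zero] at h2
    rw [h1, RCLike.norm_conj]
    exact h2
  let v := (InnerProductSpace.toDual ℂ (Lp F 2 (volume : Measure (Eu m)))).symm (ℓ.extendOfNorm e)
  have hv : ∀ g : 𝓢(Eu m, F), inner ℂ v (g.toLp 2) = ∫ x, inner ℂ (w x) (bessel s g x) := by
    intro g
    rw [InnerProductSpace.toDual_symm_apply]
    exact LinearMap.extendOfNorm_eq he ⟨K, hℓ⟩ g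
  have hvK : ‖v‖ ≤ K := by
    rw [LinearIsometryEquiv.norm_map]
    exact LinearMap.opNorm_extendOfNorm_le he hK0 hℓ
  have hspec : besselPotential (Eu m) F s u =
      Lp.toTemperedDistributionCLM F (volume : Measure (Eu m)) 2 v := by
    ext φ
    rw [besselPotential, fourierMultiplierCLM_apply_apply, (hu _).2,
      Lp.toTemperedDistributionCLM_apply, Lp.toTemperedDistribution_apply]
    refine ext_inner_right ℂ fun h ↦ ?_
    -- Testing with the conjugate of `φ` times an arbitrary vector `h` recovers the inner product
    -- with `h` of the vector valued integral against `φ`.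
    have hg := hv (SchwartzMap.postcompCLM (conjSMul h) φ)
    rw [bessel_postcomp_conjSMul, L2.inner_def] at hg
    have hi : Integrable fun x ↦ φ x • v x := by
      rw [← memLp_one_iff_integrable]
      exact (Lp.memLp v).smul (φ.memLp 2 (volume : Measure (Eu m)))
    have hconj : ∀ (z : ℂ) (y : F), inner ℂ (z • y) h = inner ℂ y ((starRingEnd ℂ) z • h) := by
      intro z y
      rw [inner_smul_left, inner_smul_right]
    have hint : ∀ {q : Eu m → F}, Integrable q → inner ℂ (∫ x, q x) h = ∫ x, inner ℂ (q x) h := by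
      intro q hq
      rw [← inner_conj_symm, ← integral_inner hq, ← integral_conj]
      simp only [inner_conj_symm]
    rw [hint (hu _).1, hint hi]
    simp only [hconj]
    simp only [SchwartzMap.postcompCLM_apply, conjSMul_apply] at hg
    rw [← hg]
    refine integral_congr_ae ?_
    filter_upwards [(SchwartzMap.postcompCLM (conjSMul h) φ).coeFn_toLp 2
      (volume : Measure (Eu m))] with x hx
    rw [hx]
    rfl
  have hmem : MemSobolev s 2 u := ⟨v, hspec⟩
  have : SobolevSpace.toL2 (SobolevSpace.mk u hmem) = v :=
    SobolevSpace.Lp_toTemperedDistribution_injective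
      ((SobolevSpace.toL2_spec (SobolevSpace.mk u hmem)).symm.trans hspec)
  exact ⟨hmem, by rwa [SobolevSpace.norm_eq, this]⟩

end Riesz


/-! ### Extension by density, consistency and uniqueness. -/

section Extension

theorem IsRepresentedBy.unique {m : ℕ} {F : Type*} [NormedAddCommGroup F] [NormedSpace ℂ F]
    {u v : 𝓢'(Eu m, F)} {w : Eu m → F} (hu : IsRepresentedBy u w) (hv : IsRepresentedBy v w) :
    u = v := by
  ext φ
  rw [(hu φ).2, (hv φ).2]

variable {m N : ℕ} {τ d : ℝ} {H₀ H₁ : Type*}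
  [NormedAddCommGroup H₀] [InnerProductSpace ℂ H₀] [CompleteSpace H₀]
  [NormedAddCommGroup H₁] [InnerProductSpace ℂ H₁] [CompleteSpace H₁]
  {p : Eu m → Eu m → H₀ →L[ℂ] H₁}

theorem IsSymbol.exists_norm_OP_bound (hp : IsSymbol τ d N p) (hτ : 0 ≤ τ) (hm : 1 ≤ m)
    (f : 𝓢(Eu m, H₀)) : ∃ M, ∀ x, ‖OP p f x‖ ≤ M := by
  obtain ⟨C, -, hC⟩ := hp.exists_norm_OP_le (H₀ := H₀) hτ hm
  exact ⟨_, hC f⟩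

/-- Boundedness suffices to regard `OP(p)f` as a tempered distribution before any Sobolev regularity
is known. -/
theorem IsSymbol.memLp_OP (hp : IsSymbol τ d N p) (hτ : 0 ≤ τ) (hm : 1 ≤ m)
    (f : 𝓢(Eu m, H₀)) : MemLp (OP p f) ⊤ (volume : Measure (Eu m)) := by
  obtain ⟨M, hM⟩ := hp.exists_norm_OP_bound hτ hm f
  exact memLp_top_of_bound (hp.continuous_OP hτ hm f).aestronglyMeasurable M
    (Eventually.of_forall hM)

/-- `OP p` as a linear map from the Schwartz functions to the tempered distributions. -/
def IsSymbol.distributionOP (hp : IsSymbol τ d N p) (hτ : 0 ≤ τ) (hm : 1 ≤ m) :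
    𝓢(Eu m, H₀) →ₗ[ℂ] 𝓢'(Eu m, H₁) :=
  (Lp.toTemperedDistributionCLM H₁ (volume : Measure (Eu m)) ⊤).toLinearMap ∘ₗ
    { toFun := fun f ↦ (hp.memLp_OP hτ hm f).toLp
      map_add' := fun f g ↦ by
        rw [← MemLp.toLp_add]
        exact MemLp.toLp_congr _ _ (Eventually.of_forall fun x ↦ hp.OP_add hτ hm f g x)
      map_smul' := fun c f ↦ by
        rw [RingHom.id_apply, ← MemLp.toLp_const_smul]
        exact MemLp.toLp_congr _ _ (Eventually.of_forall fun x ↦ OP_smul c f x) }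

theorem IsSymbol.isRepresentedBy_distributionOP (hp : IsSymbol τ d N p) (hτ : 0 ≤ τ)
    (hm : 1 ≤ m) (f : 𝓢(Eu m, H₀)) :
    IsRepresentedBy (hp.distributionOP hτ hm f) (OP p f) := by
  intro φ
  constructor
  · obtain ⟨M, hM⟩ := hp.exists_norm_OP_bound hτ hm f
    refine ((φ.integrable (μ := (volume : Measure (Eu m)))).norm.mul_const M).mono'
      (φ.continuous.smul (hp.continuous_OP hτ hm f)).aestronglyMeasurable
      (Eventually.of_forall fun x ↦ ?_)
    rw [norm_smul]
    gcongr
    exact hM x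
  · have h : hp.distributionOP hτ hm f φ =
        Lp.toTemperedDistribution (hp.memLp_OP hτ hm f).toLp φ := rfl
    rw [h, Lp.toTemperedDistribution_apply]
    refine integral_congr_ae ?_
    filter_upwards [(hp.memLp_OP hτ hm f).coeFn_toLp] with x hx
    rw [hx]

theorem IsSymbol.exists_memSobolev_distributionOP (hp : IsSymbol τ d N p) (hτ : 0 ≤ τ)
    (hm : 1 ≤ m) (hN : m + 1 ≤ N) {s : ℝ} (hs : |s| < τ) :
    ∃ C : ℝ, ∀ f : 𝓢(Eu m, H₀), ∃ h : MemSobolev s 2 (hp.distributionOP hτ hm f),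
      ‖SobolevSpace.mk _ h‖ ≤ C * ‖SobolevSpace.ofSchwartz (s + d) f‖ := by
  obtain ⟨C, hC0, hC⟩ := hp.exists_norm_integral_inner_OP_le hm hN hs
  refine ⟨C, fun f ↦ ?_⟩
  obtain ⟨M, hM⟩ := hp.exists_norm_OP_bound hτ hm f
  refine exists_memSobolev_of_bounded (hp.continuous_OP hτ hm f) hM
    (by positivity) (fun g ↦ ?_) (hp.isRepresentedBy_distributionOP hτ hm f)
  rw [SobolevSpace.norm_ofSchwartz]
  exact (hC g f).trans (le_of_eq (mul_right_comm _ _ _))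

/-- `OP p` extends to a bounded operator from `H^{s+d}` to `H^s`. -/
theorem IsSymbol.exists_extension (hp : IsSymbol τ d N p) (hτ : 0 ≤ τ) (hm : 1 ≤ m)
    (hN : m + 1 ≤ N) {s : ℝ} (hs : |s| < τ) :
    ∃ P : SobolevSpace m H₀ (s + d) →L[ℂ] SobolevSpace m H₁ s, ∀ f : 𝓢(Eu m, H₀),
      (P (SobolevSpace.ofSchwartz (s + d) f)).toDistribution = hp.distributionOP hτ hm f := by
  obtain ⟨C, hC⟩ := hp.exists_memSobolev_distributionOP hτ hm hN hs
  choose hmem hbound using hC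
  let T : 𝓢(Eu m, H₀) →ₗ[ℂ] SobolevSpace m H₁ s :=
    { toFun := fun f ↦ SobolevSpace.mk _ (hmem f)
      map_add' := fun f g ↦ SobolevSpace.toDistribution_injective (by simp)
      map_smul' := fun c f ↦ SobolevSpace.toDistribution_injective (by simp) }
  refine ⟨T.extendOfNorm (SobolevSpace.ofSchwartzₗ m H₀ (s + d)), fun f ↦ ?_⟩
  have h := LinearMap.extendOfNorm_eq (f := T) (SobolevSpace.denseRange_ofSchwartz (s + d))
    ⟨C, hbound⟩ f
  rw [SobolevSpace.ofSchwartzₗ_apply] at h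
  rw [h]
  rfl

/-- Composed with the inclusion of the smaller domain into the larger one, `P` agrees with `P'` on
Schwartz functions, which are dense in the smaller domain; both maps are continuous into the
tempered distributions. -/
theorem SobolevSpace.toDistribution_eq_of_le {s s' t t' : ℝ} (h : s ≤ s')
    {P : SobolevSpace m H₀ s →L[ℂ] SobolevSpace m H₁ t}
    {P' : SobolevSpace m H₀ s' →L[ℂ] SobolevSpace m H₁ t'}
    (hP : ∀ f, (P (ofSchwartz s f)).toDistribution = (P' (ofSchwartz s' f)).toDistribution)
    {u : SobolevSpace m H₀ s} {u' : SobolevSpace m H₀ s'}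
    (hu : u.toDistribution = u'.toDistribution) :
    (P u).toDistribution = (P' u').toDistribution := by
  obtain ⟨J, hJ⟩ := exists_inclusion (m := m) (F := H₀) h
  have h1 : u = J u' := toDistribution_injective (by rw [hJ, hu])
  rw [h1]
  have h2 : ∀ f, J (ofSchwartz s' f) = ofSchwartz s f := fun f ↦ toDistribution_injective (by
    rw [hJ, toDistribution_ofSchwartz, toDistribution_ofSchwartz])
  have h3 : (fun u' ↦ (P (J u')).toDistribution) = fun u' ↦ (P' u').toDistribution :=
    (denseRange_ofSchwartz s').equalizer
      ((continuous_toDistribution t).comp (P.continuous.comp J.continuous))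
      ((continuous_toDistribution t').comp P'.continuous) (funext fun f ↦ by
        simp only [Function.comp_apply, ofSchwartzₗ_apply]
        rw [h2, hP])
  exact congrFun h3 u'

end Extension

end NonsmoothPsiDO

end

/-- For `p ∈ C^τ S^d_{1,0}(ℝᵐ × ℝᵐ, N; 𝓛(H₀, H₁))` with `N ≥ m + 1`, the operator `OP(p)`, given on
Schwartz functions by the integral formula, extends (in a unique way) to continuous operators from
`H^{s+d}(ℝᵐ; H₀)` to `H^s(ℝᵐ; H₁)` for all `|s| < τ`, which are consistent for different `s`. -/
theorem theorem3p7 {H₀ H₁ : Type*}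
    [NormedAddCommGroup H₀] [InnerProductSpace ℂ H₀] [CompleteSpace H₀]
    [NormedAddCommGroup H₁] [InnerProductSpace ℂ H₁] [CompleteSpace H₁]
    {m N : ℕ} (hm : 1 ≤ m) (hN : m + 1 ≤ N) {d τ : ℝ} (hτ : 0 < τ)
    {p : NonsmoothPsiDO.Eu m → NonsmoothPsiDO.Eu m → H₀ →L[ℂ] H₁}
    (hp : NonsmoothPsiDO.IsSymbol τ d N p) :
    ∃! P : ∀ s : ℝ, |s| < τ →
        (NonsmoothPsiDO.SobolevSpace m H₀ (s + d) →L[ℂ] NonsmoothPsiDO.SobolevSpace m H₁ s),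
      (∀ (s : ℝ) (hs : |s| < τ) (f : 𝓢(NonsmoothPsiDO.Eu m, H₀)),
        NonsmoothPsiDO.IsRepresentedBy
          (P s hs (NonsmoothPsiDO.SobolevSpace.ofSchwartz (s + d) f)).toDistribution
          (NonsmoothPsiDO.OP p f)) ∧
      ∀ (s s' : ℝ) (hs : |s| < τ) (hs' : |s'| < τ)
        (u : NonsmoothPsiDO.SobolevSpace m H₀ (s + d))
        (u' : NonsmoothPsiDO.SobolevSpace m H₀ (s' + d)),
        u.toDistribution = u'.toDistribution →
          (P s hs u).toDistribution = (P s' hs' u').toDistribution := by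
  have hP := fun (s : ℝ) (hs : |s| < τ) ↦ hp.exists_extension hτ.le hm hN hs
  choose P hP using hP
  have hrep := hp.isRepresentedBy_distributionOP hτ.le hm
  refine ⟨P, ⟨fun s hs f ↦ ?_, fun s s' hs hs' u u' hu ↦ ?_⟩, fun Q hQ ↦ ?_⟩
  · rw [hP]
    exact hrep f
  · rcases le_total s s' with h | h
    · exact NonsmoothPsiDO.SobolevSpace.toDistribution_eq_of_le (add_le_add_left h d)
        (fun f ↦ by rw [hP, hP]) hu
    · exact (NonsmoothPsiDO.SobolevSpace.toDistribution_eq_of_le (add_le_add_left h d)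
        (fun f ↦ by rw [hP, hP]) hu.symm).symm
  -- Uniqueness holds for each `s` separately: the values on the dense set of Schwartz functions are
  -- prescribed, so consistency of the competing family plays no role.
  · ext s hs : 2
    refine DFunLike.coe_injective ((NonsmoothPsiDO.SobolevSpace.denseRange_ofSchwartz (s + d)).equalizer
      (Q s hs).continuous (P s hs).continuous ?_)
    ext1 f
    refine NonsmoothPsiDO.SobolevSpace.toDistribution_injective ((hQ.1 s hs f).unique ?_)
    rw [Function.comp_apply, NonsmoothPsiDO.SobolevSpace.ofSchwartzₗ_apply, hP]
    exact hrep f
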